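/- Let $n\ge 0$, let $\mathbb S=\{z\in\mathbb C: a<\operatorname{Im} z<b\}$ with $-\infty\le a<b\le\infty$ (so $\mathbb S=\mathbb C$ is allowed), and write $z=u+iv$. Let $\mathbb R^{n+4}_1$ carry the Lorentzian inner product $-x_0y_0+\sum_{i\ge1}x_iy_i$, let $G=SO^+(1,n+3)$ be the identity component of its isometry group, acting on $S^{n+2}$ (the projectivized light cone) by conformal transformations, and let $G/K=SO^+(1,n+3)/(SO^+(1,3)\times SO(n))$ be the Grassmannian of oriented Lorentzian $4$-planes in $\mathbb R^{n+4}_1$. A smooth conformal immersion $y:\mathbb S\to S^{n+2}$ is *Willmore* if it is a critical point of $\int(|H|^2+1)\,dA$ under compactly supported variations in $S^{n+2}$. A map $g$ from $\mathbb S$ to $S^{n+2}$ or to $G/K$ is *translationally equivariant* (TE) if there is a continuous one-parameter group $R:\mathbb R\to G$ with $g(z+t)=R(t).g(z)$ for all $z\in\mathbb S$, $t\in\mathbb R$. The *canonical lift* of $y$ is $Y=|y_u|^{-1}(1,y)$, so that $\langle Y_z,Y_{\bar z}\rangle=\tfrac12$; the *oriented conformal Gauss map* $f:\mathbb S\to G/K$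 of $y$ assigns to $z$ the $4$-plane $\operatorname{span}\{Y,Y_u,Y_v,Y_{z\bar z}\}$, oriented by the orthonormal basis $\tfrac1{\sqrt2}(Y+N),\ \tfrac1{\sqrt2}(-Y+N),\ Y_u,\ Y_v$, where $N$ is the light-like vector of this plane with $\langle N,Y\rangle=-1$ and $N\perp Y_u,Y_v$. The map $f$ is *full* if the elements of $G$ fixing every $f(z)$, $z\in\mathbb S$, are exactly those of the center of $G$. A smooth map $f:\mathbb S\to G/K$ is *harmonic* if for (local) smooth frames $F$ of $f$ with $F^{-1}dF=\alpha=\alpha_{\mathfrak k}+\alpha_{\mathfrak m}$, where $\mathfrak g=\mathfrak k+\mathfrak m$ is the symmetric decomposition and $\alpha_{\mathfrak m}=\alpha_{\mathfrak m}'\,dz+\alpha_{\mathfrak m}''\,d\bar z$, the form $\alpha_\lambda=\lambda^{-1}\alpha_{\mathfrak m}'\,dz+\alpha_{\mathfrak k}+\lambda\alpha_{\mathfrak m}''\,d\bar z$ is integrable ($d\alpha_\lambda+\alpha_\lambda\wedge\alpha_\lambda=0$) for all $\lambda\in S^1$. For a real number $\omega$, $y$ is called a *TE Willmore cylinder with real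 period $\omega$* if $y$ is a TE Willmore immersion, $\omega\ne0$ and $y(z+\omega)=y(z)$ for all $z\in\mathbb S$; and $f$ is called a *TE harmonic cylinder with real period $\omega$* if $f$ is harmonic and TE, $\omega\neq0$ and $f(z+\omega)=f(z)$ for all $z\in\mathbb S$. **Theorem.** Let $y:\mathbb S\to S^{n+2}$ be a TE Willmore immersion whose oriented conformal Gauss map $f$ is full, and let $\omega\in\mathbb R$. Then $y$ is a TE Willmore cylinder with real period $\omega$ if and only if $f$ is a TE harmonic cylinder with real period $\omega$. -/

import Mathlib

noncomputable section

namespace TEWillmore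

open scoped ContDiff RealInnerProductSpace

/-! ### The group `SO⁺(1, n+3)` and the Grassmannian of oriented Lorentzian 4-planes -/

/-- The Gram matrix `diag(-1, 1, …, 1)` of the Minkowski space `ℝ^{n+4}_1`. -/
def minkowski (n : ℕ) : Matrix (Fin (n + 4)) (Fin (n + 4)) ℝ :=
  Matrix.diagonal (Fin.cons (-1) (fun _ => 1))

/-- The Lorentzian inner product of `ℝ^{n+4}_1`. -/
def mink {n : ℕ} (v w : Fin (n + 4) → ℝ) : ℝ :=
  -(v 0 * w 0) + ∑ i : Fin (n + 3), v i.succ * w i.succ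

lemma minkowski_mul_self (n : ℕ) : minkowski n * minkowski n = 1 := by
  rw [minkowski, Matrix.diagonal_mul_diagonal, ← Matrix.diagonal_one]
  congr 1
  funext i
  refine Fin.cases ?_ (fun j => ?_) i <;> simp

lemma lorentz_comm {n : ℕ} {A : Matrix (Fin (n + 4)) (Fin (n + 4)) ℝ}
    (h : A.transpose * minkowski n * A = minkowski n) :
    A * minkowski n * A.transpose = minkowski n := by
  have h1 : (minkowski n * A.transpose * minkowski n) * A = 1 := by
    rw [Matrix.mul_assoc, Matrix.mul_assoc, ← Matrix.mul_assoc A.transpose, h,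
      minkowski_mul_self]
  have h2 : A * (minkowski n * A.transpose * minkowski n) = 1 := mul_eq_one_comm.mp h1
  calc A * minkowski n * A.transpose
      = A * minkowski n * A.transpose * (minkowski n * minkowski n) := by
        rw [minkowski_mul_self, Matrix.mul_one]
    _ = (A * (minkowski n * A.transpose * minkowski n)) * minkowski n := by
        simp only [Matrix.mul_assoc]
    _ = minkowski n := by rw [h2, Matrix.one_mul]

lemma lorentz_col {n : ℕ} {A : Matrix (Fin (n + 4)) (Fin (n + 4)) ℝ}
    (h : A.transpose * minkowski n * A = minkowski n) :
    ∑ i : Fin (n + 3), A i.succ 0 ^ 2 = A 0 0 ^ 2 - 1 := by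
  have h0 := congrFun (congrFun h 0) 0
  rw [Matrix.mul_apply, minkowski] at h0
  simp only [Matrix.mul_diagonal, Matrix.transpose_apply] at h0
  rw [Fin.sum_univ_succ] at h0
  simp only [Fin.cons_zero, Fin.cons_succ, Matrix.diagonal_apply_eq] at h0
  have : ∑ i : Fin (n + 3), A i.succ 0 ^ 2 = ∑ i : Fin (n + 3), A i.succ 0 * 1 * A i.succ 0 :=
    Finset.sum_congr rfl (fun i _ => by ring)
  rw [this]
  linarith

lemma lorentz_row {n : ℕ} {A : Matrix (Fin (n + 4)) (Fin (n + 4)) ℝ}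
    (h : A.transpose * minkowski n * A = minkowski n) :
    ∑ i : Fin (n + 3), A 0 i.succ ^ 2 = A 0 0 ^ 2 - 1 := by
  have h' : A.transpose.transpose * minkowski n * A.transpose = minkowski n := by
    rw [Matrix.transpose_transpose]; exact lorentz_comm h
  simpa using lorentz_col h'

lemma timeOriented_mul {n : ℕ} {A B : Matrix (Fin (n + 4)) (Fin (n + 4)) ℝ}
    (hA : A.transpose * minkowski n * A = minkowski n) (hA0 : 0 < A 0 0)
    (hB : B.transpose * minkowski n * B = minkowski n) (hB0 : 0 < B 0 0) :
    0 < (A * B) 0 0 := by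
  rw [Matrix.mul_apply, Fin.sum_univ_succ]
  have hcs := Finset.sum_mul_sq_le_sq_mul_sq Finset.univ
    (fun i : Fin (n + 3) => A 0 i.succ) (fun i => B i.succ 0)
  rw [lorentz_row hA, lorentz_col hB] at hcs
  have ha : 0 ≤ A 0 0 ^ 2 - 1 := by
    rw [← lorentz_row hA]; exact Finset.sum_nonneg fun i _ => sq_nonneg _
  have hb : 0 ≤ B 0 0 ^ 2 - 1 := by
    rw [← lorentz_col hB]; exact Finset.sum_nonneg fun i _ => sq_nonneg _
  have hlt : (∑ i : Fin (n + 3), A 0 i.succ * B i.succ 0) ^ 2 < (A 0 0 * B 0 0) ^ 2 := by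
    nlinarith
  have := abs_lt_of_sq_lt_sq hlt (by positivity)
  linarith [(abs_lt.mp this).1]

/-- The identity component `SO⁺(1, n+3)` of the Lorentz group of `ℝ^{n+4}_1`: matrices of
determinant one that preserve the Lorentzian inner product and the future light cone. -/
def SOPlus (n : ℕ) : Subgroup (Matrix.SpecialLinearGroup (Fin (n + 4)) ℝ) where
  carrier := {A | A.1.transpose * minkowski n * A.1 = minkowski n ∧ 0 < A.1 0 0}
  one_mem' := by simp
  mul_mem' := by
    rintro A B ⟨hA, hA0⟩ ⟨hB, hB0⟩
    refine ⟨?_, timeOriented_mul hA hA0 hB hB0⟩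
    rw [Matrix.SpecialLinearGroup.coe_mul, Matrix.transpose_mul]
    calc B.1.transpose * A.1.transpose * minkowski n * (A.1 * B.1)
        = B.1.transpose * (A.1.transpose * minkowski n * A.1) * B.1 := by
          simp only [Matrix.mul_assoc]
      _ = minkowski n := by rw [hA, hB]
  inv_mem' := by
    rintro A ⟨hA, hA0⟩
    have h1 : (minkowski n * A.1.transpose * minkowski n) * A.1 = 1 := by
      rw [Matrix.mul_assoc, Matrix.mul_assoc, ← Matrix.mul_assoc A.1.transpose, hA,
        minkowski_mul_self]
    have h2 : A.1 * (A⁻¹).1 = 1 := by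
      rw [← Matrix.SpecialLinearGroup.coe_mul, mul_inv_cancel, Matrix.SpecialLinearGroup.coe_one]
    have hinv : (A⁻¹).1 = minkowski n * A.1.transpose * minkowski n :=
      (left_inv_eq_right_inv h1 h2).symm
    have ht := lorentz_comm hA
    refine ⟨?_, ?_⟩
    · rw [hinv]
      have hs : (minkowski n).transpose = minkowski n := by
        rw [minkowski, Matrix.diagonal_transpose]
      rw [Matrix.transpose_mul, Matrix.transpose_mul, hs, Matrix.transpose_transpose]
      calc minkowski n * (A.1 * minkowski n) * minkowski n *
            (minkowski n * A.1.transpose * minkowski n)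
          = minkowski n * (A.1 * minkowski n * (minkowski n * minkowski n) * A.1.transpose) *
              minkowski n := by simp only [Matrix.mul_assoc]
        _ = minkowski n := by
            rw [minkowski_mul_self, Matrix.mul_one, ht, minkowski_mul_self, Matrix.one_mul]
    · rw [hinv]
      simpa [minkowski, Matrix.mul_diagonal, Matrix.diagonal_mul] using hA0

/-- The underlying matrix of an element of `SO⁺(1, n+3)`. -/
def mat {n : ℕ} (g : SOPlus n) : Matrix (Fin (n + 4)) (Fin (n + 4)) ℝ := g.1.1

lemma mat_mul {n : ℕ} (g h : SOPlus n) : mat (g * h) = mat g * mat h := rfl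

/-- Two indices belong to the same block of the splitting `n + 4 = 4 + n`. -/
def SameBlock {n : ℕ} (i j : Fin (n + 4)) : Prop := (i.1 < 4 ↔ j.1 < 4)

instance {n : ℕ} (i j : Fin (n + 4)) : Decidable (SameBlock i j) :=
  inferInstanceAs (Decidable (i.1 < 4 ↔ j.1 < 4))

lemma toSquareBlockProp_one {n : ℕ} :
    (1 : Matrix (Fin (n + 4)) (Fin (n + 4)) ℝ).toSquareBlockProp (fun i => i.1 < 4) = 1 := by
  ext i j
  simp [Matrix.toSquareBlockProp_def, Matrix.one_apply, Subtype.ext_iff]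

lemma toSquareBlockProp_mul {n : ℕ} {A B : Matrix (Fin (n + 4)) (Fin (n + 4)) ℝ}
    (hA : ∀ i j, ¬ SameBlock i j → A i j = 0) :
    (A * B).toSquareBlockProp (fun i => i.1 < 4) =
      A.toSquareBlockProp (fun i => i.1 < 4) * B.toSquareBlockProp (fun i => i.1 < 4) := by
  have h0 : A.toBlock (fun i => i.1 < 4) (fun i => ¬ i.1 < 4) = 0 := by
    ext i j
    exact hA _ _ (fun h => j.2 (h.mp i.2))
  unfold Matrix.toSquareBlockProp
  rw [Matrix.toBlock_mul_eq_add (fun i : Fin (n + 4) => i.1 < 4) (fun i => i.1 < 4), h0,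
    Matrix.zero_mul, add_zero]

lemma mat_inv {n : ℕ} (g : SOPlus n) :
    mat g⁻¹ = minkowski n * (mat g).transpose * minkowski n := by
  have h1 : (minkowski n * (mat g).transpose * minkowski n) * mat g = 1 := by
    rw [Matrix.mul_assoc, Matrix.mul_assoc, ← Matrix.mul_assoc (mat g).transpose]
    have := g.2.1
    unfold mat
    rw [this, minkowski_mul_self]
  have h2 : mat g * mat g⁻¹ = 1 := by rw [← mat_mul, mul_inv_cancel]; rfl
  exact (left_inv_eq_right_inv h1 h2).symm

/-- The subgroup `K = SO⁺(1,3) × SO(n)` of block diagonal matrices in `SO⁺(1, n+3)` whose upper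
left `4 × 4` block (hence also the lower right `n × n` block) has determinant one. -/
def blockSubgroup (n : ℕ) : Subgroup (SOPlus n) where
  carrier := {g | (∀ i j, ¬ SameBlock i j → mat g i j = 0) ∧
    ((mat g).toSquareBlockProp (fun i => i.1 < 4)).det = 1}
  one_mem' := by
    refine ⟨fun i j h => ?_, ?_⟩
    · have : i ≠ j := fun e => h (by rw [e, SameBlock])
      exact Matrix.one_apply_ne this
    · have : mat (1 : SOPlus n) = 1 := rfl
      rw [this, toSquareBlockProp_one, Matrix.det_one]
  mul_mem' := by
    rintro g h ⟨hg, hg1⟩ ⟨hh, hh1⟩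
    refine ⟨fun i j hij => ?_, ?_⟩
    · rw [mat_mul, Matrix.mul_apply]
      refine Finset.sum_eq_zero fun k _ => ?_
      by_cases hk : SameBlock i k
      · rw [hh k j (fun hkj => hij (Iff.trans hk hkj)), mul_zero]
      · rw [hg i k hk, zero_mul]
    · rw [mat_mul, toSquareBlockProp_mul hg, Matrix.det_mul, hg1, hh1, one_mul]
  inv_mem' := by
    rintro g ⟨hg, hg1⟩
    have hinv : mat g * mat g⁻¹ = 1 := by rw [← mat_mul, mul_inv_cancel]; rfl
    refine ⟨fun i j hij => ?_, ?_⟩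
    · rw [mat_inv, minkowski, Matrix.mul_diagonal, Matrix.diagonal_mul,
        Matrix.transpose_apply, hg j i (fun h => hij h.symm)]
      simp
    · have := toSquareBlockProp_mul (B := mat g⁻¹) hg
      rw [hinv, toSquareBlockProp_one] at this
      have h2 := congrArg Matrix.det this
      rw [Matrix.det_one, Matrix.det_mul, hg1, one_mul] at h2
      exact h2.symm

/-- The symmetric space `SO⁺(1, n+3) / (SO⁺(1,3) × SO(n))`, i.e. the Grassmannian of oriented
four-dimensional Lorentzian subspaces of `ℝ^{n+4}_1`; the coset of `F` is the oriented subspace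
spanned by the first four columns of `F`. -/
abbrev Gr (n : ℕ) : Type := SOPlus n ⧸ blockSubgroup n

/-! ### Surfaces in the sphere `S^{n+2}` -/

/-- The ambient Euclidean space `ℝ^{n+3}` of the sphere `S^{n+2}`. -/
abbrev Euc (n : ℕ) : Type := EuclideanSpace ℝ (Fin (n + 3))

/-- The horizontal open strip `{z | a < Im z < b}`, where `a = -∞` and `b = ∞` are allowed. -/
def strip (a b : EReal) : Set ℂ := {z | a < (z.im : EReal) ∧ (z.im : EReal) < b}

/-- Partial derivative with respect to `u`, where `z = u + i v`. -/
def du {E : Type*} [NormedAddCommGroup E] [NormedSpace ℝ E] (y : ℂ → E) (z : ℂ) : E :=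
  fderiv ℝ y z 1

/-- Partial derivative with respect to `v`, where `z = u + i v`. -/
def dv {E : Type*} [NormedAddCommGroup E] [NormedSpace ℝ E] (y : ℂ → E) (z : ℂ) : E :=
  fderiv ℝ y z Complex.I

/-- `y` is a smooth conformal immersion of the open set `Ω ⊆ ℂ` into the unit sphere `S^{n+2}`. -/
structure IsConformalImmersion {n : ℕ} (Ω : Set ℂ) (y : ℂ → Euc n) : Prop where
  smooth : ContDiffOn ℝ ∞ y Ω
  mem_sphere : ∀ z ∈ Ω, ‖y z‖ = 1
  norm_eq : ∀ z ∈ Ω, ‖du y z‖ = ‖dv y z‖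
  orthogonal : ∀ z ∈ Ω, ⟪du y z, dv y z⟫ = 0
  immersed : ∀ z ∈ Ω, du y z ≠ 0

/-- The determinant `EG - F²` of the first fundamental form of `x`. -/
def gramDet {n : ℕ} (x : ℂ → Euc n) (z : ℂ) : ℝ :=
  ⟪du x z, du x z⟫ * ⟪dv x z, dv x z⟫ - ⟪du x z, dv x z⟫ ^ 2

/-- The component of `w` orthogonal to `x(z)`, `x_u(z)` and `x_v(z)`, for an immersion `x` into
the unit sphere. -/
def normalPart {n : ℕ} (x : ℂ → Euc n) (z : ℂ) (w : Euc n) : Euc n :=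
  w - ⟪w, x z⟫ • x z
    - ((⟪dv x z, dv x z⟫ * ⟪w, du x z⟫ - ⟪du x z, dv x z⟫ * ⟪w, dv x z⟫) / gramDet x z) • du x z
    - ((⟪du x z, du x z⟫ * ⟪w, dv x z⟫ - ⟪du x z, dv x z⟫ * ⟪w, du x z⟫) / gramDet x z) • dv x z

/-- The mean curvature vector `H = (G II(u,u) - 2 F II(u,v) + E II(v,v)) / (2 (EG - F²))` of an
immersion `x` into the unit sphere; it is normal to the surface and tangent to the sphere. -/
def meanCurvature {n : ℕ} (x : ℂ → Euc n) (z : ℂ) : Euc n :=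
  (1 / (2 * gramDet x z)) • normalPart x z
    (⟪dv x z, dv x z⟫ • du (du x) z - (2 * ⟪du x z, dv x z⟫) • dv (du x) z
      + ⟪du x z, du x z⟫ • dv (dv x) z)

/-- The integrand `(|H|² + 1) dA` of the Willmore functional of surfaces in the unit sphere. -/
def willmoreDensity {n : ℕ} (x : ℂ → Euc n) (z : ℂ) : ℝ :=
  (‖meanCurvature x z‖ ^ 2 + 1) * Real.sqrt (gramDet x z)

/-- `Y` is a smooth variation of `y : Ω → S^{n+2}` through maps into the sphere which is supported
in the set `C`. -/
structure IsVariation {n : ℕ} (Ω : Set ℂ) (y : ℂ → Euc n) (C : Set ℂ) (Y : ℝ → ℂ → Euc n) :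
    Prop where
  smooth : ContDiffOn ℝ ∞ (fun p : ℝ × ℂ => Y p.1 p.2) (Set.univ ×ˢ Ω)
  mem_sphere : ∀ t, ∀ z ∈ Ω, ‖Y t z‖ = 1
  initial : ∀ z ∈ Ω, Y 0 z = y z
  support : ∀ t, ∀ z ∈ Ω \ C, Y t z = y z

/-- `y` is a critical point of the Willmore functional `∫ (|H|² + 1) dA` with respect to all
compactly supported variations. -/
def IsWillmore {n : ℕ} (Ω : Set ℂ) (y : ℂ → Euc n) : Prop :=
  ∀ (C : Set ℂ) (Y : ℝ → ℂ → Euc n), IsCompact C → C ⊆ Ω → IsVariation Ω y C Y →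
    HasDerivAt (fun t : ℝ => ∫ z in C, willmoreDensity (Y t) z) 0 0

/-! ### One-parameter groups and translational equivariance -/

/-- `R : ℝ → SO⁺(1, n+3)` is a (continuous) one-parameter group. -/
structure IsOneParameterGroup {n : ℕ} (R : ℝ → SOPlus n) : Prop where
  map_add : ∀ s t, R (s + t) = R s * R t
  continuous : ∀ i j, Continuous fun t => mat (R t) i j

/-- The light-like vector `(1, p) ∈ ℝ^{n+4}_1` over a point `p` of the unit sphere. -/
def lightVec {n : ℕ} (p : Euc n) : Fin (n + 4) → ℝ := Fin.cons 1 (fun i => p i)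

/-- The conformal action of `SO⁺(1, n+3)` on the unit sphere `S^{n+2}`, seen as the projectivized
light cone: `g (1, p)` is a positive multiple of `(1, g.p)`. -/
def sphereAct {n : ℕ} (g : SOPlus n) (p : Euc n) : Euc n :=
  WithLp.toLp 2 fun i : Fin (n + 3) =>
    (mat g).mulVec (lightVec p) i.succ / (mat g).mulVec (lightVec p) 0

/-- The surface `y` is translationally equivariant (TE). -/
def IsTESurface {n : ℕ} (Ω : Set ℂ) (y : ℂ → Euc n) : Prop :=
  ∃ R : ℝ → SOPlus n, IsOneParameterGroup R ∧
    ∀ z ∈ Ω, ∀ t : ℝ, y (z + (t : ℂ)) = sphereAct (R t) (y z)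

/-- The map `f` into the Grassmannian is translationally equivariant (TE). -/
def IsTEMap {n : ℕ} (Ω : Set ℂ) (f : ℂ → Gr n) : Prop :=
  ∃ R : ℝ → SOPlus n, IsOneParameterGroup R ∧
    ∀ z ∈ Ω, ∀ t : ℝ, f (z + (t : ℂ)) = R t • f z

/-- A TE Willmore surface: a translationally equivariant conformal immersion that is a critical
point of the Willmore functional. -/
structure IsTEWillmoreSurface {n : ℕ} (Ω : Set ℂ) (y : ℂ → Euc n) : Prop where
  conformal : IsConformalImmersion Ω y
  willmore : IsWillmore Ω y
  equivariant : IsTESurface Ω y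

/-! ### The oriented conformal Gauss map -/

/-- The canonical lift `Y = |y_u|⁻¹ (1, y)` into the light cone, for which
`⟨Y_z, Y_{\bar z}⟩ = 1/2`, i.e. `⟨Y_u, Y_u⟩ = ⟨Y_v, Y_v⟩ = 1`. -/
def canonicalLift {n : ℕ} (y : ℂ → Euc n) (z : ℂ) : Fin (n + 4) → ℝ :=
  ‖du y z‖⁻¹ • lightVec (y z)

/-- The Laplacian `Y_uu + Y_vv = 4 Y_{z \bar z}` of the canonical lift. -/
def laplaceLift {n : ℕ} (y : ℂ → Euc n) (z : ℂ) : Fin (n + 4) → ℝ :=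
  du (du (canonicalLift y)) z + dv (dv (canonicalLift y)) z

/-- The light-like section `N` of `span {Y, Y_u, Y_v, Y_{z \bar z}}` with `⟨N, Y⟩ = -1` and
`⟨N, Y_u⟩ = ⟨N, Y_v⟩ = 0`, namely `N = ½ ΔY + ⅛ ⟨ΔY, ΔY⟩ Y`. -/
def dualLift {n : ℕ} (y : ℂ → Euc n) (z : ℂ) : Fin (n + 4) → ℝ :=
  (1 / 2 : ℝ) • laplaceLift y z
    + (mink (laplaceLift y z) (laplaceLift y z) / 8) • canonicalLift y z

/-- The oriented orthonormal basis `((Y + N)/√2, (-Y + N)/√2, Y_u, Y_v)` of the Lorentzian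
four-plane `span {Y, Y_u, Y_v, Y_{z \bar z}}` at `z`. -/
def gaussBasis {n : ℕ} (y : ℂ → Euc n) (z : ℂ) : Fin 4 → Fin (n + 4) → ℝ :=
  ![(Real.sqrt 2)⁻¹ • (canonicalLift y z + dualLift y z),
    (Real.sqrt 2)⁻¹ • (-canonicalLift y z + dualLift y z),
    du (canonicalLift y) z,
    dv (canonicalLift y) z]

/-- `f` is the oriented conformal Gauss map of `y` on `Ω`: at each point, `f z` is the class of a
matrix `F ∈ SO⁺(1, n+3)` whose first four columns are
`((Y + N)/√2, (-Y + N)/√2, Y_u, Y_v)`. (All such `F` lie in the same coset.) -/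
def IsConformalGaussMap {n : ℕ} (Ω : Set ℂ) (y : ℂ → Euc n) (f : ℂ → Gr n) : Prop :=
  ∀ z ∈ Ω, ∃ F : SOPlus n, f z = (F : Gr n) ∧
    ∀ (j : Fin 4) (i : Fin (n + 4)),
      mat F i (Fin.castLE (Nat.le_add_left 4 n) j) = gaussBasis y z j i

/-- The map `f` is full: the only elements of `SO⁺(1, n+3)` that fix `f` pointwise are those in
the center. -/
def IsFull {n : ℕ} (Ω : Set ℂ) (f : ℂ → Gr n) : Prop :=
  {R : SOPlus n | ∀ z ∈ Ω, R • f z = f z} = (Subgroup.center (SOPlus n) : Set (SOPlus n))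

/-! ### Harmonic maps into the Grassmannian -/

/-- `F` is a smooth frame of `f` on `U`. -/
structure IsFrame {n : ℕ} (U : Set ℂ) (f : ℂ → Gr n) (F : ℂ → SOPlus n) : Prop where
  smooth : ∀ i j, ContDiffOn ℝ ∞ (fun z => mat (F z) i j) U
  lifts : ∀ z ∈ U, f z = (F z : Gr n)

/-- The `du`-coefficient `F⁻¹ F_u` of the Maurer–Cartan form `α = F⁻¹ dF`. -/
def mcU {n : ℕ} (F : ℂ → SOPlus n) (z : ℂ) : Matrix (Fin (n + 4)) (Fin (n + 4)) ℝ :=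
  mat (F z)⁻¹ * Matrix.of fun i j => du (fun w => mat (F w) i j) z

/-- The `dv`-coefficient `F⁻¹ F_v` of the Maurer–Cartan form `α = F⁻¹ dF`. -/
def mcV {n : ℕ} (F : ℂ → SOPlus n) (z : ℂ) : Matrix (Fin (n + 4)) (Fin (n + 4)) ℝ :=
  mat (F z)⁻¹ * Matrix.of fun i j => dv (fun w => mat (F w) i j) z

/-- The component in `𝔨` (block diagonal part) of a matrix, complexified. -/
def kPart {n : ℕ} (A : Matrix (Fin (n + 4)) (Fin (n + 4)) ℝ) :
    Matrix (Fin (n + 4)) (Fin (n + 4)) ℂ :=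
  Matrix.of fun i j => if SameBlock i j then (A i j : ℂ) else 0

/-- The component in `𝔪` (off-diagonal blocks) of a matrix, complexified. -/
def mPart {n : ℕ} (A : Matrix (Fin (n + 4)) (Fin (n + 4)) ℝ) :
    Matrix (Fin (n + 4)) (Fin (n + 4)) ℂ :=
  Matrix.of fun i j => if SameBlock i j then 0 else (A i j : ℂ)

/-- The coefficient `α'_𝔪` of `dz` in the `𝔪`-part of `α = F⁻¹ dF`. -/
def mcM' {n : ℕ} (F : ℂ → SOPlus n) (z : ℂ) : Matrix (Fin (n + 4)) (Fin (n + 4)) ℂ :=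
  (1 / 2 : ℂ) • (mPart (mcU F z) - Complex.I • mPart (mcV F z))

/-- The coefficient `α''_𝔪` of `d\bar z` in the `𝔪`-part of `α = F⁻¹ dF`. -/
def mcM'' {n : ℕ} (F : ℂ → SOPlus n) (z : ℂ) : Matrix (Fin (n + 4)) (Fin (n + 4)) ℂ :=
  (1 / 2 : ℂ) • (mPart (mcU F z) + Complex.I • mPart (mcV F z))

/-- The `du`-coefficient of `α_l = l⁻¹ α'_𝔪 dz + α_𝔨 + l α''_𝔪 d\bar z`. -/
def loopU {n : ℕ} (F : ℂ → SOPlus n) (l : ℂ) (z : ℂ) : Matrix (Fin (n + 4)) (Fin (n + 4)) ℂ :=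
  kPart (mcU F z) + l⁻¹ • mcM' F z + l • mcM'' F z

/-- The `dv`-coefficient of `α_l = l⁻¹ α'_𝔪 dz + α_𝔨 + l α''_𝔪 d\bar z`. -/
def loopV {n : ℕ} (F : ℂ → SOPlus n) (l : ℂ) (z : ℂ) : Matrix (Fin (n + 4)) (Fin (n + 4)) ℂ :=
  kPart (mcV F z) + Complex.I • (l⁻¹ • mcM' F z - l • mcM'' F z)

/-- The form `α_l` is integrable on `U`, that is `dα_l + α_l ∧ α_l = 0`. -/
def LoopIntegrable {n : ℕ} (U : Set ℂ) (F : ℂ → SOPlus n) (l : ℂ) : Prop :=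
  ∀ z ∈ U, ∀ i j,
    du (fun w => loopV F l w i j) z - dv (fun w => loopU F l w i j) z
      + (loopU F l z * loopV F l z - loopV F l z * loopU F l z) i j = 0

/-- `f` is a (primitive) harmonic map into the symmetric space `Gr n`: near every point it has a
smooth frame whose Maurer–Cartan form `α` gives rise to an integrable form `α_l` for every
`l ∈ S¹`. (The condition does not depend on the frame.) -/
def IsHarmonicMap {n : ℕ} (Ω : Set ℂ) (f : ℂ → Gr n) : Prop :=
  ∀ z₀ ∈ Ω, ∃ (U : Set ℂ) (F : ℂ → SOPlus n), IsOpen U ∧ z₀ ∈ U ∧ U ⊆ Ω ∧ IsFrame U f F ∧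
    ∀ l : ℂ, ‖l‖ = 1 → LoopIntegrable U F l

/-! ### Cylinders -/

/-- `y` is a TE Willmore cylinder with real period `p`: a TE Willmore surface on the strip `Ω` that
descends to the cylinder `Ω / pℤ`. -/
structure IsTEWillmoreCylinder {n : ℕ} (Ω : Set ℂ) (y : ℂ → Euc n) (p : ℝ) : Prop where
  surface : IsTEWillmoreSurface Ω y
  period_ne : p ≠ 0
  periodic : ∀ z ∈ Ω, y (z + (p : ℂ)) = y z

/-- `f` is a TE harmonic cylinder with real period `p`: a TE harmonic map on the strip `Ω` that
descends to the cylinder `Ω / pℤ`. -/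
structure IsTEHarmonicCylinder {n : ℕ} (Ω : Set ℂ) (f : ℂ → Gr n) (p : ℝ) : Prop where
  harmonic : IsHarmonicMap Ω f
  equivariant : IsTEMap Ω f
  period_ne : p ≠ 0
  periodic : ∀ z ∈ Ω, f (z + (p : ℂ)) = f z

end TEWillmore

end

/-! Both directions rest on the naturality of the conformal Gauss map (`gaussMap_equivariant`). If a
translation of `y` is realised by `g` in the group, the same `g` realises that translation of `f`.
Thus `f` is translationally equivariant under the very one-parameter group `R` that moves `y`. If
`y` has period `ω`, naturality with `g = 1` gives the period of `f`. Conversely, if `f` has period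
`ω`, then `R ω` fixes every `f z`. Fullness puts `R ω` in the center, the center is trivial
(`eq_one_of_mem_center`), and `y (z + ω) = R ω . y z = y z`.

The remaining claim, which takes most of the work, is that the Gauss map of a Willmore immersion is
harmonic (`isHarmonicMap_of_isWillmore`). On the analytic side, `|H|² + 1 = |Δ_g x|² / 4` for
surfaces in the unit sphere. With `ν = H - y = Δy / (2 |y_u|²)`, the first variation at a conformal
immersion is `⟨ν, Δη⟩` minus the pairing of a stress tensor with `dη`. Integration by parts and
variations in the direction of the Euler–Lagrange operator itself give `eulerLagrange_eq_zero`.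

On the geometric side, `f` is encoded by the field `Q` of reflections fixing the 4-planes. The
harmonic map equation becomes the vanishing of `∂_u (Q_u Q) + ∂_v (Q_v Q)`. Applied to `(1, y)`,
`(0, y_u)`, `(0, y_v)` this matrix vanishes by conformality alone. Applied to `(0, Δy)` it vanishes
by the component of the Euler–Lagrange equation normal to the 4-plane (`tension_mulVec_gaussBasis`).
Skewness then kills the whole matrix.

In an adapted frame, passing to `α_l` rotates the `𝔪`-part by an angle. Its curvature is a
combination of the two parts of the Maurer–Cartan equation and the tension, so it vanishes for every
`l` (`loopIntegrable_of_frameTension`). -/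

noncomputable section

namespace TEWillmore

open scoped ContDiff RealInnerProductSpace Topology

/-! ### Directional derivatives of smooth maps on open subsets of the plane. -/

section Calculus

variable {E E' : Type*} [NormedAddCommGroup E] [NormedSpace ℝ E]
  [NormedAddCommGroup E'] [NormedSpace ℝ E']

/-- The derivative of `f` at `z` in the direction `h`. -/
def dd (h : ℂ) (f : ℂ → E) (z : ℂ) : E := fderiv ℝ f z h

lemma du_eq_dd (f : ℂ → E) : du f = dd 1 f := rfl

lemma dv_eq_dd (f : ℂ → E) : dv f = dd Complex.I f := rfl

variable {Ω : Set ℂ} {f g : ℂ → E} {z : ℂ}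

lemma isOpen_strip (a b : EReal) : IsOpen (strip a b) := by
  have hc : Continuous fun z : ℂ => (z.im : EReal) :=
    continuous_coe_real_ereal.comp Complex.continuous_im
  exact (isOpen_lt continuous_const hc).inter (isOpen_lt hc continuous_const)

lemma diffAt_of_smooth (hΩ : IsOpen Ω) (hf : ContDiffOn ℝ ∞ f Ω) (hz : z ∈ Ω) :
    DifferentiableAt ℝ f z :=
  (hf.contDiffAt (hΩ.mem_nhds hz)).differentiableAt (by simp)

lemma smooth_dd (hΩ : IsOpen Ω) (hf : ContDiffOn ℝ ∞ f Ω) (h : ℂ) :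
    ContDiffOn ℝ ∞ (dd h f) Ω :=
  (hf.fderiv_of_isOpen hΩ (m := ∞) (by simp)).clm_apply contDiffOn_const

lemma smooth_du (hΩ : IsOpen Ω) (hf : ContDiffOn ℝ ∞ f Ω) : ContDiffOn ℝ ∞ (du f) Ω :=
  smooth_dd hΩ hf 1

lemma smooth_dv (hΩ : IsOpen Ω) (hf : ContDiffOn ℝ ∞ f Ω) : ContDiffOn ℝ ∞ (dv f) Ω :=
  smooth_dd hΩ hf Complex.I

lemma dd_congr (hΩ : IsOpen Ω) (h : ℂ) (hfg : ∀ w ∈ Ω, f w = g w) (hz : z ∈ Ω) :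
    dd h f z = dd h g z := by
  have : f =ᶠ[𝓝 z] g := Filter.eventually_of_mem (hΩ.mem_nhds hz) hfg
  rw [dd, dd, this.fderiv_eq]

lemma dd_const (h : ℂ) (c : E) (z : ℂ) : dd h (fun _ => c) z = 0 := by
  simp [dd]

lemma dd_add (h : ℂ) (hf : DifferentiableAt ℝ f z) (hg : DifferentiableAt ℝ g z) :
    dd h (fun w => f w + g w) z = dd h f z + dd h g z := by
  simp [dd, fderiv_fun_add hf hg]

lemma dd_sub (h : ℂ) (hf : DifferentiableAt ℝ f z) (hg : DifferentiableAt ℝ g z) :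
    dd h (fun w => f w - g w) z = dd h f z - dd h g z := by
  simp [dd, fderiv_fun_sub hf hg]

lemma dd_const_smul (h : ℂ) (c : ℝ) (hf : DifferentiableAt ℝ f z) :
    dd h (fun w => c • f w) z = c • dd h f z := by
  simp [dd, fderiv_fun_const_smul hf]

lemma dd_smul (h : ℂ) {a : ℂ → ℝ} (ha : DifferentiableAt ℝ a z) (hf : DifferentiableAt ℝ f z) :
    dd h (fun w => a w • f w) z = dd h a z • f z + a z • dd h f z := by
  simp [dd, fderiv_fun_smul ha hf, add_comm]

lemma dd_mul (h : ℂ) {a b : ℂ → ℝ} (ha : DifferentiableAt ℝ a z) (hb : DifferentiableAt ℝ b z) :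
    dd h (fun w => a w * b w) z = dd h a z * b z + a z * dd h b z := dd_smul h ha hb

lemma dd_clm (h : ℂ) (T : E →L[ℝ] E') (hf : DifferentiableAt ℝ f z) :
    dd h (fun w => T (f w)) z = T (dd h f z) := by
  have := (T.hasFDerivAt.comp z hf.hasFDerivAt).fderiv
  rw [dd, dd]
  exact congrArg (fun L : ℂ →L[ℝ] E' => L h) this

lemma dd_sum {ι : Type*} (s : Finset ι) (h : ℂ) {F : ι → ℂ → E}
    (hF : ∀ i ∈ s, DifferentiableAt ℝ (F i) z) :
    dd h (fun w => ∑ i ∈ s, F i w) z = ∑ i ∈ s, dd h (F i) z := by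
  simp [dd, fderiv_fun_sum hF]

lemma dd_inner {F : Type*} [NormedAddCommGroup F] [InnerProductSpace ℝ F] {f g : ℂ → F} (h : ℂ)
    (hf : DifferentiableAt ℝ f z) (hg : DifferentiableAt ℝ g z) :
    dd h (fun w => ⟪f w, g w⟫) z = ⟪dd h f z, g z⟫ + ⟪f z, dd h g z⟫ := by
  rw [dd, fderiv_inner_apply ℝ hf hg, add_comm]
  rfl

lemma dd_comm (hΩ : IsOpen Ω) (hf : ContDiffOn ℝ ∞ f Ω) (hz : z ∈ Ω) (h k : ℂ) :
    dd h (dd k f) z = dd k (dd h f) z := by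
  have hs : IsSymmSndFDerivAt ℝ f z :=
    (hf.contDiffAt (hΩ.mem_nhds hz)).isSymmSndFDerivAt
      (by simpa using ENat.LEInfty.out)
  have hd : DifferentiableAt ℝ (fderiv ℝ f) z :=
    ((hf.fderiv_of_isOpen hΩ (m := ∞) (by simp)).contDiffAt (hΩ.mem_nhds hz)).differentiableAt
      (by simp)
  have key (k h : ℂ) : dd h (dd k f) z = fderiv ℝ (fderiv ℝ f) z h k :=
    dd_clm h (ContinuousLinearMap.apply ℝ E k) hd
  rw [key, key]
  exact hs h k

lemma dd_translate (h : ℂ) (c : ℂ) (f : ℂ → E) (z : ℂ) :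
    dd h (fun w => f (w + c)) z = dd h f (z + c) := by
  rw [dd, fderiv_comp_add_right, dd]

/-- Smoothness on `Ω` together with vanishing off a closed subset implies global smoothness. -/
lemma contDiff_of_tsupport_subset (hΩ : IsOpen Ω) (hf : ContDiffOn ℝ ∞ f Ω)
    (hs : tsupport f ⊆ Ω) : ContDiff ℝ ∞ f := by
  rw [contDiff_iff_contDiffAt]
  intro z
  by_cases hz : z ∈ tsupport f
  · exact hf.contDiffAt (hΩ.mem_nhds (hs hz))
  · have h0 : f =ᶠ[𝓝 z] fun _ => 0 :=
      notMem_tsupport_iff_eventuallyEq.mp hz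
    exact contDiffAt_const.congr_of_eventuallyEq h0

open MeasureTheory in
lemma integral_dd_eq_zero {X : ℂ → ℝ} (hX : ContDiff ℝ ∞ X) (hc : HasCompactSupport X) (h : ℂ) :
    ∫ z, dd h X z = 0 := by
  have h1 : Continuous (fun z => fderiv ℝ X z h) :=
    (hX.continuous_fderiv (by simp)).clm_apply continuous_const
  have h2 : HasCompactSupport (fun z => fderiv ℝ X z h) :=
    (hc.fderiv_apply (𝕜 := ℝ) h)
  -- Integration by parts against the constant function `1`, whose derivative is zero.
  have := integral_mul_fderiv_eq_neg_fderiv_mul_of_integrable (μ := (volume : Measure ℂ))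
    (f := fun _ : ℂ => (1 : ℝ)) (g := X) (v := h) (by simp)
    (by simpa using h1.integrable_of_hasCompactSupport h2)
    (by simpa using hX.continuous.integrable_of_hasCompactSupport hc)
    (fun _ _ => differentiableAt_const _) (fun x _ => hX.differentiable (by simp) x)
  simpa [dd] using this

end Calculus

/-! ### Smooth one-parameter families and differentiation under the integral. -/

section Families

open MeasureTheory Set

/-- Differentiation under the integral sign over a compact set, for a smooth integrand. -/
lemma hasDerivAt_setIntegral_of_contDiffOn {W : Set (ℝ × ℂ)} (hW : IsOpen W) {Φ : ℝ × ℂ → ℝ}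
    (hΦ : ContDiffOn ℝ ∞ Φ W) {C : Set ℂ} (hC : IsCompact C)
    (hCW : ({0} : Set ℝ) ×ˢ C ⊆ W) :
    HasDerivAt (fun t => ∫ z in C, Φ (t, z)) (∫ z in C, fderiv ℝ Φ (0, z) (1, 0)) 0 := by
  -- The integrand is smooth only on `W`. The tube lemma yields one `ε` for which all times up to
  -- `ε` stay in `W` over the whole compact set. Compactness of that tube bounds the time derivative
  -- and so provides the dominating constant.
  obtain ⟨U, V, hU, -, hU0, hCV, hUV⟩ := generalized_tube_lemma isCompact_singleton hC hW hCW
  obtain ⟨ε, hε, hεU⟩ := Metric.nhds_basis_closedBall.mem_iff.mp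
    (hU.mem_nhds (hU0 rfl))
  have hsub : Metric.closedBall (0 : ℝ) ε ×ˢ C ⊆ W :=
    (prod_mono hεU hCV).trans hUV
  have hfd : ContinuousOn (fun p => fderiv ℝ Φ p (1, 0)) W :=
    (hΦ.continuousOn_fderiv_of_isOpen hW (by simp)).clm_apply continuousOn_const
  obtain ⟨M, hM⟩ := ((isCompact_closedBall (0 : ℝ) ε).prod hC).exists_bound_of_continuousOn
    (hfd.mono hsub)
  have hsec {E : Type} [NormedAddCommGroup E] {Ψ : ℝ × ℂ → E} (hΨ : ContinuousOn Ψ W) {t : ℝ}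
      (ht : t ∈ Metric.closedBall (0 : ℝ) ε) : ContinuousOn (fun z => Ψ (t, z)) C :=
    hΨ.comp (by fun_prop) fun z hz => hsub ⟨ht, hz⟩
  have hmem0 : (0 : ℝ) ∈ Metric.closedBall (0 : ℝ) ε := Metric.mem_closedBall_self hε.le
  have hnhds : Metric.closedBall (0 : ℝ) ε ∈ 𝓝 (0 : ℝ) := Metric.closedBall_mem_nhds _ hε
  refine (hasDerivAt_integral_of_dominated_loc_of_deriv_le (μ := volume.restrict C)
    (F := fun t z => Φ (t, z)) (F' := fun t z => fderiv ℝ Φ (t, z) (1, 0))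
    (bound := fun _ => M) hnhds ?_ ?_ ?_ ?_ ?_ ?_).2
  · filter_upwards [hnhds] with t ht
    exact (hsec hΦ.continuousOn ht).aestronglyMeasurable_of_isCompact hC hC.measurableSet
  · exact (hsec hΦ.continuousOn hmem0).integrableOn_compact hC
  · exact (hsec hfd hmem0).aestronglyMeasurable_of_isCompact hC hC.measurableSet
  · filter_upwards [ae_restrict_mem hC.measurableSet] with z hz t ht
    exact hM (t, z) ⟨ht, hz⟩
  · exact integrableOn_const hC.measure_lt_top.ne
  · filter_upwards [ae_restrict_mem hC.measurableSet] with z hz t ht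
    have hd : DifferentiableAt ℝ Φ (t, z) :=
      (hΦ.contDiffAt (hW.mem_nhds (hsub ⟨ht, hz⟩))).differentiableAt (by simp)
    have hp : HasDerivAt (fun t : ℝ => (t, z)) ((1 : ℝ), (0 : ℂ)) t :=
      (hasDerivAt_id t).prodMk (hasDerivAt_const t z)
    exact hd.hasFDerivAt.comp_hasDerivAt t hp

variable {E : Type*} [NormedAddCommGroup E] [NormedSpace ℝ E]

/-- `Y` is a smooth one-parameter family of maps on `Ω`. -/
def SmoothFamily (Ω : Set ℂ) (Y : ℝ → ℂ → E) : Prop :=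
  ContDiffOn ℝ ∞ (fun p : ℝ × ℂ => Y p.1 p.2) (univ ×ˢ Ω)

variable {Ω : Set ℂ} {Y : ℝ → ℂ → E} {z : ℂ}

lemma SmoothFamily.contDiffAt (hΩ : IsOpen Ω) (hY : SmoothFamily Ω Y) (t : ℝ) (hz : z ∈ Ω) :
    ContDiffAt ℝ ∞ (fun p : ℝ × ℂ => Y p.1 p.2) (t, z) :=
  ContDiffOn.contDiffAt hY ((isOpen_univ.prod hΩ).mem_nhds ⟨mem_univ _, hz⟩)

lemma SmoothFamily.slice (hY : SmoothFamily Ω Y) (t : ℝ) : ContDiffOn ℝ ∞ (Y t) Ω :=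
  ContDiffOn.comp (f := fun z : ℂ => (t, z)) hY (by fun_prop) fun _ hz => ⟨mem_univ _, hz⟩

lemma SmoothFamily.hasDerivAt (hΩ : IsOpen Ω) (hY : SmoothFamily Ω Y) (t : ℝ) (hz : z ∈ Ω) :
    HasDerivAt (fun s => Y s z) (fderiv ℝ (fun p : ℝ × ℂ => Y p.1 p.2) (t, z) (1, 0)) t := by
  have hp : HasDerivAt (fun s : ℝ => (s, z)) ((1 : ℝ), (0 : ℂ)) t :=
    (hasDerivAt_id t).prodMk (hasDerivAt_const t z)
  exact ((hY.contDiffAt hΩ t hz).differentiableAt (by simp)).hasFDerivAt.comp_hasDerivAt t hp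

lemma SmoothFamily.dd_eq (hΩ : IsOpen Ω) (hY : SmoothFamily Ω Y) (h : ℂ) (t : ℝ) (hz : z ∈ Ω) :
    dd h (Y t) z = fderiv ℝ (fun p : ℝ × ℂ => Y p.1 p.2) (t, z) (0, h) := by
  have h1 := ((hY.contDiffAt hΩ t hz).differentiableAt (by simp)).hasFDerivAt.comp z
    ((hasFDerivAt_const t z).prodMk (hasFDerivAt_id z))
  have h2 : fderiv ℝ (Y t) z = _ := h1.fderiv
  rw [dd, h2]
  simp

lemma SmoothFamily.dd (hΩ : IsOpen Ω) (hY : SmoothFamily Ω Y) (h : ℂ) :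
    SmoothFamily Ω (fun t => dd h (Y t)) := by
  have h1 : ContDiffOn ℝ ∞ (fun p => fderiv ℝ (fun p : ℝ × ℂ => Y p.1 p.2) p (0, h))
      (univ ×ˢ Ω) :=
    (ContDiffOn.fderiv_of_isOpen hY (isOpen_univ.prod hΩ) (m := ∞) (by simp)).clm_apply
      contDiffOn_const
  exact h1.congr fun p hp => hY.dd_eq hΩ h p.1 hp.2

/-- Differentiation with respect to the parameter commutes with directional derivatives. -/
lemma SmoothFamily.hasDerivAt_dd (hΩ : IsOpen Ω) (hY : SmoothFamily Ω Y) {η : ℂ → E} {t : ℝ}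
    (hη : ∀ w ∈ Ω, HasDerivAt (fun s => Y s w) (η w) t) (h : ℂ) (hz : z ∈ Ω) :
    HasDerivAt (fun s => TEWillmore.dd h (Y s) z) (TEWillmore.dd h η z) t := by
  set G : ℝ × ℂ → E := fun p => Y p.1 p.2 with hG
  have hopen := isOpen_univ.prod hΩ (X := ℝ)
  have hc := hY.contDiffAt hΩ t hz
  have hs : IsSymmSndFDerivAt ℝ G (t, z) :=
    hc.isSymmSndFDerivAt (by simpa using ENat.LEInfty.out)
  have hd : DifferentiableAt ℝ (fderiv ℝ G) (t, z) :=
    ((ContDiffOn.fderiv_of_isOpen hY hopen (m := ∞) (by simp)).contDiffAt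
      (hopen.mem_nhds ⟨mem_univ _, hz⟩)).differentiableAt (by simp)
  have key (v : ℝ × ℂ) : HasFDerivAt (fun p => fderiv ℝ G p v)
      ((ContinuousLinearMap.apply ℝ E v).comp (fderiv ℝ (fderiv ℝ G) (t, z))) (t, z) :=
    (ContinuousLinearMap.apply ℝ E v).hasFDerivAt.comp _ hd.hasFDerivAt
  have h1 : HasDerivAt (fun s => fderiv ℝ G (s, z) (0, h))
      (fderiv ℝ (fderiv ℝ G) (t, z) (1, 0) (0, h)) t := by
    have hp : HasDerivAt (fun s : ℝ => (s, z)) ((1 : ℝ), (0 : ℂ)) t :=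
      (hasDerivAt_id t).prodMk (hasDerivAt_const t z)
    exact (key (0, h)).comp_hasDerivAt t hp
  have h2 : TEWillmore.dd h η z = fderiv ℝ (fderiv ℝ G) (t, z) (0, h) (1, 0) := by
    have e : ∀ w ∈ Ω, η w = fderiv ℝ G (t, w) (1, 0) := fun w hw =>
      (hη w hw).unique (hY.hasDerivAt hΩ t hw)
    rw [dd_congr hΩ h e hz]
    have := ((key (1, 0)).comp z ((hasFDerivAt_const t z).prodMk (hasFDerivAt_id z))).fderiv
    have h3 : fderiv ℝ (fun w => fderiv ℝ G (t, w) (1, 0)) z = _ := this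
    rw [TEWillmore.dd, h3]
    simp
  rw [h2, hs (0, h) (1, 0)]
  exact h1.congr_of_eventuallyEq (Filter.Eventually.of_forall fun s => hY.dd_eq hΩ h s hz)

end Families

/-! ### The Willmore density in terms of the first fundamental form. -/

section Density

variable {n : ℕ} {Ω : Set ℂ} {Y : ℝ → ℂ → Euc n} {z : ℂ}

lemma SmoothFamily.contDiffAt_gramDet (hΩ : IsOpen Ω) (hY : SmoothFamily Ω Y) (t : ℝ)
    (hz : z ∈ Ω) : ContDiffAt ℝ ∞ (fun p : ℝ × ℂ => gramDet (Y p.1) p.2) (t, z) := by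
  have hu := (hY.dd hΩ 1).contDiffAt hΩ t hz
  have hv := (hY.dd hΩ Complex.I).contDiffAt hΩ t hz
  exact ((hu.inner ℝ hu).mul (hv.inner ℝ hv)).sub ((hu.inner ℝ hv).pow 2)

lemma SmoothFamily.contDiffAt_willmoreDensity (hΩ : IsOpen Ω) (hY : SmoothFamily Ω Y) (t : ℝ)
    (hz : z ∈ Ω) (hD : gramDet (Y t) z ≠ 0) :
    ContDiffAt ℝ ∞ (fun p : ℝ × ℂ => willmoreDensity (Y p.1) p.2) (t, z) := by
  have hx := hY.contDiffAt hΩ t hz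
  have hu : ContDiffAt ℝ ∞ (fun p : ℝ × ℂ => du (Y p.1) p.2) (t, z) :=
    (hY.dd hΩ 1).contDiffAt hΩ t hz
  have hv : ContDiffAt ℝ ∞ (fun p : ℝ × ℂ => dv (Y p.1) p.2) (t, z) :=
    (hY.dd hΩ Complex.I).contDiffAt hΩ t hz
  have huu : ContDiffAt ℝ ∞ (fun p : ℝ × ℂ => du (du (Y p.1)) p.2) (t, z) :=
    ((hY.dd hΩ 1).dd hΩ 1).contDiffAt hΩ t hz
  have huv : ContDiffAt ℝ ∞ (fun p : ℝ × ℂ => dv (du (Y p.1)) p.2) (t, z) :=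
    ((hY.dd hΩ 1).dd hΩ Complex.I).contDiffAt hΩ t hz
  have hvv : ContDiffAt ℝ ∞ (fun p : ℝ × ℂ => dv (dv (Y p.1)) p.2) (t, z) :=
    ((hY.dd hΩ Complex.I).dd hΩ Complex.I).contDiffAt hΩ t hz
  have hG := hY.contDiffAt_gramDet hΩ t hz
  have hE := hu.inner ℝ hu
  have hF := hu.inner ℝ hv
  have hGG := hv.inner ℝ hv
  have hw := ((hGG.smul huu).sub ((contDiffAt_const (c := (2 : ℝ)).mul hF).smul huv)).add
    (hE.smul hvv)
  have hnp := ((hw.sub ((hw.inner ℝ hx).smul hx)).sub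
    ((((hGG.mul (hw.inner ℝ hu)).sub (hF.mul (hw.inner ℝ hv))).div hG hD).smul hu)).sub
    ((((hE.mul (hw.inner ℝ hv)).sub (hF.mul (hw.inner ℝ hu))).div hG hD).smul hv)
  have hH := (contDiffAt_const (c := (1 : ℝ)).div (contDiffAt_const (c := (2 : ℝ)).mul hG)
    (mul_ne_zero two_ne_zero hD)).smul hnp
  exact ((hH.norm_sq ℝ).add contDiffAt_const).mul (hG.sqrt hD)

/-- The first and second jets of a map into the unit sphere. -/
lemma inner_dd_of_sphere (hΩ : IsOpen Ω) {x : ℂ → Euc n} (hx : ContDiffOn ℝ ∞ x Ω)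
    (h1 : ∀ w ∈ Ω, ‖x w‖ = 1) (h : ℂ) (hz : z ∈ Ω) : ⟪dd h x z, x z⟫ = 0 := by
  have e : dd h (fun w => ⟪x w, x w⟫) z = dd h (fun _ => (1 : ℝ)) z :=
    dd_congr hΩ h (fun w hw => by rw [real_inner_self_eq_norm_sq, h1 w hw, one_pow]) hz
  rw [dd_const, dd_inner h (diffAt_of_smooth hΩ hx hz) (diffAt_of_smooth hΩ hx hz),
    real_inner_comm] at e
  rw [real_inner_comm]
  linarith

lemma inner_dd_dd_of_sphere (hΩ : IsOpen Ω) {x : ℂ → Euc n} (hx : ContDiffOn ℝ ∞ x Ω)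
    (h1 : ∀ w ∈ Ω, ‖x w‖ = 1) (h k : ℂ) (hz : z ∈ Ω) :
    ⟪dd k (dd h x) z, x z⟫ = -⟪dd h x z, dd k x z⟫ := by
  have e : dd k (fun w => ⟪dd h x w, x w⟫) z = dd k (fun _ => (0 : ℝ)) z :=
    dd_congr hΩ k (fun w hw => inner_dd_of_sphere hΩ hx h1 h hw) hz
  rw [dd_const, dd_inner k (diffAt_of_smooth hΩ (smooth_dd hΩ hx h) hz)
    (diffAt_of_smooth hΩ hx hz)] at e
  linarith

/-- The coefficient vector `G x_uu - 2 F x_uv + E x_vv`. -/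
def mixedLaplacian (x : ℂ → Euc n) (z : ℂ) : Euc n :=
  ⟪dv x z, dv x z⟫ • du (du x) z - (2 * ⟪du x z, dv x z⟫) • dv (du x) z
    + ⟪du x z, du x z⟫ • dv (dv x) z

/-- The Willmore density of a surface in the unit sphere, through `|H|² + 1 = |Δ_g x|² / 4`. -/
lemma willmoreDensity_eq (hΩ : IsOpen Ω) {x : ℂ → Euc n} (hx : ContDiffOn ℝ ∞ x Ω)
    (h1 : ∀ w ∈ Ω, ‖x w‖ = 1) (hz : z ∈ Ω) (hD : gramDet x z ≠ 0) :
    willmoreDensity x z =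
      (⟪mixedLaplacian x z, mixedLaplacian x z⟫ -
        (⟪dv x z, dv x z⟫ * ⟪mixedLaplacian x z, du x z⟫ ^ 2
          - 2 * ⟪du x z, dv x z⟫ * ⟪mixedLaplacian x z, du x z⟫ * ⟪mixedLaplacian x z, dv x z⟫
          + ⟪du x z, du x z⟫ * ⟪mixedLaplacian x z, dv x z⟫ ^ 2) / gramDet x z)
        / (4 * gramDet x z ^ 2) * Real.sqrt (gramDet x z) := by
  have hux : ⟪du x z, x z⟫ = 0 := inner_dd_of_sphere hΩ hx h1 1 hz
  have hvx : ⟪dv x z, x z⟫ = 0 := inner_dd_of_sphere hΩ hx h1 Complex.I hz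
  have huux : ⟪du (du x) z, x z⟫ = -⟪du x z, du x z⟫ := inner_dd_dd_of_sphere hΩ hx h1 1 1 hz
  have huvx : ⟪dv (du x) z, x z⟫ = -⟪du x z, dv x z⟫ :=
    inner_dd_dd_of_sphere hΩ hx h1 1 Complex.I hz
  have hvvx : ⟪dv (dv x) z, x z⟫ = -⟪dv x z, dv x z⟫ :=
    inner_dd_dd_of_sphere hΩ hx h1 Complex.I Complex.I hz
  have hxx : ⟪x z, x z⟫ = 1 := by rw [real_inner_self_eq_norm_sq, h1 z hz, one_pow]
  -- The component along `x` is forced by `|x| = 1`. After division by `2D`, where `D = EG - F²`,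
  -- its square is exactly the summand `1` in `|H|² + 1`.
  have hwx : ⟪mixedLaplacian x z, x z⟫ = -2 * gramDet x z := by
    simp only [mixedLaplacian, inner_add_left, inner_sub_left, real_inner_smul_left, huux, huvx,
      hvvx, gramDet]
    ring
  have hH : meanCurvature x z = (1 / (2 * gramDet x z)) • normalPart x z (mixedLaplacian x z) :=
    rfl
  rw [willmoreDensity, hH, norm_smul, mul_pow, ← real_inner_self_eq_norm_sq (normalPart _ _ _)]
  congr 1
  have hxu := hux
  have hxv := hvx
  have hvu := real_inner_comm (du x z) (dv x z)
  rw [real_inner_comm] at hxu hxv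
  have hxw := hwx
  have huw := real_inner_comm (du x z) (mixedLaplacian x z)
  have hvw := real_inner_comm (dv x z) (mixedLaplacian x z)
  rw [real_inner_comm] at hxw
  have hDdef : gramDet x z =
    ⟪du x z, du x z⟫ * ⟪dv x z, dv x z⟫ - ⟪du x z, dv x z⟫ ^ 2 := rfl
  simp only [normalPart, inner_sub_left, inner_sub_right, real_inner_smul_left,
    real_inner_smul_right, hwx, hxw, hxx, hux, hvx, hxu, hxv, hvu, huw, hvw, Real.norm_eq_abs,
    sq_abs]
  generalize ⟪mixedLaplacian x z, mixedLaplacian x z⟫ = s at *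
  generalize ⟪mixedLaplacian x z, du x z⟫ = a at *
  generalize ⟪mixedLaplacian x z, dv x z⟫ = b at *
  generalize ⟪du x z, du x z⟫ = E at *
  generalize ⟪dv x z, dv x z⟫ = G at *
  generalize ⟪du x z, dv x z⟫ = F at *
  generalize gramDet x z = D at *
  field_simp
  subst hDdef
  ring

/-- The tangential correction is quadratic in `a` and `b`, which vanish at time `0`, so it does not
contribute. What is differentiated is `s / (4 D^(3/2))`, with `D = m²` and `D' = m (E' + G')` at
time `0`. -/
lemma hasDerivAt_density_aux {s E F G a b : ℝ → ℝ} {s' E' F' G' a' b' m : ℝ}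
    (hm : 0 < m) (hs : HasDerivAt s s' 0) (hE : HasDerivAt E E' 0) (hF : HasDerivAt F F' 0)
    (hG : HasDerivAt G G' 0) (ha : HasDerivAt a a' 0) (hb : HasDerivAt b b' 0)
    (hE0 : E 0 = m) (hF0 : F 0 = 0) (hG0 : G 0 = m) (ha0 : a 0 = 0) (hb0 : b 0 = 0) :
    HasDerivAt (fun t => (s t - (G t * a t ^ 2 - 2 * F t * a t * b t + E t * b t ^ 2)
        / (E t * G t - F t ^ 2)) / (4 * (E t * G t - F t ^ 2) ^ 2)
        * Real.sqrt (E t * G t - F t ^ 2))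
      (s' / (4 * m ^ 3) - 3 / 8 * s 0 * (E' + G') / m ^ 4) 0 := by
  have hD := (hE.fun_mul hG).fun_sub (hF.fun_pow 2)
  have hD0 : E 0 * G 0 - F 0 ^ 2 = m ^ 2 := by rw [hE0, hG0, hF0]; ring
  have hDne : E 0 * G 0 - F 0 ^ 2 ≠ 0 := by rw [hD0]; positivity
  have hq := ((((hG.fun_mul (ha.fun_pow 2)).fun_sub (((hF.const_mul 2).fun_mul ha).fun_mul hb)).fun_add
    (hE.fun_mul (hb.fun_pow 2))).fun_div hD hDne)
  have h4 : 4 * (E 0 * G 0 - F 0 ^ 2) ^ 2 ≠ 0 := by positivity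
  have := (((hs.fun_sub hq).fun_div ((hD.fun_pow 2).const_mul 4) h4).fun_mul (hD.sqrt hDne))
  refine this.congr_deriv ?_
  simp only [hE0, hG0, hF0, ha0, hb0]
  have hsq : Real.sqrt (m * m - 0 ^ 2) = m := by
    rw [show m * m - 0 ^ 2 = m * m by ring, Real.sqrt_mul_self hm.le]
  rw [hsq]
  field_simp
  ring

end Density

/-! ### First variation and Euler–Lagrange operator at a conformal immersion. -/

section Conformal

/-- The flat Laplacian `f_uu + f_vv`. -/
def lap {E : Type*} [NormedAddCommGroup E] [NormedSpace ℝ E] (f : ℂ → E) (z : ℂ) : E :=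
  du (du f) z + dv (dv f) z

lemma smooth_lap {E : Type*} [NormedAddCommGroup E] [NormedSpace ℝ E] {Ω : Set ℂ} {f : ℂ → E}
    (hΩ : IsOpen Ω) (hf : ContDiffOn ℝ ∞ f Ω) : ContDiffOn ℝ ∞ (lap f) Ω :=
  (smooth_du hΩ (smooth_du hΩ hf)).add (smooth_dv hΩ (smooth_dv hΩ hf))

variable {n : ℕ} {Ω : Set ℂ} {y : ℂ → Euc n} {z : ℂ}

/-- The conformal factor `|y_u|²`. -/
def conf (y : ℂ → Euc n) (z : ℂ) : ℝ := ⟪du y z, du y z⟫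

/-- Half the Laplace–Beltrami operator of a conformal map, `Δy / (2 |y_u|²)`; for surfaces in the
unit sphere this is `H - y`. -/
def meanVec (y : ℂ → Euc n) (z : ℂ) : Euc n := (1 / (2 * conf y z)) • lap y z

/-- The real part `y_uu - y_vv` of `4 y_zz`. -/
def hopfRe (y : ℂ → Euc n) (z : ℂ) : Euc n := du (du y) z - dv (dv y) z

/-- The imaginary part `2 y_uv` of `-4 y_zz`. -/
def hopfIm (y : ℂ → Euc n) (z : ℂ) : Euc n := (2 : ℝ) • dv (du y) z

/-- `coefRe` and `coefIm` are twice the entries of the trace-free part of the second fundamental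
form in the direction `meanVec y`, divided by the conformal factor. They form the trace-free part of
the stress tensor below. -/
def coefRe (y : ℂ → Euc n) (z : ℂ) : ℝ := ⟪meanVec y z, hopfRe y z⟫ / conf y z

def coefIm (y : ℂ → Euc n) (z : ℂ) : ℝ := ⟪meanVec y z, hopfIm y z⟫ / conf y z

/-- The first order part of the stress of the Willmore functional, `du`-component. -/
def stressU (y : ℂ → Euc n) (z : ℂ) : Euc n :=
  (⟪meanVec y z, meanVec y z⟫ + coefRe y z) • du y z + coefIm y z • dv y z

/-- The first order part of the stress of the Willmore functional, `dv`-component. -/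
def stressV (y : ℂ → Euc n) (z : ℂ) : Euc n :=
  coefIm y z • du y z + (⟪meanVec y z, meanVec y z⟫ - coefRe y z) • dv y z

/-- The Euler–Lagrange operator of the Willmore functional at a conformal immersion. -/
def eulerLagrange (y : ℂ → Euc n) (z : ℂ) : Euc n :=
  lap (meanVec y) z + (du (stressU y) z + dv (stressV y) z)

lemma conf_pos (hy : IsConformalImmersion Ω y) (hz : z ∈ Ω) : 0 < conf y z :=
  real_inner_self_pos.mpr (hy.immersed z hz)

lemma inner_dv_dv (hy : IsConformalImmersion Ω y) (hz : z ∈ Ω) :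
    ⟪dv y z, dv y z⟫ = conf y z := by
  rw [conf, real_inner_self_eq_norm_sq, real_inner_self_eq_norm_sq, hy.norm_eq z hz]

lemma inner_dv_du (hy : IsConformalImmersion Ω y) (hz : z ∈ Ω) : ⟪dv y z, du y z⟫ = 0 := by
  rw [real_inner_comm, hy.orthogonal z hz]

lemma smooth_conf (hΩ : IsOpen Ω) (hy : IsConformalImmersion Ω y) :
    ContDiffOn ℝ ∞ (conf y) Ω :=
  (smooth_du hΩ hy.smooth).inner ℝ (smooth_du hΩ hy.smooth)

lemma smooth_meanVec (hΩ : IsOpen Ω) (hy : IsConformalImmersion Ω y) :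
    ContDiffOn ℝ ∞ (meanVec y) Ω :=
  (contDiffOn_const.div (contDiffOn_const.mul (smooth_conf hΩ hy)) fun _ hz =>
    mul_ne_zero two_ne_zero (conf_pos hy hz).ne').smul (smooth_lap hΩ hy.smooth)

lemma smooth_hopfRe (hΩ : IsOpen Ω) (hy : IsConformalImmersion Ω y) :
    ContDiffOn ℝ ∞ (hopfRe y) Ω :=
  (smooth_du hΩ (smooth_du hΩ hy.smooth)).sub (smooth_dv hΩ (smooth_dv hΩ hy.smooth))

lemma smooth_hopfIm (hΩ : IsOpen Ω) (hy : IsConformalImmersion Ω y) :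
    ContDiffOn ℝ ∞ (hopfIm y) Ω :=
  (smooth_dv hΩ (smooth_du hΩ hy.smooth)).const_smul (2 : ℝ)

lemma smooth_coefRe (hΩ : IsOpen Ω) (hy : IsConformalImmersion Ω y) :
    ContDiffOn ℝ ∞ (coefRe y) Ω :=
  ((smooth_meanVec hΩ hy).inner ℝ (smooth_hopfRe hΩ hy)).div (smooth_conf hΩ hy)
    fun _ hz => (conf_pos hy hz).ne'

lemma smooth_coefIm (hΩ : IsOpen Ω) (hy : IsConformalImmersion Ω y) :
    ContDiffOn ℝ ∞ (coefIm y) Ω :=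
  ((smooth_meanVec hΩ hy).inner ℝ (smooth_hopfIm hΩ hy)).div (smooth_conf hΩ hy)
    fun _ hz => (conf_pos hy hz).ne'

lemma smooth_normMeanVec (hΩ : IsOpen Ω) (hy : IsConformalImmersion Ω y) :
    ContDiffOn ℝ ∞ (fun z => ⟪meanVec y z, meanVec y z⟫) Ω :=
  (smooth_meanVec hΩ hy).inner ℝ (smooth_meanVec hΩ hy)

lemma smooth_stressU (hΩ : IsOpen Ω) (hy : IsConformalImmersion Ω y) :
    ContDiffOn ℝ ∞ (stressU y) Ω :=
  (((smooth_normMeanVec hΩ hy).add (smooth_coefRe hΩ hy)).smul (smooth_du hΩ hy.smooth)).add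
    ((smooth_coefIm hΩ hy).smul (smooth_dv hΩ hy.smooth))

lemma smooth_stressV (hΩ : IsOpen Ω) (hy : IsConformalImmersion Ω y) :
    ContDiffOn ℝ ∞ (stressV y) Ω :=
  ((smooth_coefIm hΩ hy).smul (smooth_du hΩ hy.smooth)).add
    (((smooth_normMeanVec hΩ hy).sub (smooth_coefRe hΩ hy)).smul (smooth_dv hΩ hy.smooth))

lemma smooth_eulerLagrange (hΩ : IsOpen Ω) (hy : IsConformalImmersion Ω y) :
    ContDiffOn ℝ ∞ (eulerLagrange y) Ω :=
  (smooth_lap hΩ (smooth_meanVec hΩ hy)).add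
    ((smooth_du hΩ (smooth_stressU hΩ hy)).add (smooth_dv hΩ (smooth_stressV hΩ hy)))

lemma dd_conf (hΩ : IsOpen Ω) (hy : IsConformalImmersion Ω y) (hz : z ∈ Ω) (h : ℂ) :
    dd h (conf y) z = 2 * ⟪dd h (du y) z, du y z⟫ := by
  have hd := diffAt_of_smooth hΩ (smooth_du hΩ hy.smooth) hz
  have : dd h (conf y) z = _ := dd_inner h hd hd
  rw [this, real_inner_comm]
  ring

lemma dd_conf' (hΩ : IsOpen Ω) (hy : IsConformalImmersion Ω y) (hz : z ∈ Ω) (h : ℂ) :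
    dd h (conf y) z = 2 * ⟪dd h (dv y) z, dv y z⟫ := by
  have hd := diffAt_of_smooth hΩ (smooth_dv hΩ hy.smooth) hz
  rw [dd_congr hΩ h (fun w hw => (inner_dv_dv hy hw).symm) hz, dd_inner h hd hd, real_inner_comm]
  ring

lemma inner_dd_du_dv (hΩ : IsOpen Ω) (hy : IsConformalImmersion Ω y) (hz : z ∈ Ω) (h : ℂ) :
    ⟪dd h (du y) z, dv y z⟫ = -⟪dd h (dv y) z, du y z⟫ := by
  have e : dd h (fun w => ⟪du y w, dv y w⟫) z = dd h (fun _ => (0 : ℝ)) z :=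
    dd_congr hΩ h hy.orthogonal hz
  rw [dd_const, dd_inner h (diffAt_of_smooth hΩ (smooth_du hΩ hy.smooth) hz)
    (diffAt_of_smooth hΩ (smooth_dv hΩ hy.smooth) hz), real_inner_comm (dd h (dv y) z)] at e
  linarith

lemma du_dv_eq (hΩ : IsOpen Ω) (hy : IsConformalImmersion Ω y) (hz : z ∈ Ω) :
    du (dv y) z = dv (du y) z := dd_comm hΩ hy.smooth hz 1 Complex.I

/-- This and the next five lemmas are the Christoffel symbols of the metric `conf y (du² + dv²)`,
obtained by differentiating `|y_u|² = |y_v|² = conf y` and `⟨y_u, y_v⟩ = 0`. -/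
lemma inner_uu_u (hΩ : IsOpen Ω) (hy : IsConformalImmersion Ω y) (hz : z ∈ Ω) :
    ⟪du (du y) z, du y z⟫ = du (conf y) z / 2 := by
  have := dd_conf hΩ hy hz 1
  simp only [← du_eq_dd] at this
  linarith

lemma inner_uv_u (hΩ : IsOpen Ω) (hy : IsConformalImmersion Ω y) (hz : z ∈ Ω) :
    ⟪dv (du y) z, du y z⟫ = dv (conf y) z / 2 := by
  have := dd_conf hΩ hy hz Complex.I
  simp only [← dv_eq_dd] at this
  linarith

lemma inner_uv_v (hΩ : IsOpen Ω) (hy : IsConformalImmersion Ω y) (hz : z ∈ Ω) :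
    ⟪dv (du y) z, dv y z⟫ = du (conf y) z / 2 := by
  have := dd_conf' hΩ hy hz 1
  simp only [← du_eq_dd, du_dv_eq hΩ hy hz] at this
  linarith

lemma inner_vv_v (hΩ : IsOpen Ω) (hy : IsConformalImmersion Ω y) (hz : z ∈ Ω) :
    ⟪dv (dv y) z, dv y z⟫ = dv (conf y) z / 2 := by
  have := dd_conf' hΩ hy hz Complex.I
  simp only [← dv_eq_dd] at this
  linarith

lemma inner_uu_v (hΩ : IsOpen Ω) (hy : IsConformalImmersion Ω y) (hz : z ∈ Ω) :
    ⟪du (du y) z, dv y z⟫ = -(dv (conf y) z / 2) := by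
  have := inner_dd_du_dv hΩ hy hz 1
  simp only [← du_eq_dd, du_dv_eq hΩ hy hz, inner_uv_u hΩ hy hz] at this
  exact this

lemma inner_vv_u (hΩ : IsOpen Ω) (hy : IsConformalImmersion Ω y) (hz : z ∈ Ω) :
    ⟪dv (dv y) z, du y z⟫ = -(du (conf y) z / 2) := by
  have := inner_dd_du_dv hΩ hy hz Complex.I
  simp only [← dv_eq_dd, inner_uv_v hΩ hy hz] at this
  linarith

/-- The Christoffel terms cancel: in conformal coordinates the flat Laplacian is `conf y` times the
Laplace–Beltrami operator, which produces a normal vector. -/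
lemma inner_lap_du (hΩ : IsOpen Ω) (hy : IsConformalImmersion Ω y) (hz : z ∈ Ω) :
    ⟪lap y z, du y z⟫ = 0 := by
  rw [lap, inner_add_left, inner_uu_u hΩ hy hz, inner_vv_u hΩ hy hz]
  ring

lemma inner_lap_dv (hΩ : IsOpen Ω) (hy : IsConformalImmersion Ω y) (hz : z ∈ Ω) :
    ⟪lap y z, dv y z⟫ = 0 := by
  rw [lap, inner_add_left, inner_uu_v hΩ hy hz, inner_vv_v hΩ hy hz]
  ring

lemma inner_du_self (hΩ : IsOpen Ω) (hy : IsConformalImmersion Ω y) (hz : z ∈ Ω) :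
    ⟪du y z, y z⟫ = 0 := inner_dd_of_sphere hΩ hy.smooth hy.mem_sphere 1 hz

lemma inner_dv_self (hΩ : IsOpen Ω) (hy : IsConformalImmersion Ω y) (hz : z ∈ Ω) :
    ⟪dv y z, y z⟫ = 0 := inner_dd_of_sphere hΩ hy.smooth hy.mem_sphere Complex.I hz

lemma inner_uu_self (hΩ : IsOpen Ω) (hy : IsConformalImmersion Ω y) (hz : z ∈ Ω) :
    ⟪du (du y) z, y z⟫ = -conf y z :=
  inner_dd_dd_of_sphere hΩ hy.smooth hy.mem_sphere 1 1 hz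

lemma inner_uv_self (hΩ : IsOpen Ω) (hy : IsConformalImmersion Ω y) (hz : z ∈ Ω) :
    ⟪dv (du y) z, y z⟫ = 0 := by
  have := inner_dd_dd_of_sphere hΩ hy.smooth hy.mem_sphere 1 Complex.I hz
  simp only [← du_eq_dd, ← dv_eq_dd, hy.orthogonal z hz, neg_zero] at this
  exact this

lemma inner_vv_self (hΩ : IsOpen Ω) (hy : IsConformalImmersion Ω y) (hz : z ∈ Ω) :
    ⟪dv (dv y) z, y z⟫ = -conf y z := by
  have := inner_dd_dd_of_sphere hΩ hy.smooth hy.mem_sphere Complex.I Complex.I hz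
  simp only [← dv_eq_dd, inner_dv_dv hy hz] at this
  exact this

lemma lap_eq_smul_meanVec (hy : IsConformalImmersion Ω y) (hz : z ∈ Ω) :
    lap y z = (2 * conf y z) • meanVec y z := by
  have := (conf_pos hy hz).ne'
  rw [meanVec, smul_smul, mul_one_div_cancel (mul_ne_zero two_ne_zero this), one_smul]

lemma inner_meanVec_du (hΩ : IsOpen Ω) (hy : IsConformalImmersion Ω y) (hz : z ∈ Ω) :
    ⟪meanVec y z, du y z⟫ = 0 := by
  rw [meanVec, real_inner_smul_left, inner_lap_du hΩ hy hz, mul_zero]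

lemma inner_meanVec_dv (hΩ : IsOpen Ω) (hy : IsConformalImmersion Ω y) (hz : z ∈ Ω) :
    ⟪meanVec y z, dv y z⟫ = 0 := by
  rw [meanVec, real_inner_smul_left, inner_lap_dv hΩ hy hz, mul_zero]

/-- In `meanVec y = H - y`, the vector `H` is tangent to the sphere, so only `-⟨y, y⟩` survives. -/
lemma inner_meanVec_self (hΩ : IsOpen Ω) (hy : IsConformalImmersion Ω y) (hz : z ∈ Ω) :
    ⟪meanVec y z, y z⟫ = -1 := by
  have := (conf_pos hy hz).ne'
  rw [meanVec, real_inner_smul_left, lap, inner_add_left, inner_uu_self hΩ hy hz,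
    inner_vv_self hΩ hy hz]
  field_simp
  ring

/-- Differentiating an orthogonality relation turns derivatives of `meanVec y` into second
derivatives of `y`. The tension computation on `meanVec y` relies on this. -/
lemma inner_dd_meanVec_du (hΩ : IsOpen Ω) (hy : IsConformalImmersion Ω y) (hz : z ∈ Ω) (h : ℂ) :
    ⟪dd h (meanVec y) z, du y z⟫ = -⟪meanVec y z, dd h (du y) z⟫ := by
  have e : dd h (fun w => ⟪meanVec y w, du y w⟫) z = dd h (fun _ => (0 : ℝ)) z :=
    dd_congr hΩ h (fun w hw => inner_meanVec_du hΩ hy hw) hz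
  rw [dd_const, dd_inner h (diffAt_of_smooth hΩ (smooth_meanVec hΩ hy) hz)
    (diffAt_of_smooth hΩ (smooth_du hΩ hy.smooth) hz)] at e
  linarith

lemma inner_dd_meanVec_dv (hΩ : IsOpen Ω) (hy : IsConformalImmersion Ω y) (hz : z ∈ Ω) (h : ℂ) :
    ⟪dd h (meanVec y) z, dv y z⟫ = -⟪meanVec y z, dd h (dv y) z⟫ := by
  have e : dd h (fun w => ⟪meanVec y w, dv y w⟫) z = dd h (fun _ => (0 : ℝ)) z :=
    dd_congr hΩ h (fun w hw => inner_meanVec_dv hΩ hy hw) hz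
  rw [dd_const, dd_inner h (diffAt_of_smooth hΩ (smooth_meanVec hΩ hy) hz)
    (diffAt_of_smooth hΩ (smooth_dv hΩ hy.smooth) hz)] at e
  linarith

lemma inner_dd_meanVec_self (hΩ : IsOpen Ω) (hy : IsConformalImmersion Ω y) (hz : z ∈ Ω) (h : ℂ) :
    ⟪dd h (meanVec y) z, y z⟫ = -⟪meanVec y z, dd h y z⟫ := by
  have e : dd h (fun w => ⟪meanVec y w, y w⟫) z = dd h (fun _ => (-1 : ℝ)) z :=
    dd_congr hΩ h (fun w hw => inner_meanVec_self hΩ hy hw) hz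
  rw [dd_const, dd_inner h (diffAt_of_smooth hΩ (smooth_meanVec hΩ hy) hz)
    (diffAt_of_smooth hΩ hy.smooth hz)] at e
  linarith

/-- Since `⟨meanVec y, y⟩` is constant and `meanVec y` is normal, both derivatives can be moved onto
`y`. This leaves `⟨meanVec y, Δy⟩`. -/
lemma inner_lap_meanVec_self (hΩ : IsOpen Ω) (hy : IsConformalImmersion Ω y) (hz : z ∈ Ω) :
    ⟪lap (meanVec y) z, y z⟫ = 2 * conf y z * ⟪meanVec y z, meanVec y z⟫ := by
  have hν := smooth_meanVec hΩ hy
  have hu : ⟪du (du (meanVec y)) z, y z⟫ = ⟪meanVec y z, du (du y) z⟫ := by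
    have e : dd 1 (fun w => ⟪dd 1 (meanVec y) w, y w⟫) z = dd 1 (fun _ => (0 : ℝ)) z :=
      dd_congr hΩ 1 (fun w hw => by
        rw [inner_dd_meanVec_self hΩ hy hw, ← du_eq_dd, inner_meanVec_du hΩ hy hw, neg_zero]) hz
    rw [dd_const, dd_inner 1 (diffAt_of_smooth hΩ (smooth_dd hΩ hν 1) hz)
      (diffAt_of_smooth hΩ hy.smooth hz)] at e
    have := inner_dd_meanVec_du hΩ hy hz 1
    simp only [← du_eq_dd] at e this
    linarith
  have hv : ⟪dv (dv (meanVec y)) z, y z⟫ = ⟪meanVec y z, dv (dv y) z⟫ := by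
    have e : dd Complex.I (fun w => ⟪dd Complex.I (meanVec y) w, y w⟫) z
        = dd Complex.I (fun _ => (0 : ℝ)) z :=
      dd_congr hΩ Complex.I (fun w hw => by
        rw [inner_dd_meanVec_self hΩ hy hw, ← dv_eq_dd, inner_meanVec_dv hΩ hy hw, neg_zero]) hz
    rw [dd_const, dd_inner Complex.I (diffAt_of_smooth hΩ (smooth_dd hΩ hν _) hz)
      (diffAt_of_smooth hΩ hy.smooth hz)] at e
    have := inner_dd_meanVec_dv hΩ hy hz Complex.I
    simp only [← dv_eq_dd] at e this
    linarith
  rw [lap, inner_add_left, hu, hv, ← inner_add_right]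
  have := lap_eq_smul_meanVec hy hz
  rw [lap] at this
  rw [this, real_inner_smul_right]

/-- The Euler–Lagrange operator is tangent to the sphere. -/
lemma inner_eulerLagrange_self (hΩ : IsOpen Ω) (hy : IsConformalImmersion Ω y) (hz : z ∈ Ω) :
    ⟪eulerLagrange y z, y z⟫ = 0 := by
  -- The trace of the stress against `(y_u, y_v)` is `2 conf y |ν|²`, where `ν = meanVec y`: the
  -- trace-free part drops out. This cancels `⟨Δν, y⟩`. Tangency makes the Euler–Lagrange operator
  -- itself an admissible direction of variation.
  have hm := (conf_pos hy hz).ne'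
  have hu : ⟪du (stressU y) z, y z⟫ = -⟪stressU y z, du y z⟫ := by
    have e : dd 1 (fun w => ⟪stressU y w, y w⟫) z = dd 1 (fun _ => (0 : ℝ)) z :=
      dd_congr hΩ 1 (fun w hw => by
        rw [stressU, inner_add_left, real_inner_smul_left, real_inner_smul_left,
          inner_du_self hΩ hy hw, inner_dv_self hΩ hy hw]
        ring) hz
    rw [dd_const, dd_inner 1 (diffAt_of_smooth hΩ (smooth_stressU hΩ hy) hz)
      (diffAt_of_smooth hΩ hy.smooth hz)] at e
    simp only [← du_eq_dd] at e
    linarith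
  have hv : ⟪dv (stressV y) z, y z⟫ = -⟪stressV y z, dv y z⟫ := by
    have e : dd Complex.I (fun w => ⟪stressV y w, y w⟫) z = dd Complex.I (fun _ => (0 : ℝ)) z :=
      dd_congr hΩ _ (fun w hw => by
        rw [stressV, inner_add_left, real_inner_smul_left, real_inner_smul_left,
          inner_du_self hΩ hy hw, inner_dv_self hΩ hy hw]
        ring) hz
    rw [dd_const, dd_inner _ (diffAt_of_smooth hΩ (smooth_stressV hΩ hy) hz)
      (diffAt_of_smooth hΩ hy.smooth hz)] at e
    simp only [← dv_eq_dd] at e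
    linarith
  have huu : ⟪du y z, du y z⟫ = conf y z := rfl
  rw [eulerLagrange, inner_add_left, inner_add_left, hu, hv, inner_lap_meanVec_self hΩ hy hz,
    stressU, stressV]
  simp only [inner_add_left, real_inner_smul_left, hy.orthogonal z hz, inner_dv_du hy hz,
    inner_dv_dv hy hz, huu]
  ring

/-- The principal part of the Willmore equation agrees with the Euler–Lagrange operator up to
vectors in the conformal Gauss map. -/
lemma exists_eulerLagrange_eq (hΩ : IsOpen Ω) (hy : IsConformalImmersion Ω y) (hz : z ∈ Ω) :
    ∃ c₁ c₂ : ℝ, eulerLagrange y z =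
      lap (meanVec y) z + coefRe y z • hopfRe y z + coefIm y z • hopfIm y z
        + ⟪meanVec y z, meanVec y z⟫ • lap y z + c₁ • du y z + c₂ • dv y z := by
  have hN := diffAt_of_smooth hΩ (smooth_normMeanVec hΩ hy) hz
  have hα := diffAt_of_smooth hΩ (smooth_coefRe hΩ hy) hz
  have hβ := diffAt_of_smooth hΩ (smooth_coefIm hΩ hy) hz
  have hyu := diffAt_of_smooth hΩ (smooth_du hΩ hy.smooth) hz
  have hyv := diffAt_of_smooth hΩ (smooth_dv hΩ hy.smooth) hz
  have hU : du (stressU y) z = _ :=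
    dd_add 1 ((hN.fun_add hα).fun_smul hyu) (hβ.fun_smul hyv)
  have hV : dv (stressV y) z = _ :=
    dd_add Complex.I (hβ.fun_smul hyu) ((hN.fun_sub hα).fun_smul hyv)
  rw [dd_smul _ (hN.fun_add hα) hyu, dd_smul _ hβ hyv] at hU
  rw [dd_smul _ (hN.fun_sub hα) hyv, dd_smul _ hβ hyu] at hV
  rw [← du_eq_dd (dv y), du_dv_eq hΩ hy hz] at hU
  simp only [← du_eq_dd, ← dv_eq_dd] at hU hV
  rw [eulerLagrange, hU, hV]
  simp only [hopfRe, hopfIm, lap]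
  -- In the divergence of the stress, derivatives falling on the coefficients only multiply `y_u`
  -- and `y_v`, which lie in the conformal Gauss map. They are collected in the two unspecified
  -- constants.
  refine ⟨du (fun w => ⟪meanVec y w, meanVec y w⟫ + coefRe y w) z + dv (coefIm y) z,
    du (coefIm y) z + dv (fun w => ⟪meanVec y w, meanVec y w⟫ - coefRe y w) z, ?_⟩
  module

/-- The first variation of the Willmore density at a conformal immersion. -/
def firstVariation (y η : ℂ → Euc n) (z : ℂ) : ℝ :=
  ⟪meanVec y z, lap η z⟫ - ⟪stressU y z, du η z⟫ - ⟪stressV y z, dv η z⟫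

lemma hasDerivAt_willmoreDensity (hΩ : IsOpen Ω) {Y : ℝ → ℂ → Euc n} {η : ℂ → Euc n}
    (hY : SmoothFamily Ω Y) (hs : ∀ t, ∀ w ∈ Ω, ‖Y t w‖ = 1)
    (hy : IsConformalImmersion Ω (Y 0)) (hη : ∀ w ∈ Ω, HasDerivAt (fun t => Y t w) (η w) 0)
    (hz : z ∈ Ω) :
    HasDerivAt (fun t => willmoreDensity (Y t) z) (firstVariation (Y 0) η z) 0 := by
  have hm := conf_pos hy hz
  have dU : HasDerivAt (fun t => du (Y t) z) (du η z) 0 := hY.hasDerivAt_dd hΩ hη 1 hz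
  have dV : HasDerivAt (fun t => dv (Y t) z) (dv η z) 0 := hY.hasDerivAt_dd hΩ hη Complex.I hz
  have dUU : HasDerivAt (fun t => du (du (Y t)) z) (du (du η) z) 0 :=
    (hY.dd hΩ 1).hasDerivAt_dd hΩ (fun w hw => hY.hasDerivAt_dd hΩ hη 1 hw) 1 hz
  have dUV : HasDerivAt (fun t => dv (du (Y t)) z) (dv (du η) z) 0 :=
    (hY.dd hΩ 1).hasDerivAt_dd hΩ (fun w hw => hY.hasDerivAt_dd hΩ hη 1 hw) Complex.I hz
  have dVV : HasDerivAt (fun t => dv (dv (Y t)) z) (dv (dv η) z) 0 :=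
    (hY.dd hΩ Complex.I).hasDerivAt_dd hΩ (fun w hw => hY.hasDerivAt_dd hΩ hη Complex.I hw)
      Complex.I hz
  have dE := dU.inner ℝ dU
  have dF := dU.inner ℝ dV
  have dG := dV.inner ℝ dV
  have dW : HasDerivAt (fun t => mixedLaplacian (Y t) z) _ 0 :=
    ((dG.smul dUU).sub ((dF.const_mul 2).smul dUV)).add (dE.smul dVV)
  have huu : ⟪du (Y 0) z, du (Y 0) z⟫ = conf (Y 0) z := rfl
  have hW0 : mixedLaplacian (Y 0) z = conf (Y 0) z • lap (Y 0) z := by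
    rw [mixedLaplacian, inner_dv_dv hy hz, hy.orthogonal z hz, huu, lap]
    module
  have key := hasDerivAt_density_aux hm (dW.inner ℝ dW) dE dF dG (dW.inner ℝ dU) (dW.inner ℝ dV)
    rfl (hy.orthogonal z hz) (inner_dv_dv hy hz)
    (by simp only [hW0, real_inner_smul_left, inner_lap_du hΩ hy hz, mul_zero])
    (by simp only [hW0, real_inner_smul_left, inner_lap_dv hΩ hy hz, mul_zero])
  have hD0 : gramDet (Y 0) z ≠ 0 := by
    rw [gramDet, huu, inner_dv_dv hy hz, hy.orthogonal z hz]
    have := mul_pos hm hm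
    linarith
  -- The closed formula for the density needs an immersion. The surfaces of the family are immersed
  -- at `z` only for `t` near `0`, which is enough for a derivative at `0`.
  have hev : ∀ᶠ t in 𝓝 (0 : ℝ), gramDet (Y t) z ≠ 0 := by
    have hc : ContinuousAt (fun t : ℝ => gramDet (Y t) z) 0 :=
      ((hY.contDiffAt_gramDet hΩ 0 hz).continuousAt).comp
        (f := fun t : ℝ => (t, z)) (by fun_prop)
    exact hc.eventually_ne hD0
  refine (key.congr_of_eventuallyEq ?_).congr_deriv ?_
  · filter_upwards [hev] with t ht
    exact willmoreDensity_eq hΩ (hY.slice t) (hs t) hz ht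
  · simp only [hW0, firstVariation, stressU, stressV, coefRe, coefIm, hopfRe, hopfIm]
    simp only [inner_dv_dv hy hz, hy.orthogonal z hz, huu, inner_add_left, inner_add_right,
      inner_sub_right, real_inner_smul_left, real_inner_smul_right, meanVec, lap,
      real_inner_comm (du (Y 0) z) (du η z),
      real_inner_comm (dv (Y 0) z) (du η z), real_inner_comm (dv (Y 0) z) (dv η z)]
    simp only [inner_add_left, inner_sub_left, real_inner_smul_left,
      real_inner_comm (du (du (Y 0)) z) (du (du η) z),
      real_inner_comm (dv (dv (Y 0)) z) (du (du η) z),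
      real_inner_comm (du (du (Y 0)) z) (dv (dv η) z),
      real_inner_comm (dv (dv (Y 0)) z) (dv (dv η) z),
      real_inner_comm (dv (dv (Y 0)) z) (dv (du (Y 0)) z),
      real_inner_comm (du (du (Y 0)) z) (dv (du (Y 0)) z),
      real_inner_comm (du (du (Y 0)) z) (dv (dv (Y 0)) z),
      real_inner_comm (du (du (Y 0)) z) (dv (du η) z),
      real_inner_comm (dv (dv (Y 0)) z) (dv (du η) z)]
    generalize conf (Y 0) z = m at *
    have := hm.ne'
    field_simp
    ring

end Conformal

/-! ### From criticality to the Euler–Lagrange equation. -/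

section EulerLagrange

open MeasureTheory Set

variable {n : ℕ} {Ω : Set ℂ} {y η : ℂ → Euc n} {z : ℂ}

/-- The first variation is the Euler–Lagrange pairing up to a divergence. -/
lemma firstVariation_eq (hΩ : IsOpen Ω) (hy : IsConformalImmersion Ω y)
    (hη : ContDiffOn ℝ ∞ η Ω) (hz : z ∈ Ω) :
    firstVariation y η z = ⟪eulerLagrange y z, η z⟫
      + du (fun w => ⟪meanVec y w, du η w⟫ - ⟪du (meanVec y) w, η w⟫ - ⟪stressU y w, η w⟫) z
      + dv (fun w => ⟪meanVec y w, dv η w⟫ - ⟪dv (meanVec y) w, η w⟫ - ⟪stressV y w, η w⟫) z := by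
  have dν := diffAt_of_smooth hΩ (smooth_meanVec hΩ hy) hz
  have dη := diffAt_of_smooth hΩ hη hz
  have key (h : ℂ) {A : ℂ → Euc n} (hA : ContDiffOn ℝ ∞ A Ω) :
      dd h (fun w => ⟪meanVec y w, dd h η w⟫ - ⟪dd h (meanVec y) w, η w⟫ - ⟪A w, η w⟫) z
        = ⟪meanVec y z, dd h (dd h η) z⟫ - ⟪dd h (dd h (meanVec y)) z, η z⟫
          - ⟪dd h A z, η z⟫ - ⟪A z, dd h η z⟫ := by
    have d1 := diffAt_of_smooth hΩ (smooth_dd hΩ hη h) hz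
    have d2 := diffAt_of_smooth hΩ (smooth_dd hΩ (smooth_meanVec hΩ hy) h) hz
    have d3 := diffAt_of_smooth hΩ hA hz
    rw [dd_sub h ((dν.inner ℝ d1).fun_sub (d2.inner ℝ dη)) (d3.inner ℝ dη),
      dd_sub h (dν.inner ℝ d1) (d2.inner ℝ dη), dd_inner h dν d1, dd_inner h d2 dη,
      dd_inner h d3 dη]
    ring
  have hu := key 1 (smooth_stressU hΩ hy)
  have hv := key Complex.I (smooth_stressV hΩ hy)
  simp only [← du_eq_dd] at hu
  simp only [← dv_eq_dd] at hv
  rw [hu, hv, firstVariation, eulerLagrange]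
  simp only [lap, inner_add_left, inner_add_right]
  ring

lemma dd_eq_zero_of_notMem_tsupport {E : Type*} [NormedAddCommGroup E] [NormedSpace ℝ E]
    {f : ℂ → E} (hz : z ∉ tsupport f) (h : ℂ) : dd h f z = 0 := by
  rw [dd, (notMem_tsupport_iff_eventuallyEq.mp hz).fderiv_eq]
  simp

lemma tsupport_dd_subset {E : Type*} [NormedAddCommGroup E] [NormedSpace ℝ E]
    (f : ℂ → E) (h : ℂ) : tsupport (dd h f) ⊆ tsupport f :=
  closure_minimal (fun _ hz => by_contra fun hn => hz (dd_eq_zero_of_notMem_tsupport hn h))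
    (isClosed_tsupport f)

lemma integral_firstVariation (hΩ : IsOpen Ω) (hy : IsConformalImmersion Ω y)
    (hη : ContDiffOn ℝ ∞ η Ω) (hc : HasCompactSupport η) (hs : tsupport η ⊆ Ω) :
    ∫ z in tsupport η, firstVariation y η z = ∫ z, ⟪eulerLagrange y z, η z⟫ := by
  have h0 {z : ℂ} (hz : z ∉ tsupport η) : η z = 0 := image_eq_zero_of_notMem_tsupport hz
  -- The boundary fluxes are supported in the support of `η`, hence extend smoothly by zero to the
  -- plane, and their derivatives integrate to zero.
  have hflux (h : ℂ) {A : ℂ → Euc n} (hA : ContDiffOn ℝ ∞ A Ω) :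
      ContDiff ℝ ∞ (fun w => ⟪meanVec y w, dd h η w⟫ - ⟪dd h (meanVec y) w, η w⟫ - ⟪A w, η w⟫) ∧
      tsupport (fun w => ⟪meanVec y w, dd h η w⟫ - ⟪dd h (meanVec y) w, η w⟫ - ⟪A w, η w⟫)
        ⊆ tsupport η := by
    have hsub : tsupport (fun w => ⟪meanVec y w, dd h η w⟫ - ⟪dd h (meanVec y) w, η w⟫
        - ⟪A w, η w⟫) ⊆ tsupport η := by
      refine closure_minimal (fun w hw => by_contra fun hn => hw ?_) (isClosed_tsupport η)
      simp [h0 hn, dd_eq_zero_of_notMem_tsupport hn h]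
    exact ⟨contDiff_of_tsupport_subset hΩ
      ((((smooth_meanVec hΩ hy).inner ℝ (smooth_dd hΩ hη h)).sub
        ((smooth_dd hΩ (smooth_meanVec hΩ hy) h).inner ℝ hη)).sub (hA.inner ℝ hη))
      (hsub.trans hs), hsub⟩
  obtain ⟨hXs, hXt⟩ := hflux 1 (smooth_stressU hΩ hy)
  obtain ⟨hZs, hZt⟩ := hflux Complex.I (smooth_stressV hΩ hy)
  set X : ℂ → ℝ := fun w => ⟪meanVec y w, dd 1 η w⟫ - ⟪dd 1 (meanVec y) w, η w⟫
    - ⟪stressU y w, η w⟫ with hX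
  set Z : ℂ → ℝ := fun w => ⟪meanVec y w, dd Complex.I η w⟫ - ⟪dd Complex.I (meanVec y) w, η w⟫
    - ⟪stressV y w, η w⟫ with hZ
  have hXc : HasCompactSupport X := hc.of_isClosed_subset (isClosed_tsupport _) hXt
  have hZc : HasCompactSupport Z := hc.of_isClosed_subset (isClosed_tsupport _) hZt
  have hint {W : ℂ → ℝ} (hW : ContDiff ℝ ∞ W) (hWc : HasCompactSupport W) (h : ℂ) :
      Integrable (dd h W) :=
    ((hW.continuous_fderiv (by simp)).clm_apply continuous_const).integrable_of_hasCompactSupport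
      (hWc.of_isClosed_subset (isClosed_tsupport _) (tsupport_dd_subset W h))
  have hPt : tsupport (fun w => ⟪eulerLagrange y w, η w⟫) ⊆ tsupport η := by
    refine closure_minimal (fun w hw => by_contra fun hn => hw ?_) (isClosed_tsupport η)
    simp [h0 hn]
  have hPi : Integrable (fun w => ⟪eulerLagrange y w, η w⟫) :=
    (contDiff_of_tsupport_subset hΩ ((smooth_eulerLagrange hΩ hy).inner ℝ hη)
      (hPt.trans hs)).continuous.integrable_of_hasCompactSupport
      (hc.of_isClosed_subset (isClosed_tsupport _) hPt)
  have hpt : ∀ w, w ∈ tsupport η → firstVariation y η w =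
      ⟪eulerLagrange y w, η w⟫ + dd 1 X w + dd Complex.I Z w := fun w hw =>
    firstVariation_eq hΩ hy hη (hs hw)
  rw [setIntegral_congr_fun (isClosed_tsupport η).measurableSet hpt,
    setIntegral_eq_integral_of_forall_compl_eq_zero fun w hw => by
      rw [h0 hw, inner_zero_right, dd_eq_zero_of_notMem_tsupport (fun h => hw (hXt h)),
        dd_eq_zero_of_notMem_tsupport (fun h => hw (hZt h))]
      simp,
    integral_add (hPi.fun_add (hint hXs hXc 1)) (hint hZs hZc Complex.I),
    integral_add hPi (hint hXs hXc 1), integral_dd_eq_zero hXs hXc, integral_dd_eq_zero hZs hZc,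
    add_zero, add_zero]

/-- The normalized linear variation of a map into the unit sphere. -/
def sphereVariation (y η : ℂ → Euc n) (t : ℝ) (z : ℂ) : Euc n :=
  (Real.sqrt (1 + t ^ 2 * ‖η z‖ ^ 2))⁻¹ • (y z + t • η z)

lemma sphereVariation_zero (y η : ℂ → Euc n) : sphereVariation y η 0 = y := by
  funext z
  simp [sphereVariation]

lemma hasDerivAt_sphereVariation (y η : ℂ → Euc n) (z : ℂ) :
    HasDerivAt (fun t => sphereVariation y η t z) (η z) 0 := by
  have h1 : HasDerivAt (fun t : ℝ => 1 + t ^ 2 * ‖η z‖ ^ 2) 0 0 := by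
    have := (((hasDerivAt_id (0 : ℝ)).fun_pow 2).mul_const (‖η z‖ ^ 2)).const_add 1
    simpa using this
  have h2 := (h1.sqrt (by simp)).fun_inv (by simp)
  have h3 := h2.smul (((hasDerivAt_id (0 : ℝ)).smul_const (η z)).const_add (y z))
  refine h3.congr_deriv ?_
  simp

lemma smoothFamily_sphereVariation (hy : ContDiffOn ℝ ∞ y Ω) (hη : ContDiffOn ℝ ∞ η Ω) :
    SmoothFamily Ω (sphereVariation y η) := by
  have hsnd : MapsTo (Prod.snd : ℝ × ℂ → ℂ) (univ ×ˢ Ω) Ω := fun _ hp => hp.2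
  have hη' : ContDiffOn ℝ ∞ (fun p : ℝ × ℂ => η p.2) (univ ×ˢ Ω) :=
    hη.comp contDiff_snd.contDiffOn hsnd
  have hy' : ContDiffOn ℝ ∞ (fun p : ℝ × ℂ => y p.2) (univ ×ˢ Ω) :=
    hy.comp contDiff_snd.contDiffOn hsnd
  have ht : ContDiffOn ℝ ∞ (fun p : ℝ × ℂ => p.1) (univ ×ˢ Ω) := contDiff_fst.contDiffOn
  have hpos (p : ℝ × ℂ) : 0 < 1 + p.1 ^ 2 * ‖η p.2‖ ^ 2 := by positivity
  exact (((contDiffOn_const.add ((ht.pow 2).mul (hη'.norm_sq ℝ))).sqrt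
    fun p _ => (hpos p).ne').inv fun p _ => (Real.sqrt_pos.mpr (hpos p)).ne').smul
    (hy'.add (ht.smul hη'))

/-- A Willmore immersion satisfies the Euler–Lagrange equation. -/
theorem eulerLagrange_eq_zero (hΩ : IsOpen Ω) (hy : IsConformalImmersion Ω y)
    (hW : IsWillmore Ω y) (hz : z ∈ Ω) : eulerLagrange y z = 0 := by
  have hEL := smooth_eulerLagrange hΩ hy
  have hmain : ∀ φ : ℂ → ℝ, ContDiff ℝ ∞ φ → HasCompactSupport φ → tsupport φ ⊆ Ω →
      ∫ z, φ z • ⟪eulerLagrange y z, eulerLagrange y z⟫ = 0 := by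
    intro φ hφ hφc hφΩ
    -- The direction of variation is the Euler–Lagrange operator cut off by `φ`. The vanishing first
    -- variation then reads `∫ φ |eulerLagrange y|² = 0`.
    set η : ℂ → Euc n := fun z => φ z • eulerLagrange y z with hηdef
    have hη : ContDiffOn ℝ ∞ η Ω := hφ.contDiffOn.smul hEL
    have hsub : tsupport η ⊆ tsupport φ := tsupport_smul_subset_left φ _
    have hηc : HasCompactSupport η := hφc.of_isClosed_subset (isClosed_tsupport _) hsub
    have hηΩ := hsub.trans hφΩ
    have hsm := smoothFamily_sphereVariation hy.smooth hη
    have hsph : ∀ t, ∀ w ∈ Ω, ‖sphereVariation y η t w‖ = 1 := by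
      intro t w hw
      -- Because `η` is orthogonal to `y`, Pythagoras shows that the normalizing factor in
      -- `sphereVariation` is exact.
      have horth : ⟪y w, t • η w⟫ = 0 := by
        rw [hηdef, real_inner_smul_right, real_inner_smul_right, real_inner_comm,
          inner_eulerLagrange_self hΩ hy hw, mul_zero, mul_zero]
      have hn : ‖y w + t • η w‖ = Real.sqrt (1 + t ^ 2 * ‖η w‖ ^ 2) := by
        rw [eq_comm, Real.sqrt_eq_iff_mul_self_eq (by positivity) (norm_nonneg _),
          norm_add_sq_eq_norm_sq_add_norm_sq_real horth, hy.mem_sphere w hw,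
          norm_smul t (η w), Real.norm_eq_abs, mul_mul_mul_comm, abs_mul_abs_self]
        ring
      rw [sphereVariation, norm_smul, hn, norm_inv, Real.norm_of_nonneg (Real.sqrt_nonneg _)]
      exact inv_mul_cancel₀ (Real.sqrt_pos.mpr (by positivity)).ne'
    have h0 : sphereVariation y η 0 = y := sphereVariation_zero y η
    have hvar : IsVariation Ω y (tsupport η) (sphereVariation y η) :=
      { smooth := hsm
        mem_sphere := hsph
        initial := fun z _ => congrFun h0 z
        support := fun t z hz => by
          simp [sphereVariation, image_eq_zero_of_notMem_tsupport hz.2] }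
    have hd := hW (tsupport η) _ hηc hηΩ hvar
    have hder (w : ℂ) (hw : w ∈ Ω) :
        HasDerivAt (fun t => willmoreDensity (sphereVariation y η t) w)
          (firstVariation y η w) 0 := by
      have := hasDerivAt_willmoreDensity hΩ (Y := sphereVariation y η) hsm hsph
        (by rwa [h0]) (fun w _ => hasDerivAt_sphereVariation y η w) hw
      rwa [h0] at this
    -- The family need not stay immersed for all times. The density is smooth where the first
    -- fundamental form is nondegenerate, an open set containing the slice `t = 0` over the support.
    set W : Set (ℝ × ℂ) := {p | p ∈ univ ×ˢ Ω ∧ gramDet (sphereVariation y η p.1) p.2 ≠ 0} with hWdef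
    have hcont : ContinuousOn (fun p : ℝ × ℂ => gramDet (sphereVariation y η p.1) p.2)
        (univ ×ˢ Ω) := fun p hp =>
      (hsm.contDiffAt_gramDet hΩ p.1 hp.2).continuousAt.continuousWithinAt
    have hWopen : IsOpen W :=
      hcont.isOpen_inter_preimage (isOpen_univ.prod hΩ) isOpen_compl_singleton
    have hΦ : ContDiffOn ℝ ∞ (fun p : ℝ × ℂ => willmoreDensity (sphereVariation y η p.1) p.2) W :=
      fun p hp => (hsm.contDiffAt_willmoreDensity hΩ p.1 hp.1.2 hp.2).contDiffWithinAt
    have hCW : ({0} : Set ℝ) ×ˢ tsupport η ⊆ W := by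
      rintro ⟨t, w⟩ ⟨ht, hw⟩
      have ht0 : t = 0 := ht
      subst ht0
      refine ⟨⟨mem_univ _, hηΩ hw⟩, ?_⟩
      have hm := conf_pos hy (hηΩ hw)
      have huu : ⟪du y w, du y w⟫ = conf y w := rfl
      simp only [h0, gramDet, inner_dv_dv hy (hηΩ hw), hy.orthogonal w (hηΩ hw), huu]
      have := mul_pos hm hm
      intro h
      linarith
    have hd' := hasDerivAt_setIntegral_of_contDiffOn hWopen hΦ hηc hCW
    have hzero := hd.unique hd'
    have hpt : ∀ w ∈ tsupport η,
        fderiv ℝ (fun p : ℝ × ℂ => willmoreDensity (sphereVariation y η p.1) p.2) (0, w) (1, 0)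
          = firstVariation y η w := by
      intro w hw
      have hp : HasDerivAt (fun t : ℝ => (t, w)) ((1 : ℝ), (0 : ℂ)) 0 :=
        (hasDerivAt_id 0).prodMk (hasDerivAt_const 0 w)
      have h1 := ((hΦ.contDiffAt (hWopen.mem_nhds (hCW ⟨mem_singleton _, hw⟩))).differentiableAt
        (by simp)).hasFDerivAt.comp_hasDerivAt 0 hp
      exact h1.unique (hder w (hηΩ hw))
    rw [setIntegral_congr_fun (isClosed_tsupport η).measurableSet hpt,
      integral_firstVariation hΩ hy hη hηc hηΩ] at hzero
    rw [hzero]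
    congr 1
    funext w
    rw [hηdef, real_inner_smul_right, smul_eq_mul]
  -- The fundamental lemma of the calculus of variations gives vanishing almost everywhere;
  -- continuity upgrades it to every point.
  have hsq := hEL.inner ℝ hEL
  have hae := hΩ.ae_eq_zero_of_integral_contDiff_smul_eq_zero (μ := volume)
    (hsq.continuousOn.locallyIntegrableOn hΩ.measurableSet) hmain
  have := Measure.eqOn_open_of_ae_eq (μ := (volume : Measure ℂ)) (g := fun _ => (0 : ℝ))
    ((ae_restrict_iff' hΩ.measurableSet).mpr hae) hΩ hsq.continuousOn continuousOn_const
  exact inner_self_eq_zero.mp (this hz)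

end EulerLagrange

/-! ### Lorentz matrices, cosets determined by leading columns, and triviality of the center. -/

section Lorentz

variable {n : ℕ}

/-- The signs of the diagonal matrix `minkowski n`. -/
def sgn (n : ℕ) : Fin (n + 4) → ℝ := Fin.cons (-1) fun _ => 1

lemma minkowski_eq (n : ℕ) : minkowski n = Matrix.diagonal (sgn n) := rfl

lemma sgn_mul_self (i : Fin (n + 4)) : sgn n i * sgn n i = 1 := by
  refine Fin.cases ?_ (fun j => ?_) i <;> simp [sgn]

lemma mink_eq_sum (v w : Fin (n + 4) → ℝ) : mink v w = ∑ i, sgn n i * (v i * w i) := by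
  rw [Fin.sum_univ_succ]
  simp [mink, sgn]

lemma mink_eq_dotProduct (v w : Fin (n + 4) → ℝ) :
    mink v w = v ⬝ᵥ (minkowski n).mulVec w := by
  rw [mink_eq_sum, minkowski_eq, dotProduct]
  refine Finset.sum_congr rfl fun i _ => ?_
  rw [Matrix.mulVec_diagonal]
  ring

lemma mink_comm (v w : Fin (n + 4) → ℝ) : mink v w = mink w v := by
  simp only [mink_eq_sum, mul_comm (v _)]

lemma mink_add_left (v v' w : Fin (n + 4) → ℝ) : mink (v + v') w = mink v w + mink v' w := by
  simp only [mink_eq_dotProduct, add_dotProduct]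

lemma mink_smul_left (c : ℝ) (v w : Fin (n + 4) → ℝ) : mink (c • v) w = c * mink v w := by
  simp only [mink_eq_dotProduct, smul_dotProduct, smul_eq_mul]

lemma mink_add_right (v w w' : Fin (n + 4) → ℝ) : mink v (w + w') = mink v w + mink v w' := by
  rw [mink_comm, mink_add_left, mink_comm w, mink_comm w']

lemma mink_smul_right (c : ℝ) (v w : Fin (n + 4) → ℝ) : mink v (c • w) = c * mink v w := by
  rw [mink_comm, mink_smul_left, mink_comm]

lemma mink_mulVec_left (A : Matrix (Fin (n + 4)) (Fin (n + 4)) ℝ) (v w : Fin (n + 4) → ℝ) :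
    mink (A.mulVec v) w = v ⬝ᵥ (A.transpose * minkowski n).mulVec w := by
  rw [mink_eq_dotProduct, ← Matrix.mulVec_mulVec, Matrix.mulVec_transpose,
    dotProduct_comm, Matrix.dotProduct_mulVec, dotProduct_comm]

lemma mink_mulVec {A : Matrix (Fin (n + 4)) (Fin (n + 4)) ℝ}
    (hA : A.transpose * minkowski n * A = minkowski n) (v w : Fin (n + 4) → ℝ) :
    mink (A.mulVec v) (A.mulVec w) = mink v w := by
  rw [mink_mulVec_left, Matrix.mulVec_mulVec, hA, mink_eq_dotProduct]

lemma mat_lorentz (g : SOPlus n) : (mat g).transpose * minkowski n * mat g = minkowski n := g.2.1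

lemma mat_inv_mul (g : SOPlus n) : mat g⁻¹ * mat g = 1 := by
  rw [← mat_mul, inv_mul_cancel]
  rfl

lemma mat_mul_inv (g : SOPlus n) : mat g * mat g⁻¹ = 1 := by
  rw [← mat_mul, mul_inv_cancel]
  rfl

lemma mat_injective : Function.Injective (mat (n := n)) := fun _ _ h =>
  Subtype.ext (Subtype.ext h)

/-- The inclusion of the four leading indices. -/
def lead (n : ℕ) (j : Fin 4) : Fin (n + 4) := Fin.castLE (Nat.le_add_left 4 n) j

lemma lead_val (j : Fin 4) : (lead n j).1 = j.1 := rfl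

lemma exists_lead {i : Fin (n + 4)} (hi : i.1 < 4) : ∃ j, lead n j = i := ⟨⟨i.1, hi⟩, rfl⟩

/-- Two frames with the same leading four columns span the same oriented subspace. -/
lemma coset_eq_of_lead_eq {F F' : SOPlus n}
    (h : ∀ j i, mat F i (lead n j) = mat F' i (lead n j)) : (F : Gr n) = (F' : Gr n) := by
  rw [QuotientGroup.eq]
  set k := F⁻¹ * F' with hk
  have hcol : ∀ i j : Fin (n + 4), j.1 < 4 → mat k i j = (1 : Matrix _ _ ℝ) i j := by
    intro i j hj
    obtain ⟨j, rfl⟩ := exists_lead hj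
    rw [hk, mat_mul, ← mat_inv_mul F, Matrix.mul_apply, Matrix.mul_apply]
    exact Finset.sum_congr rfl fun l _ => by rw [h]
  -- Column `i` of `k` is the `i`-th basis vector, so the `(i, j)` entry of the Lorentz relation is
  -- `± k i j`. It vanishes because `i ≠ j`.
  have hupper : ∀ i j : Fin (n + 4), i.1 < 4 → ¬ j.1 < 4 → mat k i j = 0 := by
    intro i j hi hj
    have hJ := congrFun (congrFun (mat_lorentz k) i) j
    rw [Matrix.mul_assoc, Matrix.mul_apply, Finset.sum_eq_single i] at hJ
    · have hij : i ≠ j := fun e => hj (e ▸ hi)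
      rw [Matrix.transpose_apply, hcol i i hi, Matrix.one_apply_eq, one_mul, minkowski_eq,
        Matrix.diagonal_mul, Matrix.diagonal_apply_ne _ hij] at hJ
      have h1 := sgn_mul_self i
      exact (mul_eq_zero.mp hJ).resolve_left fun h0 => by simp [h0] at h1
    · intro l _ hl
      rw [Matrix.transpose_apply, hcol l i hi, Matrix.one_apply_ne hl, zero_mul]
    · simp
  refine ⟨fun i j hij => ?_, ?_⟩
  · by_cases hj : j.1 < 4
    · rw [hcol i j hj, Matrix.one_apply_ne]
      rintro rfl
      exact hij Iff.rfl
    · exact hupper i j (by_contra fun hi => hij (by simp [SameBlock, hi, hj])) hj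
  · have : (mat k).toSquareBlockProp (fun i => i.1 < 4) =
        (1 : Matrix (Fin (n + 4)) (Fin (n + 4)) ℝ).toSquareBlockProp (fun i => i.1 < 4) := by
      ext i j
      exact hcol i.1 j.1 j.2
    rw [this, toSquareBlockProp_one, Matrix.det_one]

/-- A boost in the plane of the coordinates `0` and `i`. -/
def boostMat (i : Fin (n + 4)) : Matrix (Fin (n + 4)) (Fin (n + 4)) ℝ :=
  -- The hyperbolic angle has `cosh = 5/4` and `sinh = 3/4`, which keeps all entries rational. The
  -- square has `cosh = 17/8` and `sinh = 15/8`.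
  1 + ((1 / 4 : ℝ) • Matrix.single 0 0 1 + (1 / 4 : ℝ) • Matrix.single i i 1
    + (3 / 4 : ℝ) • Matrix.single 0 i 1 + (3 / 4 : ℝ) • Matrix.single i 0 1)

lemma boostMat_mul_self {i : Fin (n + 4)} (hi : i ≠ 0) :
    boostMat i * boostMat i = 1 + ((9 / 8 : ℝ) • Matrix.single 0 0 1
      + (9 / 8 : ℝ) • Matrix.single i i 1 + (15 / 8 : ℝ) • Matrix.single 0 i 1
      + (15 / 8 : ℝ) • Matrix.single i 0 1) := by
  simp only [boostMat, add_mul, mul_add, one_mul, mul_one, Matrix.smul_mul, Matrix.mul_smul,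
    Matrix.single_mul_single_same, Matrix.single_mul_single_of_ne _ _ _ _ hi,
    Matrix.single_mul_single_of_ne _ _ _ _ hi.symm, smul_zero]
  module

lemma minkowski_mul_single (i j : Fin (n + 4)) :
    minkowski n * Matrix.single i j 1 = sgn n i • Matrix.single i j 1 := by
  ext k l
  rw [minkowski_eq, Matrix.diagonal_mul, Matrix.smul_apply, smul_eq_mul, Matrix.single_apply]
  split_ifs with h
  · rw [h.1]
  · simp

lemma boostMat_lorentz {i : Fin (n + 4)} (hi : i ≠ 0) :
    (boostMat i).transpose * minkowski n * boostMat i = minkowski n := by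
  have hs0 : sgn n 0 = -1 := rfl
  have hsi : sgn n i = 1 := by
    obtain ⟨j, rfl⟩ := Fin.exists_succ_eq.mpr hi
    rfl
  have ht : (boostMat i).transpose = boostMat i := by
    simp only [boostMat, Matrix.transpose_add, Matrix.transpose_one, Matrix.transpose_smul,
      Matrix.transpose_single]
    module
  have hsm (k l : Fin (n + 4)) :
      Matrix.single k l (1 : ℝ) * minkowski n = sgn n l • Matrix.single k l 1 := by
    ext p q
    rw [minkowski_eq, Matrix.mul_diagonal, Matrix.smul_apply, smul_eq_mul, Matrix.single_apply,
      mul_comm]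
    split_ifs with h
    · rw [h.2]
    · simp
  rw [ht]
  simp only [boostMat, add_mul, mul_add, one_mul, mul_one, Matrix.smul_mul, Matrix.mul_smul,
    hsm, minkowski_mul_single, hs0, hsi,
    Matrix.single_mul_single_same, Matrix.single_mul_single_of_ne _ _ _ _ hi,
    Matrix.single_mul_single_of_ne _ _ _ _ hi.symm, smul_zero]
  module

lemma det_sq_of_lorentz {A : Matrix (Fin (n + 4)) (Fin (n + 4)) ℝ}
    (hA : A.transpose * minkowski n * A = minkowski n) : A.det * A.det = 1 := by
  have h := congrArg Matrix.det hA
  have h2 := congrArg Matrix.det (minkowski_mul_self n)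
  rw [Matrix.det_mul, Matrix.det_one] at h2
  rw [Matrix.det_mul, Matrix.det_mul, Matrix.det_transpose] at h
  have h0 : (minkowski n).det ≠ 0 := fun h0 => by simp [h0] at h2
  apply mul_right_cancel₀ h0
  linarith

/-- The square of a boost, as an element of `SO⁺(1, n+3)`. -/
def boost {i : Fin (n + 4)} (hi : i ≠ 0) : SOPlus n :=
  -- Taking a square makes the determinant one without evaluating it, since a Lorentz matrix has
  -- `det² = 1`.
  ⟨⟨boostMat i * boostMat i, by
      rw [Matrix.det_mul, det_sq_of_lorentz (boostMat_lorentz hi)]⟩, by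
    have h0 : 0 < boostMat i 0 0 := by simp [boostMat, hi]; norm_num
    have hl := boostMat_lorentz hi
    refine ⟨?_, timeOriented_mul hl h0 hl h0⟩
    change (boostMat i * boostMat i).transpose * minkowski n * (boostMat i * boostMat i) = _
    rw [Matrix.transpose_mul]
    calc (boostMat i).transpose * (boostMat i).transpose * minkowski n *
          (boostMat i * boostMat i)
        = (boostMat i).transpose * ((boostMat i).transpose * minkowski n * boostMat i)
          * boostMat i := by simp only [Matrix.mul_assoc]
      _ = minkowski n := by rw [hl, hl]⟩

/-- Commuting with the boosts in all planes `(0, i)` forces a scalar matrix: off-diagonal entries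
solve 2 × 2 systems with coefficients `9/8` and `15/8`, and the boost links `A i i` to `A 0 0`. The
Lorentz relation and `A 0 0 > 0` leave only the identity. -/
lemma eq_one_of_mem_center {g : SOPlus n} (hg : g ∈ Subgroup.center (SOPlus n)) : g = 1 := by
  set A := mat g with hA
  have hcomm {i : Fin (n + 4)} (hi : i ≠ 0) :
      A * ((9 / 8 : ℝ) • Matrix.single 0 0 1 + (9 / 8 : ℝ) • Matrix.single i i 1
        + (15 / 8 : ℝ) • Matrix.single 0 i 1 + (15 / 8 : ℝ) • Matrix.single i 0 1) =
      ((9 / 8 : ℝ) • Matrix.single 0 0 1 + (9 / 8 : ℝ) • Matrix.single i i 1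
        + (15 / 8 : ℝ) • Matrix.single 0 i 1 + (15 / 8 : ℝ) • Matrix.single i 0 1) * A := by
    have h := congrArg mat (Subgroup.mem_center_iff.mp hg (boost hi))
    have hb : mat (boost hi) = boostMat i * boostMat i := rfl
    rw [mat_mul, mat_mul, hb, boostMat_mul_self hi, add_mul, mul_add, one_mul, mul_one] at h
    exact (add_left_cancel h).symm
  have hrow {i k : Fin (n + 4)} (hi : i ≠ 0) (hk0 : k ≠ 0) (hki : k ≠ i) :
      A k 0 = 0 ∧ A k i = 0 := by
    have h1 := congrFun (congrFun (hcomm hi) k) 0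
    have h2 := congrFun (congrFun (hcomm hi) k) i
    simp [mul_add, add_mul, Matrix.mul_single_apply_of_ne, Matrix.single_mul_apply_of_ne, hi,
      hi.symm, hk0, hki] at h1 h2
    constructor <;> linarith
  have hcol {i k : Fin (n + 4)} (hi : i ≠ 0) (hk0 : k ≠ 0) (hki : k ≠ i) : A 0 k = 0 := by
    have h1 := congrFun (congrFun (hcomm hi) 0) k
    have h2 := congrFun (congrFun (hcomm hi) i) k
    simp [mul_add, add_mul, Matrix.mul_single_apply_of_ne, Matrix.single_mul_apply_of_ne, hi,
      hi.symm, hk0, hki] at h1 h2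
    linarith
  have hdiag {i : Fin (n + 4)} (hi : i ≠ 0) : A i i = A 0 0 := by
    have h1 := congrFun (congrFun (hcomm hi) 0) i
    simp [mul_add, add_mul, Matrix.mul_single_apply_of_ne, Matrix.single_mul_apply_of_ne, hi,
      hi.symm] at h1
    linarith
  -- With at least four coordinates there is always a boost plane avoiding a given nonzero index, as
  -- the off-diagonal argument requires.
  have hex (k : Fin (n + 4)) : ∃ i : Fin (n + 4), i ≠ 0 ∧ k ≠ i := by
    by_cases h : k = 1
    · exact ⟨⟨2, by omega⟩, by simp [Fin.ext_iff], by simp [h, Fin.ext_iff]⟩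
    · exact ⟨1, by simp, h⟩
  have hoff (k l : Fin (n + 4)) (hkl : k ≠ l) : A k l = 0 := by
    by_cases hk : k = 0
    · subst hk
      obtain ⟨i, hi, hli⟩ := hex l
      exact hcol hi hkl.symm hli
    · by_cases hl : l = 0
      · subst hl
        obtain ⟨i, hi, hki⟩ := hex k
        exact (hrow hi hk hki).1
      · exact (hrow hl hk hkl).2
  have h00 : A 0 0 = 1 := by
    have h := lorentz_col (mat_lorentz g)
    rw [Finset.sum_eq_zero fun i _ => by rw [← hA, hoff _ _ (Fin.succ_ne_zero i)]; simp] at h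
    have hpos : 0 < A 0 0 := g.2.2
    rw [← hA] at h
    nlinarith
  apply mat_injective
  ext k l
  change A k l = (1 : Matrix _ _ ℝ) k l
  by_cases hkl : k = l
  · subst hkl
    rw [Matrix.one_apply_eq]
    by_cases hk : k = 0
    · rw [hk, h00]
    · rw [hdiag hk, h00]
  · rw [hoff k l hkl, Matrix.one_apply_ne hkl]

end Lorentz

/-! ### Light-cone lifts and the span of the Gauss basis. -/

section Lift

variable {n : ℕ} {Ω : Set ℂ} {y : ℂ → Euc n} {z : ℂ}

/-- The inclusion of `ℝ^{n+3}` into `ℝ^{n+4}_1` as the space-like coordinate hyperplane. -/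
def spaceIncl (n : ℕ) : Euc n →L[ℝ] (Fin (n + 4) → ℝ) :=
  LinearMap.toContinuousLinearMap
    { toFun := fun v => Fin.cons 0 fun i => v i
      map_add' := fun v w => by
        ext i
        refine Fin.cases ?_ (fun j => ?_) i <;> simp
      map_smul' := fun c v => by
        ext i
        refine Fin.cases ?_ (fun j => ?_) i <;> simp }

lemma spaceIncl_zero (v : Euc n) : spaceIncl n v 0 = 0 := rfl

lemma spaceIncl_succ (v : Euc n) (i : Fin (n + 3)) : spaceIncl n v i.succ = v i := rfl

lemma lightVec_zero (p : Euc n) : lightVec p 0 = 1 := rfl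

lemma lightVec_succ (p : Euc n) (i : Fin (n + 3)) : lightVec p i.succ = p i := rfl

lemma lightVec_eq (p : Euc n) : lightVec p = lightVec 0 + spaceIncl n p := by
  ext i
  refine Fin.cases ?_ (fun j => ?_) i
  · simp [lightVec_zero, spaceIncl_zero]
  · simp [lightVec_succ, spaceIncl_succ]

lemma real_inner_eq_sum (v w : Euc n) : ⟪v, w⟫ = ∑ i, v i * w i := by
  rw [PiLp.inner_apply]
  exact Finset.sum_congr rfl fun i _ => by simp [mul_comm]

lemma mink_spaceIncl (v w : Euc n) : mink (spaceIncl n v) (spaceIncl n w) = ⟪v, w⟫ := by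
  simp [mink, spaceIncl_zero, spaceIncl_succ, real_inner_eq_sum]

lemma mink_lightVec_spaceIncl (p w : Euc n) : mink (lightVec p) (spaceIncl n w) = ⟪p, w⟫ := by
  simp [mink, spaceIncl_zero, spaceIncl_succ, lightVec_succ, real_inner_eq_sum]

lemma mink_lightVec {p : Euc n} (hp : ‖p‖ = 1) : mink (lightVec p) (lightVec p) = 0 := by
  have := real_inner_self_eq_norm_sq p
  rw [hp, real_inner_eq_sum] at this
  simp [mink, lightVec_zero, lightVec_succ, this]

lemma smooth_lightVec (hy : ContDiffOn ℝ ∞ y Ω) :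
    ContDiffOn ℝ ∞ (fun w => lightVec (y w)) Ω := by
  have : (fun w => lightVec (y w)) = fun w => lightVec 0 + spaceIncl n (y w) :=
    funext fun w => lightVec_eq (y w)
  rw [this]
  exact contDiffOn_const.add ((spaceIncl n).contDiff.comp_contDiffOn hy)

lemma dd_lightVec (hd : DifferentiableAt ℝ y z) (h : ℂ) :
    dd h (fun w => lightVec (y w)) z = spaceIncl n (dd h y z) := by
  have : (fun w => lightVec (y w)) = fun w => lightVec 0 + spaceIncl n (y w) :=
    funext fun w => lightVec_eq (y w)
  have hd' : DifferentiableAt ℝ (fun w => spaceIncl n (y w)) z :=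
    (spaceIncl n).differentiableAt.comp z hd
  rw [this, dd_add h (differentiableAt_const _) hd', dd_const, zero_add, dd_clm h _ hd]

lemma smooth_mink {f g : ℂ → Fin (n + 4) → ℝ} (hf : ContDiffOn ℝ ∞ f Ω)
    (hg : ContDiffOn ℝ ∞ g Ω) : ContDiffOn ℝ ∞ (fun w => mink (f w) (g w)) Ω := by
  simp only [mink_eq_sum]
  exact ContDiffOn.sum fun i _ =>
    contDiffOn_const.mul ((contDiffOn_pi.mp hf i).mul (contDiffOn_pi.mp hg i))

lemma smooth_scale (hΩ : IsOpen Ω) (hy : IsConformalImmersion Ω y) :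
    ContDiffOn ℝ ∞ (fun w => ‖du y w‖⁻¹) Ω :=
  ((smooth_du hΩ hy.smooth).norm ℝ hy.immersed).inv fun w hw =>
    norm_ne_zero_iff.mpr (hy.immersed w hw)

lemma smooth_canonicalLift (hΩ : IsOpen Ω) (hy : IsConformalImmersion Ω y) :
    ContDiffOn ℝ ∞ (canonicalLift y) Ω :=
  (smooth_scale hΩ hy).smul (smooth_lightVec hy.smooth)

lemma smooth_dualLift (hΩ : IsOpen Ω) (hy : IsConformalImmersion Ω y) :
    ContDiffOn ℝ ∞ (dualLift y) Ω := by
  have hY := smooth_canonicalLift hΩ hy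
  have hL : ContDiffOn ℝ ∞ (laplaceLift y) Ω := smooth_lap hΩ hY
  exact (hL.const_smul (1 / 2 : ℝ)).add (((smooth_mink hL hL).div_const 8).smul hY)

lemma smooth_gaussBasis (hΩ : IsOpen Ω) (hy : IsConformalImmersion Ω y) (j : Fin 4) :
    ContDiffOn ℝ ∞ (fun w => gaussBasis y w j) Ω := by
  have hY := smooth_canonicalLift hΩ hy
  have hN := smooth_dualLift hΩ hy
  fin_cases j
  · exact (hY.add hN).const_smul _
  · exact (hY.neg.add hN).const_smul _
  · exact smooth_du hΩ hY
  · exact smooth_dv hΩ hY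

/-- The leading columns of a frame and the moving vectors `(1, y)`, `(0, y_u)`, `(0, y_v)`,
`(0, Δy)` have the same span: a linear map killing the latter kills the Gauss basis. -/
lemma gaussBasis_mem (hΩ : IsOpen Ω) (hy : IsConformalImmersion Ω y) (hz : z ∈ Ω)
    (V : Submodule ℝ (Fin (n + 4) → ℝ)) :
    (∀ j, gaussBasis y z j ∈ V) ↔
      lightVec (y z) ∈ V ∧ spaceIncl n (du y z) ∈ V ∧ spaceIncl n (dv y z) ∈ V ∧
        spaceIncl n (lap y z) ∈ V := by
  set r : ℂ → ℝ := fun w => ‖du y w‖⁻¹ with hr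
  have hrs : ContDiffOn ℝ ∞ r Ω := smooth_scale hΩ hy
  have hr0 : r z ≠ 0 := inv_ne_zero (norm_ne_zero_iff.mpr (hy.immersed z hz))
  have hℓ := smooth_lightVec hy.smooth
  have hY : canonicalLift y z = r z • lightVec (y z) := rfl
  -- With `Y = r (1, y)`, the product rule expresses `Y`, `Y_u`, `Y_v`, `ΔY` through `(1, y)`, `(0,
  -- y_u)`, `(0, y_v)`, `(0, Δy)` by a triangular system with the nonzero diagonal entry `r`.
  -- Membership can therefore be read in either direction.
  have hdd (h : ℂ) {w : ℂ} (hw : w ∈ Ω) : dd h (canonicalLift y) w =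
      dd h r w • lightVec (y w) + r w • spaceIncl n (dd h y w) := by
    have hdy := diffAt_of_smooth hΩ hy.smooth hw
    have := dd_smul h (diffAt_of_smooth hΩ hrs hw) (diffAt_of_smooth hΩ hℓ hw)
    rw [dd_lightVec hdy] at this
    exact this
  have hdd2 (h : ℂ) : dd h (dd h (canonicalLift y)) z =
      dd h (dd h r) z • lightVec (y z) + (2 * dd h r z) • spaceIncl n (dd h y z)
        + r z • spaceIncl n (dd h (dd h y) z) := by
    have hdy := diffAt_of_smooth hΩ hy.smooth hz
    have hddy := diffAt_of_smooth hΩ (smooth_dd hΩ hy.smooth h) hz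
    have h1 := diffAt_of_smooth hΩ (smooth_dd hΩ hrs h) hz
    have h2 := diffAt_of_smooth hΩ hℓ hz
    have h3 := diffAt_of_smooth hΩ hrs hz
    have h4 : DifferentiableAt ℝ (fun w => spaceIncl n (dd h y w)) z :=
      (spaceIncl n).differentiableAt.comp z hddy
    rw [dd_congr hΩ h (fun w hw => hdd h hw) hz, dd_add h (h1.fun_smul h2) (h3.fun_smul h4),
      dd_smul h h1 h2, dd_smul h h3 h4, dd_lightVec hdy, dd_clm h _ hddy]
    module
  have hYu : du (canonicalLift y) z = du r z • lightVec (y z) + r z • spaceIncl n (du y z) :=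
    hdd 1 hz
  have hYv : dv (canonicalLift y) z = dv r z • lightVec (y z) + r z • spaceIncl n (dv y z) :=
    hdd Complex.I hz
  have hΔ : laplaceLift y z = lap r z • lightVec (y z) + (2 * du r z) • spaceIncl n (du y z)
      + (2 * dv r z) • spaceIncl n (dv y z) + r z • spaceIncl n (lap y z) := by
    have hu := hdd2 1
    have hv := hdd2 Complex.I
    simp only [← du_eq_dd] at hu
    simp only [← dv_eq_dd] at hv
    rw [laplaceLift, hu, hv, lap, lap, map_add]
    module
  have h2 : (Real.sqrt 2)⁻¹ * (Real.sqrt 2)⁻¹ = 1 / 2 := by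
    rw [← mul_inv, Real.mul_self_sqrt (by norm_num)]
    norm_num
  constructor
  · intro h
    have e0 := h 0
    have e1 := h 1
    have e2 : du (canonicalLift y) z ∈ V := h 2
    have e3 : dv (canonicalLift y) z ∈ V := h 3
    simp only [gaussBasis, Matrix.cons_val_zero, Matrix.cons_val_one] at e0 e1
    -- `Y` and `N` are recovered as the difference and the sum of the first two basis vectors,
    -- divided by `√2`.
    have hYm : canonicalLift y z ∈ V := by
      have := V.smul_mem (Real.sqrt 2)⁻¹ (V.sub_mem e0 e1)
      rw [← smul_sub, smul_smul, h2] at this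
      convert this using 1
      module
    have hNm : dualLift y z ∈ V := by
      have := V.smul_mem (Real.sqrt 2)⁻¹ (V.add_mem e0 e1)
      rw [← smul_add, smul_smul, h2] at this
      convert this using 1
      module
    have hℓm : lightVec (y z) ∈ V := by
      rwa [hY, V.smul_mem_iff hr0] at hYm
    have hum : spaceIncl n (du y z) ∈ V := by
      rwa [hYu, V.add_mem_iff_right (V.smul_mem _ hℓm), V.smul_mem_iff hr0] at e2
    have hvm : spaceIncl n (dv y z) ∈ V := by
      rwa [hYv, V.add_mem_iff_right (V.smul_mem _ hℓm), V.smul_mem_iff hr0] at e3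
    have hΔm : laplaceLift y z ∈ V := by
      rwa [dualLift, V.add_mem_iff_left (V.smul_mem _ hYm),
        V.smul_mem_iff (by norm_num)] at hNm
    refine ⟨hℓm, hum, hvm, ?_⟩
    rwa [hΔ, V.add_mem_iff_right (V.add_mem (V.add_mem (V.smul_mem _ hℓm) (V.smul_mem _ hum))
      (V.smul_mem _ hvm)), V.smul_mem_iff hr0] at hΔm
  · rintro ⟨hℓm, hum, hvm, hlm⟩
    have hYm : canonicalLift y z ∈ V := by
      rw [hY]
      exact V.smul_mem _ hℓm
    have hΔm : laplaceLift y z ∈ V := by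
      rw [hΔ]
      exact V.add_mem (V.add_mem (V.add_mem (V.smul_mem _ hℓm) (V.smul_mem _ hum))
        (V.smul_mem _ hvm)) (V.smul_mem _ hlm)
    have hNm : dualLift y z ∈ V := V.add_mem (V.smul_mem _ hΔm) (V.smul_mem _ hYm)
    intro j
    fin_cases j
    · exact V.smul_mem _ (V.add_mem hYm hNm)
    · exact V.smul_mem _ (V.add_mem (V.neg_mem hYm) hNm)
    · change du (canonicalLift y) z ∈ V
      rw [hYu]
      exact V.add_mem (V.smul_mem _ hℓm) (V.smul_mem _ hum)
    · change dv (canonicalLift y) z ∈ V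
      rw [hYv]
      exact V.add_mem (V.smul_mem _ hℓm) (V.smul_mem _ hvm)

end Lift

/-! ### Naturality of the canonical lift and of the conformal Gauss map. -/

section Equivariance

variable {n : ℕ} {a b : EReal} {y : ℂ → Euc n} {z : ℂ}

lemma add_real_mem_strip (hz : z ∈ strip a b) (t : ℝ) : z + (t : ℂ) ∈ strip a b := by
  simpa [strip] using hz

/-- The spatial part of row `0` has squared length `(mat g 0 0)² - 1`. By Cauchy–Schwarz its product
with a unit vector is smaller in absolute value than `mat g 0 0`, which is positive. -/
lemma lorentz_lightVec_pos (g : SOPlus n) {p : Euc n} (hp : ‖p‖ = 1) :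
    0 < (mat g).mulVec (lightVec p) 0 := by
  have hA := mat_lorentz g
  have hA0 : 0 < mat g 0 0 := g.2.2
  have hexp : (mat g).mulVec (lightVec p) 0 =
      mat g 0 0 + ∑ i : Fin (n + 3), mat g 0 i.succ * p i := by
    rw [Matrix.mulVec, dotProduct, Fin.sum_univ_succ]
    simp [lightVec_zero, lightVec_succ]
  have hcs := Finset.sum_mul_sq_le_sq_mul_sq Finset.univ
    (fun i : Fin (n + 3) => mat g 0 i.succ) (fun i => p i)
  have hp2 : ∑ i, p i ^ 2 = 1 := by
    have := real_inner_self_eq_norm_sq p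
    rw [hp, real_inner_eq_sum] at this
    simpa [sq] using this
  rw [lorentz_row hA, hp2] at hcs
  have := abs_lt_of_sq_lt_sq (a := ∑ i : Fin (n + 3), mat g 0 i.succ * p i) (b := mat g 0 0)
    (by linarith) hA0.le
  rw [hexp]
  linarith [(abs_lt.mp this).1]

lemma lightVec_sphereAct (g : SOPlus n) {p : Euc n} (hp : ‖p‖ = 1) :
    lightVec (sphereAct g p) =
      ((mat g).mulVec (lightVec p) 0)⁻¹ • (mat g).mulVec (lightVec p) := by
  have h := (lorentz_lightVec_pos g hp).ne'
  ext i
  refine Fin.cases ?_ (fun j => ?_) i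
  · rw [lightVec_zero, Pi.smul_apply, smul_eq_mul, inv_mul_cancel₀ h]
  · rw [lightVec_succ, Pi.smul_apply, smul_eq_mul, inv_mul_eq_div]
    rfl

lemma sphereAct_one (p : Euc n) : sphereAct (1 : SOPlus n) p = p := by
  ext i
  have : mat (1 : SOPlus n) = 1 := rfl
  simp [sphereAct, this, lightVec_zero, lightVec_succ]

/-- The linear map of a matrix as a continuous linear map. -/
def mulVecCLM (A : Matrix (Fin (n + 4)) (Fin (n + 4)) ℝ) :
    (Fin (n + 4) → ℝ) →L[ℝ] (Fin (n + 4) → ℝ) :=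
  LinearMap.toContinuousLinearMap A.mulVecLin

lemma mulVecCLM_apply (A : Matrix (Fin (n + 4)) (Fin (n + 4)) ℝ) (v : Fin (n + 4) → ℝ) :
    mulVecCLM A v = A.mulVec v := rfl

variable {Ω : Set ℂ}

/-- The action gives `(1, y (w + t)) = h⁻¹ A (1, y w)` with a variable factor `h`. Differentiating
`h⁻¹` adds only a multiple of the null vector `A (1, y)`, which is orthogonal to `A (0, y_u)`. Hence
`|y_u|` is scaled by `h⁻¹` too, and the factor cancels in the canonical lift. -/
lemma canonicalLift_equivariant (hΩ : IsOpen Ω) (hy : IsConformalImmersion Ω y) {t : ℂ}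
    (hz : z ∈ Ω) (ht : z + t ∈ Ω) {g : SOPlus n} (hg : ∀ w ∈ Ω, y (w + t) = sphereAct g (y w)) :
    canonicalLift y (z + t) = (mat g).mulVec (canonicalLift y z) := by
  set A := mat g with hA
  set h : ℂ → ℝ := fun w => A.mulVec (lightVec (y w)) 0 with hh
  have hpos {w : ℂ} (hw : w ∈ Ω) : 0 < h w := lorentz_lightVec_pos g (hy.mem_sphere w hw)
  have hℓ := smooth_lightVec hy.smooth
  have hAℓ : ContDiffOn ℝ ∞ (fun w => mulVecCLM A (lightVec (y w))) Ω :=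
    (mulVecCLM A).contDiff.comp_contDiffOn hℓ
  have hhs : ContDiffOn ℝ ∞ h Ω := contDiffOn_pi.mp hAℓ 0
  have hinv : ContDiffOn ℝ ∞ (fun w => (h w)⁻¹) Ω := hhs.inv fun w hw => (hpos hw).ne'
  have htrans : ∀ w ∈ Ω, lightVec (y (w + t)) = (h w)⁻¹ • mulVecCLM A (lightVec (y w)) :=
    fun w hw => by
      rw [hg w hw, lightVec_sphereAct g (hy.mem_sphere w hw)]
      rfl
  have hd : spaceIncl n (du y (z + t)) = du (fun w => (h w)⁻¹) z • A.mulVec (lightVec (y z))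
      + (h z)⁻¹ • A.mulVec (spaceIncl n (du y z)) := by
    have h1 := dd_translate 1 t (fun w => lightVec (y w)) z
    rw [dd_lightVec (diffAt_of_smooth hΩ hy.smooth ht), dd_congr hΩ 1 htrans hz,
      dd_smul 1 (diffAt_of_smooth hΩ hinv hz) (diffAt_of_smooth hΩ hAℓ hz),
      dd_clm 1 _ (diffAt_of_smooth hΩ hℓ hz), dd_lightVec (diffAt_of_smooth hΩ hy.smooth hz)] at h1
    exact h1.symm
  have hn2 : ‖du y (z + t)‖ ^ 2 = ((h z)⁻¹ * ‖du y z‖) ^ 2 := by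
    have hL : A.transpose * minkowski n * A = minkowski n := mat_lorentz g
    rw [← real_inner_self_eq_norm_sq, ← mink_spaceIncl, hd]
    simp only [mink_add_left, mink_add_right, mink_smul_left, mink_smul_right, mink_mulVec hL,
      mink_comm (spaceIncl n (du y z)) (lightVec (y z)), mink_lightVec (hy.mem_sphere z hz),
      mink_lightVec_spaceIncl, mink_spaceIncl, real_inner_self_eq_norm_sq,
      real_inner_comm (du y z) (y z), inner_du_self hΩ hy hz]
    ring
  have hn : ‖du y (z + t)‖ = (h z)⁻¹ * ‖du y z‖ :=
    (sq_eq_sq₀ (norm_nonneg _)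
      (mul_nonneg (inv_nonneg.mpr (hpos hz).le) (norm_nonneg _))).mp hn2
  have hne := (hpos hz).ne'
  rw [canonicalLift, canonicalLift, hn, htrans z hz, smul_smul, Matrix.mulVec_smul,
    mulVecCLM_apply, mul_inv, inv_inv]
  congr 1
  field_simp

/-- The Gauss basis transforms equivariantly under conformal transformations. -/
lemma gaussBasis_equivariant (hΩ : IsOpen Ω) (hy : IsConformalImmersion Ω y) {t : ℂ}
    (ht : ∀ w ∈ Ω, w + t ∈ Ω) {g : SOPlus n} (hg : ∀ w ∈ Ω, y (w + t) = sphereAct g (y w))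
    (hz : z ∈ Ω) (j : Fin 4) :
    gaussBasis y (z + t) j = (mat g).mulVec (gaussBasis y z j) := by
  set A := mat g with hA
  -- The matrix is constant, so differentiation preserves equivariance. The Gauss basis is built
  -- from `Y` by derivatives and Lorentz-invariant products.
  have step (h : ℂ) {f : ℂ → Fin (n + 4) → ℝ} (hf : ContDiffOn ℝ ∞ f Ω)
      (he : ∀ w ∈ Ω, f (w + t) = A.mulVec (f w)) {w : ℂ} (hw : w ∈ Ω) :
      dd h f (w + t) = A.mulVec (dd h f w) := by
    rw [← dd_translate, dd_congr hΩ h (g := fun w => mulVecCLM A (f w)) he hw,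
      dd_clm h _ (diffAt_of_smooth hΩ hf hw), mulVecCLM_apply]
  have hY := smooth_canonicalLift hΩ hy
  have e0 : ∀ w ∈ Ω, canonicalLift y (w + t) = A.mulVec (canonicalLift y w) := fun w hw =>
    canonicalLift_equivariant hΩ hy hw (ht w hw) hg
  have e1 : laplaceLift y (z + t) = A.mulVec (laplaceLift y z) := by
    have hu := step 1 (smooth_dd hΩ hY 1) (fun w hw => step 1 hY e0 hw) hz
    have hv := step Complex.I (smooth_dd hΩ hY Complex.I)
      (fun w hw => step Complex.I hY e0 hw) hz
    simp only [← du_eq_dd] at hu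
    simp only [← dv_eq_dd] at hv
    rw [laplaceLift, laplaceLift, hu, hv, Matrix.mulVec_add]
  have e2 : dualLift y (z + t) = A.mulVec (dualLift y z) := by
    rw [dualLift, dualLift, e1, e0 z hz, mink_mulVec (mat_lorentz g), Matrix.mulVec_add,
      Matrix.mulVec_smul, Matrix.mulVec_smul]
  fin_cases j
  · change (Real.sqrt 2)⁻¹ • (canonicalLift y (z + t) + dualLift y (z + t)) =
      A.mulVec ((Real.sqrt 2)⁻¹ • (canonicalLift y z + dualLift y z))
    rw [e2, e0 z hz, Matrix.mulVec_smul, Matrix.mulVec_add]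
  · change (Real.sqrt 2)⁻¹ • (-canonicalLift y (z + t) + dualLift y (z + t)) =
      A.mulVec ((Real.sqrt 2)⁻¹ • (-canonicalLift y z + dualLift y z))
    rw [e2, e0 z hz, Matrix.mulVec_smul, Matrix.mulVec_add, Matrix.mulVec_neg]
  · exact step 1 hY e0 hz
  · exact step Complex.I hY e0 hz

/-- The conformal Gauss map is equivariant under conformal transformations. -/
lemma gaussMap_equivariant (hΩ : IsOpen Ω) (hy : IsConformalImmersion Ω y) {f : ℂ → Gr n}
    (hf : IsConformalGaussMap Ω y f) {t : ℂ} (ht : ∀ w ∈ Ω, w + t ∈ Ω) {g : SOPlus n}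
    (hg : ∀ w ∈ Ω, y (w + t) = sphereAct g (y w)) (hz : z ∈ Ω) : f (z + t) = g • f z := by
  obtain ⟨F, hF, hFc⟩ := hf z hz
  obtain ⟨F', hF', hFc'⟩ := hf (z + t) (ht z hz)
  have : g • (F : Gr n) = ((g * F : SOPlus n) : Gr n) := rfl
  rw [hF, hF', this]
  refine coset_eq_of_lead_eq fun j i => ?_
  have h1 : mat F' i (lead n j) = gaussBasis y (z + t) j i := hFc' j i
  rw [h1, gaussBasis_equivariant hΩ hy ht hg hz, mat_mul, Matrix.mul_apply, Matrix.mulVec,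
    dotProduct]
  exact Finset.sum_congr rfl fun k _ => congrArg _ (hFc j k).symm

end Equivariance

/-! ### Smooth local frames adapted to the Gauss basis. -/

section LocalFrame

variable {n : ℕ}

lemma lorentz_iff {A : Matrix (Fin (n + 4)) (Fin (n + 4)) ℝ} :
    A.transpose * minkowski n * A = minkowski n ↔
      ∀ j l, mink (A.transpose j) (A.transpose l) = minkowski n j l := by
  have key (j l : Fin (n + 4)) :
      (A.transpose * minkowski n * A) j l = mink (A.transpose j) (A.transpose l) := by
    rw [mink_eq_sum, minkowski_eq, Matrix.mul_apply]
    refine Finset.sum_congr rfl fun i _ => ?_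
    rw [Matrix.mul_diagonal, Matrix.transpose_apply, Matrix.transpose_apply]
    ring
  rw [← Matrix.ext_iff]
  simp only [key]

/-- The rotation taking the vector `a` to the vector `b`, where `⟨a, a⟩ = ⟨b, b⟩ = ε = ±1`. -/
def rotTo (ε : ℝ) (a b x : Fin (n + 4) → ℝ) : Fin (n + 4) → ℝ :=
  x + (-(mink x (a + b) / (ε + mink a b))) • (a + b) + (2 * ε * mink x a) • b

/-- `rotTo ε a b` is the reflection in the hyperplane orthogonal to `a` followed by the one in the
hyperplane orthogonal to `a + b`. It is defined as long as `a + b` is not null, that is `ε + ⟨a, b⟩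
≠ 0`. -/
lemma mink_rotTo {ε : ℝ} {a b : Fin (n + 4) → ℝ} (hε : ε * ε = 1) (ha : mink a a = ε)
    (hb : mink b b = ε) (hc : ε + mink a b ≠ 0) (x w : Fin (n + 4) → ℝ) :
    mink (rotTo ε a b x) (rotTo ε a b w) = mink x w := by
  simp only [rotTo, mink_add_left, mink_add_right, mink_smul_left, mink_smul_right, ha, hb,
    mink_comm a w, mink_comm b w, mink_comm b a]
  generalize mink a b = c at *
  generalize mink x a = p
  generalize mink x b = q
  generalize mink w a = r
  generalize mink w b = s
  generalize mink x w = t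
  field_simp
  have h3 : ε ^ 2 = 1 := by rw [sq, hε]
  have h4 : ε ^ 3 = ε := by rw [pow_succ, h3, one_mul]
  have h5 : ε ^ 4 = 1 := by rw [pow_succ, h4, hε]
  have h6 : ε ^ 5 = ε := by rw [pow_succ, h5, one_mul]
  ring_nf
  simp only [h3, h4, h5, h6]
  ring

lemma rotTo_self {ε : ℝ} {a b : Fin (n + 4) → ℝ} (hε : ε * ε = 1) (ha : mink a a = ε)
    (hc : ε + mink a b ≠ 0) : rotTo ε a b a = b := by
  have h : 2 * ε * ε = 2 := by rw [mul_assoc, hε, mul_one]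
  rw [rotTo, mink_add_right, ha, div_self hc, h]
  module

lemma rotTo_of_orthogonal {ε : ℝ} {a b x : Fin (n + 4) → ℝ} (ha : mink x a = 0)
    (hb : mink x b = 0) : rotTo ε a b x = x := by
  simp [rotTo, mink_add_right, ha, hb]

variable {Ω : Set ℂ} {z₀ : ℂ}

/-- A family of `k ≤ 4` orthonormal vectors extends locally to a smooth Lorentz frame with
prescribed value at a point. -/
lemma exists_lorentz_extension (hΩ : IsOpen Ω) (hz₀ : z₀ ∈ Ω)
    {e : Fin 4 → ℂ → Fin (n + 4) → ℝ} (he : ∀ j, ContDiffOn ℝ ∞ (e j) Ω)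
    (ho : ∀ z ∈ Ω, ∀ i j, mink (e i z) (e j z) = minkowski n (lead n i) (lead n j))
    {A₀ : Matrix (Fin (n + 4)) (Fin (n + 4)) ℝ}
    (hA₀ : A₀.transpose * minkowski n * A₀ = minkowski n)
    (h₀ : ∀ j, A₀.transpose (lead n j) = e j z₀) (k : ℕ) :
    ∃ (U : Set ℂ) (A : ℂ → Matrix (Fin (n + 4)) (Fin (n + 4)) ℝ), IsOpen U ∧ z₀ ∈ U ∧ U ⊆ Ω ∧
      (∀ i j, ContDiffOn ℝ ∞ (fun z => A z i j) U) ∧ A z₀ = A₀ ∧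
      (∀ z ∈ U, (A z).transpose * minkowski n * A z = minkowski n) ∧
      ∀ z ∈ U, ∀ j : Fin 4, j.1 < k → (A z).transpose (lead n j) = e j z := by
  induction k with
  | zero =>
    exact ⟨Ω, fun _ => A₀, hΩ, hz₀, subset_rfl, fun _ _ => contDiffOn_const, rfl,
      fun _ _ => hA₀, fun _ _ _ h => absurd h (Nat.not_lt_zero _)⟩
  | succ k ih =>
    obtain ⟨U, A, hU, hzU, hUΩ, hAs, hAz, hAl, hAe⟩ := ih
    -- The induction turns one more column into `e k` at each stage by a rotation depending smoothly
    -- on `z`. Beyond four columns nothing is left to do.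
    by_cases hk : k < 4
    swap
    · exact ⟨U, A, hU, hzU, hUΩ, hAs, hAz, hAl, fun z hz j _ =>
        hAe z hz j (by have := j.2; omega)⟩
    set κ : Fin 4 := ⟨k, hk⟩ with hκ
    set ε : ℝ := minkowski n (lead n κ) (lead n κ) with hε
    have hεε : ε * ε = 1 := by
      rw [hε, minkowski_eq, Matrix.diagonal_apply_eq, sgn_mul_self]
    have hε0 : ε ≠ 0 := fun h => by simp [h] at hεε
    have hcols (j : Fin (n + 4)) : ContDiffOn ℝ ∞ (fun z => (A z).transpose j) U :=
      contDiffOn_pi.mpr fun i => hAs i j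
    set a : ℂ → Fin (n + 4) → ℝ := fun z => (A z).transpose (lead n κ) with ha
    have has : ContDiffOn ℝ ∞ a U := hcols _
    have hbs : ContDiffOn ℝ ∞ (e κ) U := (he κ).mono hUΩ
    have hcs : ContDiffOn ℝ ∞ (fun z => ε + mink (a z) (e κ z)) U :=
      contDiffOn_const.add (smooth_mink has hbs)
    have haa : ∀ z ∈ U, mink (a z) (a z) = ε := fun z hz => lorentz_iff.mp (hAl z hz) _ _
    have hbb : ∀ z ∈ U, mink (e κ z) (e κ z) = ε := fun z hz => ho z (hUΩ hz) _ _
    have ha0 : a z₀ = e κ z₀ := by rw [ha, ← h₀ κ, ← hAz]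
    -- The old column and its target agree at `z₀`, where the denominator is `2ε`, so it stays
    -- nonzero on a neighbourhood.
    set U' : Set ℂ := U ∩ {z | ε + mink (a z) (e κ z) ≠ 0} with hU'
    have hU'o : IsOpen U' := hcs.continuousOn.isOpen_inter_preimage hU isOpen_compl_singleton
    have hsub : U' ⊆ U := Set.inter_subset_left
    refine ⟨U', fun z => Matrix.of fun i j =>
      rotTo ε (a z) (e κ z) ((A z).transpose j) i, hU'o, ⟨hzU, ?_⟩, hsub.trans hUΩ, ?_, ?_, ?_, ?_⟩
    · change ε + mink (a z₀) (e κ z₀) ≠ 0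
      rw [ha0, hbb z₀ hzU, ← two_mul]
      exact mul_ne_zero two_ne_zero hε0
    · intro i j
      have hx := (hcols j).mono hsub
      have ha' := has.mono hsub
      have hb' := hbs.mono hsub
      have : ContDiffOn ℝ ∞ (fun z => rotTo ε (a z) (e κ z) ((A z).transpose j)) U' :=
        (hx.add (((smooth_mink hx (ha'.add hb')).div (hcs.mono hsub) fun z hz => hz.2).neg.smul
          (ha'.add hb'))).add ((contDiffOn_const.mul (smooth_mink hx ha')).smul hb')
      exact contDiffOn_pi.mp this i
    -- For `a = b` the two reflections coincide and their product is the identity, so the value at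
    -- `z₀` is kept.
    · rw [← hAz]
      ext i j
      simp only [Matrix.of_apply, ha0]
      have hj : mink ((A z₀).transpose j) (e κ z₀) = minkowski n j (lead n κ) := by
        rw [← ha0]
        exact lorentz_iff.mp (hAl z₀ hzU) _ _
      have h2 : mink ((A z₀).transpose j) (e κ z₀ + e κ z₀) / (ε + mink (e κ z₀) (e κ z₀))
          = ε * mink ((A z₀).transpose j) (e κ z₀) := by
        rw [mink_add_right, hbb z₀ hzU, ← two_mul, ← two_mul,
          mul_div_mul_left _ _ two_ne_zero, div_eq_iff hε0, mul_right_comm, hεε, one_mul]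
      rw [rotTo, h2]
      simp only [Pi.add_apply, Pi.smul_apply, smul_eq_mul, Matrix.transpose_apply]
      ring
    · intro z hz
      rw [lorentz_iff]
      intro j l
      have : ∀ j, (Matrix.of fun i j => rotTo ε (a z) (e κ z) ((A z).transpose j) i).transpose j
          = rotTo ε (a z) (e κ z) ((A z).transpose j) := fun j => rfl
      rw [this, this, mink_rotTo hεε (haa z hz.1) (hbb z hz.1) hz.2]
      exact lorentz_iff.mp (hAl z hz.1) _ _
    · intro z hz j hj
      change rotTo ε (a z) (e κ z) ((A z).transpose (lead n j)) = e j z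
      rcases Nat.lt_succ_iff_lt_or_eq.mp hj with hj | hj
      -- Columns already adjusted are orthogonal to both the old and the new `κ`-th column, so the
      -- rotation leaves them alone.
      · have hne : lead n j ≠ lead n κ := fun h => by
          have := congrArg Fin.val h
          rw [lead_val, lead_val] at this
          exact hj.ne this
        have hm : minkowski n (lead n j) (lead n κ) = 0 := by
          rw [minkowski_eq, Matrix.diagonal_apply_ne _ hne]
        have h1 : mink ((A z).transpose (lead n j)) (a z) = 0 :=
          (lorentz_iff.mp (hAl z hz.1) _ _).trans hm
        rw [rotTo_of_orthogonal h1, hAe z hz.1 j hj]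
        rw [hAe z hz.1 j hj]
        exact (ho z (hUΩ hz.1) _ _).trans hm
      · have : j = κ := Fin.ext hj
        subst this
        exact rotTo_self hεε (haa z hz.1) hz.2

/-- The conformal Gauss map has local smooth frames adapted to the Gauss basis. -/
lemma exists_adapted_frame (hΩ : IsOpen Ω) {y : ℂ → Euc n} (hy : IsConformalImmersion Ω y)
    {f : ℂ → Gr n} (hf : IsConformalGaussMap Ω y f) (hz₀ : z₀ ∈ Ω) :
    ∃ (U : Set ℂ) (F : ℂ → SOPlus n), IsOpen U ∧ z₀ ∈ U ∧ U ⊆ Ω ∧ IsFrame U f F ∧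
      ∀ z ∈ U, ∀ j, (mat (F z)).transpose (lead n j) = gaussBasis y z j := by
  classical
  have hcol {z : ℂ} (hz : z ∈ Ω) : ∃ F : SOPlus n, f z = F ∧
      ∀ j, (mat F).transpose (lead n j) = gaussBasis y z j := by
    obtain ⟨F, hF, hFc⟩ := hf z hz
    exact ⟨F, hF, fun j => funext fun i => hFc j i⟩
  obtain ⟨F₀, -, hF₀⟩ := hcol hz₀
  obtain ⟨U, A, hU, hzU, hUΩ, hAs, hAz, hAl, hAe⟩ :=
    exists_lorentz_extension hΩ hz₀ (e := fun j z => gaussBasis y z j)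
      (smooth_gaussBasis hΩ hy) (fun z hz i j => by
        obtain ⟨F, -, hF⟩ := hcol hz
        rw [← hF i, ← hF j]
        exact lorentz_iff.mp (mat_lorentz F) _ _) (mat_lorentz F₀) hF₀ 4
  have hdet : ContinuousOn (fun z => (A z).det) U := by
    simp only [Matrix.det_apply']
    exact continuousOn_finsetSum _ fun σ _ => continuousOn_const.mul
      (continuousOn_finsetProd _ fun i _ => (hAs _ _).continuousOn)
  -- The determinant squares to one and equals one at `z₀`, so positivity, an open condition, pins
  -- it to one. Time orientation is visible in the first column, which is shared with a frame in
  -- `SOPlus n`.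
  set U' : Set ℂ := U ∩ (fun z => (A z).det) ⁻¹' Set.Ioi 0 with hU'
  have hU'o : IsOpen U' := hdet.isOpen_inter_preimage hU isOpen_Ioi
  have hmem {z : ℂ} (hz : z ∈ U') : (A z).det = 1 ∧ 0 < A z 0 0 := by
    refine ⟨?_, ?_⟩
    · have h1 := det_sq_of_lorentz (hAl z hz.1)
      have h2 : 0 < (A z).det := hz.2
      nlinarith
    · obtain ⟨F, -, hF⟩ := hcol (hUΩ hz.1)
      have h1 := congrFun ((hAe z hz.1 0 (by norm_num)).trans (hF 0).symm) 0
      have h2 : A z 0 0 = mat F 0 0 := h1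
      rw [h2]
      exact F.2.2
  -- The value `1` outside `U'` is only a default; every statement about `F` concerns `U'`.
  set F : ℂ → SOPlus n := fun z =>
    if hz : z ∈ U' then ⟨⟨A z, (hmem hz).1⟩, hAl z hz.1, (hmem hz).2⟩ else 1 with hFdef
  have hFA : ∀ z ∈ U', mat (F z) = A z := fun z hz => by
    rw [hFdef]
    simp only [dif_pos hz]
    rfl
  have hlead : ∀ z ∈ U', ∀ j, (mat (F z)).transpose (lead n j) = gaussBasis y z j :=
    fun z hz j => by rw [hFA z hz, hAe z hz.1 j j.2]
  refine ⟨U', F, hU'o, ⟨hzU, ?_⟩, Set.inter_subset_left.trans hUΩ, ⟨fun i j => ?_, fun z hz => ?_⟩,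
    hlead⟩
  · change 0 < (A z₀).det
    rw [hAz]
    exact F₀.1.2.symm ▸ one_pos
  · exact ((hAs i j).mono Set.inter_subset_left).congr fun z hz => by rw [hFA z hz]
  · obtain ⟨F', hF', hFc⟩ := hcol (hUΩ hz.1)
    rw [hF']
    exact coset_eq_of_lead_eq fun j i => congrFun ((hFc j).trans (hlead z hz j).symm) i

end LocalFrame

open scoped Matrix

/-! ### Entrywise calculus of matrix-valued functions. -/

section MatrixCalculus

variable {n : ℕ} {U : Set ℂ} {z : ℂ}

/-- The entrywise derivative of a matrix valued function. -/
def mdd (h : ℂ) (A : ℂ → Matrix (Fin (n + 4)) (Fin (n + 4)) ℝ) (z : ℂ) :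
    Matrix (Fin (n + 4)) (Fin (n + 4)) ℝ :=
  Matrix.of fun i j => dd h (fun w => A w i j) z

/-- Entrywise smoothness of a matrix valued function. -/
def MSmooth (U : Set ℂ) (A : ℂ → Matrix (Fin (n + 4)) (Fin (n + 4)) ℝ) : Prop :=
  ∀ i j, ContDiffOn ℝ ∞ (fun z => A z i j) U

variable {A B : ℂ → Matrix (Fin (n + 4)) (Fin (n + 4)) ℝ}

lemma MSmooth.const (C : Matrix (Fin (n + 4)) (Fin (n + 4)) ℝ) : MSmooth U fun _ => C :=
  fun _ _ => contDiffOn_const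

lemma MSmooth.mul (hA : MSmooth U A) (hB : MSmooth U B) : MSmooth U fun w => A w * B w :=
  fun i j => by
    simp only [Matrix.mul_apply]
    exact ContDiffOn.sum fun k _ => (hA i k).mul (hB k j)

lemma MSmooth.transpose (hA : MSmooth U A) : MSmooth U fun w => (A w)ᵀ := fun i j => hA j i

lemma MSmooth.add (hA : MSmooth U A) (hB : MSmooth U B) : MSmooth U fun w => A w + B w :=
  fun i j => (hA i j).add (hB i j)

lemma MSmooth.sub (hA : MSmooth U A) (hB : MSmooth U B) : MSmooth U fun w => A w - B w :=
  fun i j => (hA i j).sub (hB i j)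

lemma MSmooth.smul (c : ℝ) (hA : MSmooth U A) : MSmooth U fun w => c • A w :=
  fun i j => (hA i j).const_smul c

lemma MSmooth.mdd (hU : IsOpen U) (hA : MSmooth U A) (h : ℂ) : MSmooth U (mdd h A) :=
  fun i j => smooth_dd hU (hA i j) h

lemma mdd_congr (hU : IsOpen U) (h : ℂ) (hAB : ∀ w ∈ U, A w = B w) (hz : z ∈ U) :
    mdd h A z = mdd h B z := by
  ext i j
  exact dd_congr hU h (fun w hw => by rw [hAB w hw]) hz

lemma mdd_const (h : ℂ) (C : Matrix (Fin (n + 4)) (Fin (n + 4)) ℝ) (z : ℂ) :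
    mdd h (fun _ => C) z = 0 := by
  ext i j
  exact dd_const h _ z

lemma mdd_add (hU : IsOpen U) (hA : MSmooth U A) (hB : MSmooth U B) (hz : z ∈ U) (h : ℂ) :
    mdd h (fun w => A w + B w) z = mdd h A z + mdd h B z := by
  ext i j
  exact dd_add h (diffAt_of_smooth hU (hA i j) hz) (diffAt_of_smooth hU (hB i j) hz)

lemma mdd_sub (hU : IsOpen U) (hA : MSmooth U A) (hB : MSmooth U B) (hz : z ∈ U) (h : ℂ) :
    mdd h (fun w => A w - B w) z = mdd h A z - mdd h B z := by
  ext i j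
  exact dd_sub h (diffAt_of_smooth hU (hA i j) hz) (diffAt_of_smooth hU (hB i j) hz)

lemma mdd_smul (hU : IsOpen U) (c : ℝ) (hA : MSmooth U A) (hz : z ∈ U) (h : ℂ) :
    mdd h (fun w => c • A w) z = c • mdd h A z := by
  ext i j
  exact dd_const_smul h c (diffAt_of_smooth hU (hA i j) hz)

lemma mdd_transpose (h : ℂ) : mdd h (fun w => (A w)ᵀ) z = (mdd h A z)ᵀ := rfl

lemma mdd_mul (hU : IsOpen U) (hA : MSmooth U A) (hB : MSmooth U B) (hz : z ∈ U) (h : ℂ) :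
    mdd h (fun w => A w * B w) z = mdd h A z * B z + A z * mdd h B z := by
  ext i j
  have dA k := diffAt_of_smooth hU (hA i k) hz
  have dB k := diffAt_of_smooth hU (hB k j) hz
  change dd h (fun w => (A w * B w) i j) z = _
  simp only [Matrix.add_apply, Matrix.mul_apply]
  rw [dd_sum _ h fun k _ => (dA k).fun_mul (dB k), ← Finset.sum_add_distrib]
  exact Finset.sum_congr rfl fun k _ => dd_mul h (dA k) (dB k)

lemma mdd_comm (hU : IsOpen U) (hA : MSmooth U A) (hz : z ∈ U) (h k : ℂ) :
    mdd h (mdd k A) z = mdd k (mdd h A) z := by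
  ext i j
  exact dd_comm hU (hA i j) hz h k

lemma dd_pi_apply {e : ℂ → Fin (n + 4) → ℝ} (hU : IsOpen U) (he : ContDiffOn ℝ ∞ e U)
    (hz : z ∈ U) (h : ℂ) (i : Fin (n + 4)) : dd h e z i = dd h (fun w => e w i) z :=
  (dd_clm h (ContinuousLinearMap.proj (R := ℝ) (φ := fun _ : Fin (n + 4) => ℝ) i)
    (diffAt_of_smooth hU he hz)).symm

lemma smooth_mulVec {e : ℂ → Fin (n + 4) → ℝ} (hA : MSmooth U A) (he : ContDiffOn ℝ ∞ e U) :
    ContDiffOn ℝ ∞ (fun w => A w *ᵥ e w) U :=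
  contDiffOn_pi.mpr fun i => by
    simp only [Matrix.mulVec, dotProduct]
    exact ContDiffOn.sum fun k _ => (hA i k).mul (contDiffOn_pi.mp he k)

lemma dd_mulVec {e : ℂ → Fin (n + 4) → ℝ} (hU : IsOpen U) (hA : MSmooth U A)
    (he : ContDiffOn ℝ ∞ e U) (hz : z ∈ U) (h : ℂ) :
    dd h (fun w => A w *ᵥ e w) z = mdd h A z *ᵥ e z + A z *ᵥ dd h e z := by
  ext i
  have dA k := diffAt_of_smooth hU (hA i k) hz
  have de k := diffAt_of_smooth hU (contDiffOn_pi.mp he k) hz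
  rw [dd_pi_apply hU (smooth_mulVec hA he) hz]
  simp only [Matrix.mulVec, dotProduct, Pi.add_apply]
  rw [dd_sum _ h fun k _ => (dA k).fun_mul (de k), ← Finset.sum_add_distrib]
  exact Finset.sum_congr rfl fun k _ => by
    rw [dd_mul h (dA k) (de k), dd_pi_apply hU he hz]
    rfl

end MatrixCalculus

/-! ### The tension of the Gauss reflection and the Willmore equation. -/

section Tension

variable {n : ℕ} {U : Set ℂ} {z : ℂ}

/-- The tension `∂_u (Q_u Q) + ∂_v (Q_v Q)` of a field of reflections. -/
def tension (Q : ℂ → Matrix (Fin (n + 4)) (Fin (n + 4)) ℝ) (z : ℂ) :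
    Matrix (Fin (n + 4)) (Fin (n + 4)) ℝ :=
  (mdd 1 (mdd 1 Q) z * Q z + mdd 1 Q z * mdd 1 Q z)
    + (mdd Complex.I (mdd Complex.I Q) z * Q z + mdd Complex.I Q z * mdd Complex.I Q z)

variable {Q : ℂ → Matrix (Fin (n + 4)) (Fin (n + 4)) ℝ} {e : ℂ → Fin (n + 4) → ℝ}

/-- This is the derivative of `Q e = e`. -/
lemma mdd_mulVec_of_fixed (hU : IsOpen U) (hQ : MSmooth U Q) (he : ContDiffOn ℝ ∞ e U)
    (hfix : ∀ w ∈ U, Q w *ᵥ e w = e w) (hz : z ∈ U) (h : ℂ) :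
    mdd h Q z *ᵥ e z = dd h e z - Q z *ᵥ dd h e z := by
  have := dd_mulVec hU hQ he hz h
  rw [dd_congr hU h hfix hz] at this
  exact eq_sub_of_add_eq this.symm

/-- Differentiating `Q e = e` twice eliminates the second derivative of `Q`: only `Q`, its first
derivatives and the derivatives of the section remain. -/
lemma mdd_mdd_mulVec_of_fixed (hU : IsOpen U) (hQ : MSmooth U Q) (he : ContDiffOn ℝ ∞ e U)
    (hfix : ∀ w ∈ U, Q w *ᵥ e w = e w) (hz : z ∈ U) (h : ℂ) :
    (mdd h (mdd h Q) z * Q z + mdd h Q z * mdd h Q z) *ᵥ e z =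
      (dd h (dd h e) z - Q z *ᵥ dd h (dd h e) z)
        - mdd h Q z *ᵥ (dd h e z + Q z *ᵥ dd h e z) := by
  have hde := smooth_dd hU he h
  have h1 : ∀ w ∈ U, mdd h Q w *ᵥ e w + Q w *ᵥ dd h e w = dd h e w := fun w hw => by
    rw [mdd_mulVec_of_fixed hU hQ he hfix hw h, sub_add_cancel]
  have hs1 := smooth_mulVec (hQ.mdd hU h) he
  have hs2 := smooth_mulVec hQ hde
  have h2 := dd_congr hU h h1 hz
  rw [dd_add h (diffAt_of_smooth hU hs1 hz) (diffAt_of_smooth hU hs2 hz),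
    dd_mulVec hU (hQ.mdd hU h) he hz, dd_mulVec hU hQ hde hz] at h2
  have h3 := mdd_mulVec_of_fixed hU hQ he hfix hz h
  rw [Matrix.add_mulVec, ← Matrix.mulVec_mulVec, ← Matrix.mulVec_mulVec, hfix z hz, h3,
    Matrix.mulVec_sub, Matrix.mulVec_add]
  linear_combination h2

lemma tension_mulVec (hU : IsOpen U) (hQ : MSmooth U Q) (he : ContDiffOn ℝ ∞ e U)
    (hfix : ∀ w ∈ U, Q w *ᵥ e w = e w) (hz : z ∈ U) :
    tension Q z *ᵥ e z = (lap e z - Q z *ᵥ lap e z)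
      - mdd 1 Q z *ᵥ (du e z + Q z *ᵥ du e z)
      - mdd Complex.I Q z *ᵥ (dv e z + Q z *ᵥ dv e z) := by
  have hu := mdd_mdd_mulVec_of_fixed hU hQ he hfix hz 1
  have hv := mdd_mdd_mulVec_of_fixed hU hQ he hfix hz Complex.I
  rw [tension, Matrix.add_mulVec, hu, hv, lap]
  simp only [du_eq_dd, dv_eq_dd, Matrix.mulVec_add]
  abel

variable {y : ℂ → Euc n}

/-- `Q` is the field of reflections whose fixed space is the conformal Gauss map of `y`, i.e. the
span of `(1, y)`, `(0, y_u)`, `(0, y_v)`, `(0, Δy)`. -/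
structure IsGaussReflection (U : Set ℂ) (y : ℂ → Euc n)
    (Q : ℂ → Matrix (Fin (n + 4)) (Fin (n + 4)) ℝ) : Prop where
  smooth : MSmooth U Q
  fix_light : ∀ z ∈ U, Q z *ᵥ lightVec (y z) = lightVec (y z)
  fix_du : ∀ z ∈ U, Q z *ᵥ spaceIncl n (du y z) = spaceIncl n (du y z)
  fix_dv : ∀ z ∈ U, Q z *ᵥ spaceIncl n (dv y z) = spaceIncl n (dv y z)
  fix_lap : ∀ z ∈ U, Q z *ᵥ spaceIncl n (lap y z) = spaceIncl n (lap y z)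
  neg : ∀ z ∈ U, ∀ x, mink x (lightVec (y z)) = 0 → mink x (spaceIncl n (du y z)) = 0 →
    mink x (spaceIncl n (dv y z)) = 0 → mink x (spaceIncl n (lap y z)) = 0 → Q z *ᵥ x = -x

/-- Twice the projection along the conformal Gauss map, restricted to space-like vectors. -/
def normalProj (Q : ℂ → Matrix (Fin (n + 4)) (Fin (n + 4)) ℝ) (z : ℂ) :
    Euc n →ₗ[ℝ] (Fin (n + 4) → ℝ) :=
  (LinearMap.id - (Q z).mulVecLin) ∘ₗ (spaceIncl n).toLinearMap

lemma normalProj_apply (v : Euc n) :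
    normalProj Q z v = spaceIncl n v - Q z *ᵥ spaceIncl n v := rfl

lemma normalProj_eq_zero {v : Euc n} (h : Q z *ᵥ spaceIncl n v = spaceIncl n v) :
    normalProj Q z v = 0 := by
  rw [normalProj_apply, h, sub_self]

lemma smooth_spaceIncl {v : ℂ → Euc n} (hv : ContDiffOn ℝ ∞ v U) :
    ContDiffOn ℝ ∞ (fun w => spaceIncl n (v w)) U :=
  (spaceIncl n).contDiff.comp_contDiffOn hv

lemma mdd_mulVec_spaceIncl (hU : IsOpen U) (hQ : MSmooth U Q) {v : ℂ → Euc n}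
    (hv : ContDiffOn ℝ ∞ v U) (hfix : ∀ w ∈ U, Q w *ᵥ spaceIncl n (v w) = spaceIncl n (v w))
    (hz : z ∈ U) (h : ℂ) :
    mdd h Q z *ᵥ spaceIncl n (v z) = normalProj Q z (dd h v z) := by
  rw [mdd_mulVec_of_fixed hU hQ (smooth_spaceIncl hv) hfix hz,
    dd_clm h _ (diffAt_of_smooth hU hv hz), normalProj_apply]

lemma tension_mulVec_spaceIncl (hU : IsOpen U) (hQ : MSmooth U Q) {v : ℂ → Euc n}
    (hv : ContDiffOn ℝ ∞ v U) (hfix : ∀ w ∈ U, Q w *ᵥ spaceIncl n (v w) = spaceIncl n (v w))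
    (hz : z ∈ U) :
    tension Q z *ᵥ spaceIncl n (v z) = normalProj Q z (lap v z)
      - mdd 1 Q z *ᵥ (spaceIncl n (du v z) + Q z *ᵥ spaceIncl n (du v z))
      - mdd Complex.I Q z *ᵥ (spaceIncl n (dv v z) + Q z *ᵥ spaceIncl n (dv v z)) := by
  have h1 (h : ℂ) {w : ℂ} (hw : w ∈ U) : dd h (fun w => spaceIncl n (v w)) w
      = spaceIncl n (dd h v w) := dd_clm h _ (diffAt_of_smooth hU hv hw)
  have h2 (h : ℂ) : dd h (dd h fun w => spaceIncl n (v w)) z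
      = spaceIncl n (dd h (dd h v) z) := by
    rw [dd_congr hU h (fun w hw => h1 h hw) hz,
      dd_clm h _ (diffAt_of_smooth hU (smooth_dd hU hv h) hz)]
  have h3 : lap (fun w => spaceIncl n (v w)) z = spaceIncl n (lap v z) := by
    have hu := h2 1
    have hvv := h2 Complex.I
    rw [lap, lap, map_add]
    exact congrArg₂ (· + ·) hu hvv
  rw [tension_mulVec hU hQ (smooth_spaceIncl hv) hfix hz, h3, normalProj_apply]
  have hu := h1 1 hz
  have hvv := h1 Complex.I hz
  rw [du_eq_dd, dv_eq_dd, hu, hvv]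
  rfl

lemma IsGaussReflection.mdd_mulVec_light (hU : IsOpen U) (hy : IsConformalImmersion U y)
    (hQ : IsGaussReflection U y Q) (hz : z ∈ U) (h : ℂ) :
    mdd h Q z *ᵥ lightVec (y z) = normalProj Q z (dd h y z) := by
  rw [mdd_mulVec_of_fixed hU hQ.smooth (smooth_lightVec hy.smooth) hQ.fix_light hz,
    dd_lightVec (diffAt_of_smooth hU hy.smooth hz), normalProj_apply]

/-- A space-like vector is decomposed along the conformal Gauss map. -/
lemma IsGaussReflection.add_mulVec_spaceIncl (hU : IsOpen U) (hy : IsConformalImmersion U y)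
    (hQ : IsGaussReflection U y Q) (hz : z ∈ U) {x : Euc n} (hx : ⟪x, y z⟫ = 0) :
    spaceIncl n x + Q z *ᵥ spaceIncl n x =
      (2 * ⟪x, du y z⟫ / conf y z) • spaceIncl n (du y z)
        + (2 * ⟪x, dv y z⟫ / conf y z) • spaceIncl n (dv y z)
        - (2 * ⟪x, meanVec y z⟫) • lightVec (y z) := by
  have hm := (conf_pos hy hz).ne'
  have huu : ⟪du y z, du y z⟫ = conf y z := rfl
  -- `r` is `x` minus its projection to the 4-plane. The null vector `(1, y)` is dual to `(0, ν)`,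
  -- with `ν = meanVec y`, because `⟨y, ν⟩ = -1`. No multiple of `(0, ν)` enters the projection
  -- since `x` is orthogonal to `y`.
  set r : Fin (n + 4) → ℝ := spaceIncl n x + (-(⟪x, du y z⟫ / conf y z)) • spaceIncl n (du y z)
    + (-(⟪x, dv y z⟫ / conf y z)) • spaceIncl n (dv y z) + ⟪x, meanVec y z⟫ • lightVec (y z)
    with hr
  have hsl (v : Euc n) : mink (spaceIncl n v) (lightVec (y z)) = ⟪v, y z⟫ := by
    rw [mink_comm, mink_lightVec_spaceIncl, real_inner_comm]
  have hyu : ⟪y z, du y z⟫ = 0 := by rw [real_inner_comm, inner_du_self hU hy hz]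
  have hyv : ⟪y z, dv y z⟫ = 0 := by rw [real_inner_comm, inner_dv_self hU hy hz]
  have hyl : ⟪y z, meanVec y z⟫ = -1 := by rw [real_inner_comm, inner_meanVec_self hU hy hz]
  have hul : ⟪du y z, meanVec y z⟫ = 0 := by rw [real_inner_comm, inner_meanVec_du hU hy hz]
  have hvl : ⟪dv y z, meanVec y z⟫ = 0 := by rw [real_inner_comm, inner_meanVec_dv hU hy hz]
  have hneg : Q z *ᵥ r = -r := by
    apply hQ.neg z hz
    · simp only [hr, mink_add_left, mink_smul_left, hsl, mink_lightVec (hy.mem_sphere z hz),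
        hx, inner_du_self hU hy hz, inner_dv_self hU hy hz]
      ring
    · simp only [hr, mink_add_left, mink_smul_left, mink_spaceIncl, mink_lightVec_spaceIncl, hyu,
        inner_dv_du hy hz, huu]
      field_simp
      ring
    · simp only [hr, mink_add_left, mink_smul_left, mink_spaceIncl, mink_lightVec_spaceIncl, hyv,
        hy.orthogonal z hz, inner_dv_dv hy hz]
      field_simp
      ring
    · simp only [hr, mink_add_left, mink_smul_left, mink_spaceIncl, mink_lightVec_spaceIncl,
        lap_eq_smul_meanVec hy hz, real_inner_smul_right, hyl, hul, hvl]
      ring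
  have h1 := hneg
  rw [hr, Matrix.mulVec_add, Matrix.mulVec_add, Matrix.mulVec_add, Matrix.mulVec_smul,
    Matrix.mulVec_smul, Matrix.mulVec_smul, hQ.fix_light z hz, hQ.fix_du z hz,
    hQ.fix_dv z hz] at h1
  have h2 : Q z *ᵥ spaceIncl n x = -r + (⟪x, du y z⟫ / conf y z) • spaceIncl n (du y z)
      + (⟪x, dv y z⟫ / conf y z) • spaceIncl n (dv y z)
      - ⟪x, meanVec y z⟫ • lightVec (y z) := by
    rw [hr, ← h1]
    module
  rw [h2, hr]
  module

lemma IsGaussReflection.mdd_mulVec_add (hU : IsOpen U) (hy : IsConformalImmersion U y)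
    (hQ : IsGaussReflection U y Q) (hz : z ∈ U) {x : Euc n} (hx : ⟪x, y z⟫ = 0) (h : ℂ) :
    mdd h Q z *ᵥ (spaceIncl n x + Q z *ᵥ spaceIncl n x) =
      (2 * ⟪x, du y z⟫ / conf y z) • normalProj Q z (dd h (du y) z)
        + (2 * ⟪x, dv y z⟫ / conf y z) • normalProj Q z (dd h (dv y) z)
        - (2 * ⟪x, meanVec y z⟫) • normalProj Q z (dd h y z) := by
  rw [hQ.add_mulVec_spaceIncl hU hy hz hx, Matrix.mulVec_sub, Matrix.mulVec_add,
    Matrix.mulVec_smul, Matrix.mulVec_smul, Matrix.mulVec_smul, hQ.mdd_mulVec_light hU hy hz,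
    mdd_mulVec_spaceIncl hU hQ.smooth (smooth_du hU hy.smooth) hQ.fix_du hz,
    mdd_mulVec_spaceIncl hU hQ.smooth (smooth_dv hU hy.smooth) hQ.fix_dv hz]

lemma IsGaussReflection.fix_meanVec (hQ : IsGaussReflection U y Q) (hz : z ∈ U) :
    Q z *ᵥ spaceIncl n (meanVec y z) = spaceIncl n (meanVec y z) := by
  rw [meanVec, map_smul, Matrix.mulVec_smul, hQ.fix_lap z hz]

lemma IsGaussReflection.mdd_mulVec_lap (hU : IsOpen U) (hy : IsConformalImmersion U y)
    (hQ : IsGaussReflection U y Q) (hz : z ∈ U) (h : ℂ) :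
    mdd h Q z *ᵥ spaceIncl n (lap y z) = normalProj Q z (dd h (lap y) z) :=
  mdd_mulVec_spaceIncl hU hQ.smooth (smooth_lap hU hy.smooth) hQ.fix_lap hz h

/-- The tension of the Gauss reflection kills the conformal Gauss map of a solution of the
Euler–Lagrange equation. -/
lemma IsGaussReflection.tension_mulVec_gaussBasis (hU : IsOpen U)
    (hy : IsConformalImmersion U y) (hQ : IsGaussReflection U y Q)
    (hEL : ∀ w ∈ U, eulerLagrange y w = 0) (hz : z ∈ U) (j : Fin 4) :
    tension Q z *ᵥ gaussBasis y z j = 0 := by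
  have hm := (conf_pos hy hz).ne'
  have su := smooth_du hU hy.smooth
  have sv := smooth_dv hU hy.smooth
  have pu : normalProj Q z (du y z) = 0 := normalProj_eq_zero (hQ.fix_du z hz)
  have pv : normalProj Q z (dv y z) = 0 := normalProj_eq_zero (hQ.fix_dv z hz)
  have pl : normalProj Q z (lap y z) = 0 := normalProj_eq_zero (hQ.fix_lap z hz)
  -- Since `Δy` lies in the 4-plane, `y_uu` and `y_vv` have opposite normal components.
  have pvv : normalProj Q z (dv (dv y) z) = -normalProj Q z (du (du y) z) := by
    rw [lap, map_add] at pl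
    exact eq_neg_of_add_eq_zero_right pl
  have hdouble (v : Euc n) (h : Q z *ᵥ spaceIncl n v = spaceIncl n v) :
      spaceIncl n v + Q z *ᵥ spaceIncl n v = (2 : ℝ) • spaceIncl n v := by
    rw [h, two_smul]
  have hq : hopfRe y z = du (du y) z - dv (dv y) z := rfl
  have hp : hopfIm y z = (2 : ℝ) • dv (du y) z := rfl
  have hqy : ⟪hopfRe y z, y z⟫ = 0 := by
    rw [hq, inner_sub_left, inner_uu_self hU hy hz, inner_vv_self hU hy hz, sub_self]
  have hqu : ⟪hopfRe y z, du y z⟫ = du (conf y) z := by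
    rw [hq, inner_sub_left, inner_uu_u hU hy hz, inner_vv_u hU hy hz]
    ring
  have hqv : ⟪hopfRe y z, dv y z⟫ = -dv (conf y) z := by
    rw [hq, inner_sub_left, inner_uu_v hU hy hz, inner_vv_v hU hy hz]
    ring
  have hr := inner_uv_self hU hy hz
  have hru := inner_uv_u hU hy hz
  have hrv := inner_uv_v hU hy hz
  -- `y_uu` and `y_vv` are not orthogonal to `y`, so the decomposition formula does not apply to
  -- them directly. Their Laplacian halves are fixed by `Q`, and the remaining halves are orthogonal
  -- to `y`.
  have euu : du (du y) z = (1 / 2 : ℝ) • lap y z + (1 / 2 : ℝ) • hopfRe y z := by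
    rw [hq, lap]
    module
  have evv : dv (dv y) z = (1 / 2 : ℝ) • lap y z + (-(1 / 2) : ℝ) • hopfRe y z := by
    rw [hq, lap]
    module
  have huv := du_dv_eq hU hy hz
  have hlapu : lap (du y) z = du (lap y) z := by
    have s1 := diffAt_of_smooth hU (smooth_du hU su) hz
    have s2 := diffAt_of_smooth hU (smooth_dv hU sv) hz
    have h1 : du (lap y) z = _ := dd_add 1 s1 s2
    have h2 : dv (dv (du y)) z = du (dv (dv y)) z := by
      have e1 : dv (dv (du y)) z = dv (du (dv y)) z :=
        dd_congr hU Complex.I (fun w hw => (du_dv_eq hU hy hw).symm) hz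
      rw [e1]
      exact dd_comm hU sv hz Complex.I 1
    rw [h1, lap, h2]
    rfl
  have hlapv : lap (dv y) z = dv (lap y) z := by
    have s1 := diffAt_of_smooth hU (smooth_du hU su) hz
    have s2 := diffAt_of_smooth hU (smooth_dv hU sv) hz
    have h1 : dv (lap y) z = _ := dd_add Complex.I s1 s2
    have h2 : du (du (dv y)) z = dv (du (du y)) z := by
      have e1 : du (du (dv y)) z = du (dv (du y)) z :=
        dd_congr hU 1 (fun w hw => du_dv_eq hU hy hw) hz
      rw [e1]
      exact dd_comm hU su hz 1 Complex.I
    rw [h1, lap, h2]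
    rfl
  -- the values of the first derivatives of `Q`
  have Qu (x : Euc n) (hx : ⟪x, y z⟫ = 0) := hQ.mdd_mulVec_add hU hy hz hx 1
  have Qv (x : Euc n) (hx : ⟪x, y z⟫ = 0) := hQ.mdd_mulVec_add hU hy hz hx Complex.I
  simp only [← du_eq_dd, huv, pu, smul_zero, sub_zero] at Qu
  simp only [← dv_eq_dd, pvv, pv, smul_zero, sub_zero] at Qv
  have hsplit (A : Matrix (Fin (n + 4)) (Fin (n + 4)) ℝ) (c : ℝ) :
      A *ᵥ (spaceIncl n ((1 / 2 : ℝ) • lap y z + c • hopfRe y z)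
        + Q z *ᵥ spaceIncl n ((1 / 2 : ℝ) • lap y z + c • hopfRe y z)) =
      A *ᵥ spaceIncl n (lap y z)
        + c • A *ᵥ (spaceIncl n (hopfRe y z) + Q z *ᵥ spaceIncl n (hopfRe y z)) := by
    simp only [map_add, map_smul, Matrix.mulVec_add, Matrix.mulVec_smul, hQ.fix_lap z hz]
    module
  have lapu := hQ.mdd_mulVec_lap hU hy hz 1
  have lapv := hQ.mdd_mulVec_lap hU hy hz Complex.I
  have Quu := hsplit (mdd 1 Q z) (1 / 2)
  have Qvv := hsplit (mdd Complex.I Q z) (-(1 / 2))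
  rw [← euu, Qu _ hqy, lapu, hqu, hqv, ← du_eq_dd] at Quu
  rw [← evv, Qv _ hqy, lapv, hqu, hqv, ← dv_eq_dd] at Qvv
  -- For the first three vectors the Christoffel terms cancel by conformality; the Euler–Lagrange
  -- equation enters only for `Δy`.
  have hker : lightVec (y z) ∈ LinearMap.ker (tension Q z).mulVecLin ∧
      spaceIncl n (du y z) ∈ LinearMap.ker (tension Q z).mulVecLin ∧
      spaceIncl n (dv y z) ∈ LinearMap.ker (tension Q z).mulVecLin ∧
      spaceIncl n (lap y z) ∈ LinearMap.ker (tension Q z).mulVecLin := by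
    simp only [LinearMap.mem_ker, Matrix.mulVecLin_apply]
    refine ⟨?_, ?_, ?_, ?_⟩
    · have hl (h : ℂ) {w : ℂ} (hw : w ∈ U) : dd h (fun w => lightVec (y w)) w
          = spaceIncl n (dd h y w) := dd_lightVec (diffAt_of_smooth hU hy.smooth hw) h
      have hl2 (h : ℂ) : dd h (dd h fun w => lightVec (y w)) z
          = spaceIncl n (dd h (dd h y) z) := by
        rw [dd_congr hU h (fun w hw => hl h hw) hz,
          dd_clm h _ (diffAt_of_smooth hU (smooth_dd hU hy.smooth h) hz)]
      have hl3 : lap (fun w => lightVec (y w)) z = spaceIncl n (lap y z) := by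
        rw [lap, lap, map_add]
        exact congrArg₂ (· + ·) (hl2 1) (hl2 Complex.I)
      have hu : du (fun w => lightVec (y w)) z = spaceIncl n (du y z) := hl 1 hz
      have hv : dv (fun w => lightVec (y w)) z = spaceIncl n (dv y z) := hl Complex.I hz
      rw [tension_mulVec hU hQ.smooth (smooth_lightVec hy.smooth) hQ.fix_light hz, hl3, hu, hv,
        ← normalProj_apply, pl, hdouble _ (hQ.fix_du z hz), hdouble _ (hQ.fix_dv z hz),
        Matrix.mulVec_smul, Matrix.mulVec_smul,
        mdd_mulVec_spaceIncl hU hQ.smooth su hQ.fix_du hz,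
        mdd_mulVec_spaceIncl hU hQ.smooth sv hQ.fix_dv hz, ← du_eq_dd, ← dv_eq_dd, pvv]
      module
    · rw [tension_mulVec_spaceIncl hU hQ.smooth su hQ.fix_du hz, hlapu, Qv _ hr, hru, hrv, Quu]
      module
    · rw [tension_mulVec_spaceIncl hU hQ.smooth sv hQ.fix_dv hz, hlapv, huv, Qu _ hr, hru, hrv, Qvv]
      module
    -- Projecting the Euler–Lagrange equation off the 4-plane leaves `Δν + coefRe • hopfRe + coefIm
    -- • hopfIm`, where `ν = meanVec y`. This is precisely the tension applied to `ν`.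
    · have hν : tension Q z *ᵥ spaceIncl n (meanVec y z) = 0 := by
        have hd0 (h : ℂ) (h0 : ⟪meanVec y z, dd h y z⟫ = 0) :
            ⟪dd h (meanVec y) z, y z⟫ = 0 := by
          rw [inner_dd_meanVec_self hU hy hz, h0, neg_zero]
        have hdu := hd0 1 (inner_meanVec_du hU hy hz)
        have hdv := hd0 Complex.I (inner_meanVec_dv hU hy hz)
        have i1 := inner_dd_meanVec_du hU hy hz 1
        have i2 := inner_dd_meanVec_dv hU hy hz 1
        have i3 := inner_dd_meanVec_du hU hy hz Complex.I
        have i4 := inner_dd_meanVec_dv hU hy hz Complex.I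
        simp only [← du_eq_dd, huv] at hdu i1 i2
        simp only [← dv_eq_dd] at hdv i3 i4
        obtain ⟨c₁, c₂, hc⟩ := exists_eulerLagrange_eq hU hy hz
        have hE := congrArg (normalProj Q z) (hc.symm.trans (hEL z hz))
        simp only [map_add, map_smul, pu, pv, pl, smul_zero, add_zero, map_zero, hq, hp, map_sub,
          pvv] at hE
        rw [tension_mulVec_spaceIncl hU hQ.smooth (smooth_meanVec hU hy)
          (fun w hw => hQ.fix_meanVec hw) hz, Qu _ hdu, Qv _ hdv, i1, i2, i3, i4, ← hE, coefRe,
          coefIm, hq, hp, inner_sub_right, real_inner_smul_right]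
        module
      rw [lap_eq_smul_meanVec hy hz, map_smul, Matrix.mulVec_smul, hν, smul_zero]
  have := (gaussBasis_mem hU hy hz (LinearMap.ker (tension Q z).mulVecLin)).mpr hker j
  simpa using this

end Tension

/-! ### Maurer–Cartan form, symmetric involution and tension in a frame. -/

section MaurerCartan

variable {n : ℕ} {U : Set ℂ} {z : ℂ}

/-- The reflection `diag(1, …, 1, -1, …, -1)` defining the symmetric decomposition. -/
def blockSign (n : ℕ) : Matrix (Fin (n + 4)) (Fin (n + 4)) ℝ :=
  Matrix.diagonal fun i => if i.1 < 4 then 1 else -1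

lemma blockSign_mul_self : blockSign n * blockSign n = 1 := by
  rw [blockSign, Matrix.diagonal_mul_diagonal, ← Matrix.diagonal_one]
  congr 1
  funext i
  split_ifs <;> simp

lemma blockSign_conj_apply (A : Matrix (Fin (n + 4)) (Fin (n + 4)) ℝ) (i j : Fin (n + 4)) :
    (blockSign n * A * blockSign n) i j = if SameBlock i j then A i j else -A i j := by
  rw [blockSign, Matrix.mul_diagonal, Matrix.diagonal_mul]
  by_cases hi : i.1 < 4 <;> by_cases hj : j.1 < 4 <;> simp [SameBlock, hi, hj]

/-- The Maurer–Cartan coefficient `F⁻¹ dF(h)`. -/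
def mc (F : ℂ → SOPlus n) (h : ℂ) (z : ℂ) : Matrix (Fin (n + 4)) (Fin (n + 4)) ℝ :=
  mat (F z)⁻¹ * mdd h (fun w => mat (F w)) z

/-- The image of the Maurer–Cartan coefficient under the symmetric involution. -/
def mcInv (F : ℂ → SOPlus n) (h : ℂ) (z : ℂ) : Matrix (Fin (n + 4)) (Fin (n + 4)) ℝ :=
  blockSign n * mc F h z * blockSign n

/-- The reflection in the subspace spanned by the first four columns of the frame. -/
def frameReflection (F : ℂ → SOPlus n) (z : ℂ) : Matrix (Fin (n + 4)) (Fin (n + 4)) ℝ :=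
  mat (F z) * blockSign n * mat (F z)⁻¹

variable {F : ℂ → SOPlus n}

lemma smooth_mat_inv (hF : MSmooth U fun w => mat (F w)) : MSmooth U fun w => mat (F w)⁻¹ := by
  simp only [mat_inv]
  exact ((MSmooth.const _).mul hF.transpose).mul (MSmooth.const _)

lemma smooth_mc (hU : IsOpen U) (hF : MSmooth U fun w => mat (F w)) (h : ℂ) :
    MSmooth U (mc F h) := (smooth_mat_inv hF).mul (hF.mdd hU h)

lemma smooth_mcInv (hU : IsOpen U) (hF : MSmooth U fun w => mat (F w)) (h : ℂ) :
    MSmooth U (mcInv F h) :=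
  ((MSmooth.const _).mul (smooth_mc hU hF h)).mul (MSmooth.const _)

lemma smooth_frameReflection (hF : MSmooth U fun w => mat (F w)) :
    MSmooth U (frameReflection F) := (hF.mul (MSmooth.const _)).mul (smooth_mat_inv hF)

lemma mdd_const_mul_mul_const (hU : IsOpen U)
    {A : ℂ → Matrix (Fin (n + 4)) (Fin (n + 4)) ℝ} (hA : MSmooth U A) (hz : z ∈ U) (h : ℂ)
    (C D : Matrix (Fin (n + 4)) (Fin (n + 4)) ℝ) :
    mdd h (fun w => C * A w * D) z = C * mdd h A z * D := by
  rw [mdd_mul hU ((MSmooth.const C).mul hA) (MSmooth.const D) hz,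
    mdd_mul hU (MSmooth.const C) hA hz, mdd_const, mdd_const, zero_mul, zero_add, mul_zero,
    add_zero]

lemma mdd_mcInv (hU : IsOpen U) (hF : MSmooth U fun w => mat (F w)) (hz : z ∈ U) (h k : ℂ) :
    mdd h (mcInv F k) z = blockSign n * mdd h (mc F k) z * blockSign n :=
  mdd_const_mul_mul_const hU (smooth_mc hU hF k) hz h _ _

lemma mat_mul_mc (h : ℂ) : mat (F z) * mc F h z = mdd h (fun w => mat (F w)) z := by
  rw [mc, ← mul_assoc, mat_mul_inv, one_mul]

lemma mdd_mat_inv (hU : IsOpen U) (hF : MSmooth U fun w => mat (F w)) (hz : z ∈ U) (h : ℂ) :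
    mdd h (fun w => mat (F w)⁻¹) z = -(mc F h z * mat (F z)⁻¹) := by
  have h1 := mdd_mul hU (smooth_mat_inv hF) hF hz h
  rw [mdd_congr hU h (B := fun _ => 1) (fun w _ => mat_inv_mul (F w)) hz, mdd_const] at h1
  have h2 := congrArg (· * mat (F z)⁻¹) h1
  simp only [zero_mul, add_mul, mul_assoc, mat_mul_inv, mul_one] at h2
  rw [mc, mul_assoc]
  exact eq_neg_of_add_eq_zero_left h2.symm

lemma mdd_mc (hU : IsOpen U) (hF : MSmooth U fun w => mat (F w)) (hz : z ∈ U) (h k : ℂ) :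
    mdd h (mc F k) z = -(mc F h z * mc F k z)
      + mat (F z)⁻¹ * mdd h (mdd k fun w => mat (F w)) z := by
  have h1 : mdd h (mc F k) z = _ := mdd_mul hU (smooth_mat_inv hF) (hF.mdd hU k) hz h
  rw [h1, mdd_mat_inv hU hF hz, neg_mul, mul_assoc]
  rfl

/-- The Maurer–Cartan equation. -/
lemma maurerCartan (hU : IsOpen U) (hF : MSmooth U fun w => mat (F w)) (hz : z ∈ U) (h k : ℂ) :
    mdd h (mc F k) z - mdd k (mc F h) z + (mc F h z * mc F k z - mc F k z * mc F h z) = 0 := by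
  rw [mdd_mc hU hF hz, mdd_mc hU hF hz, mdd_comm hU hF hz h k]
  abel

lemma mcInv_mul (h k : ℂ) : mcInv F h z * mcInv F k z =
    blockSign n * (mc F h z * mc F k z) * blockSign n := by
  calc mcInv F h z * mcInv F k z = blockSign n * mc F h z * (blockSign n * blockSign n)
        * mc F k z * blockSign n := by simp only [mcInv, mul_assoc]
    _ = _ := by rw [blockSign_mul_self, mul_one]; simp only [mul_assoc]

lemma maurerCartan_inv (hU : IsOpen U) (hF : MSmooth U fun w => mat (F w)) (hz : z ∈ U)
    (h k : ℂ) : mdd h (mcInv F k) z - mdd k (mcInv F h) z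
      + (mcInv F h z * mcInv F k z - mcInv F k z * mcInv F h z) = 0 := by
  have h1 := congrArg (fun X => blockSign n * X * blockSign n) (maurerCartan hU hF hz h k)
  simp only [mul_zero, zero_mul] at h1
  rw [mdd_mcInv hU hF hz, mdd_mcInv hU hF hz, mcInv_mul, mcInv_mul, ← h1]
  noncomm_ring

/-- The tension of the reflection field in the frame. -/
def frameTension (F : ℂ → SOPlus n) (h z : ℂ) : Matrix (Fin (n + 4)) (Fin (n + 4)) ℝ :=
  mdd h (mc F h) z - mdd h (mcInv F h) z
    + (mcInv F h z * mc F h z - mc F h z * mcInv F h z)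

lemma mdd_frameReflection (hU : IsOpen U) (hF : MSmooth U fun w => mat (F w)) (hz : z ∈ U)
    (h : ℂ) : mdd h (frameReflection F) z =
      mat (F z) * (mc F h z * blockSign n - blockSign n * mc F h z) * mat (F z)⁻¹ := by
  have h1 : mdd h (frameReflection F) z = _ :=
    mdd_mul hU (hF.mul (MSmooth.const (blockSign n))) (smooth_mat_inv hF) hz h
  rw [h1, mdd_mul hU hF (MSmooth.const _) hz, mdd_const, mdd_mat_inv hU hF hz, ← mat_mul_mc]
  noncomm_ring

/-- Up to conjugation by the frame, `Q_h Q` is twice the `𝔪`-part of the Maurer–Cartan form. This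
links the reflection field to the loop of connections. -/
lemma mdd_frameReflection_mul (hU : IsOpen U) (hF : MSmooth U fun w => mat (F w)) (hz : z ∈ U)
    (h : ℂ) : mdd h (frameReflection F) z * frameReflection F z =
      mat (F z) * (mc F h z - mcInv F h z) * mat (F z)⁻¹ := by
  rw [mdd_frameReflection hU hF hz, frameReflection]
  calc mat (F z) * (mc F h z * blockSign n - blockSign n * mc F h z) * mat (F z)⁻¹ *
        (mat (F z) * blockSign n * mat (F z)⁻¹)
      = mat (F z) * (mc F h z * blockSign n - blockSign n * mc F h z) *
        (mat (F z)⁻¹ * mat (F z)) * blockSign n * mat (F z)⁻¹ := by simp only [mul_assoc]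
    _ = mat (F z) * (mc F h z * (blockSign n * blockSign n)
        - blockSign n * mc F h z * blockSign n) * mat (F z)⁻¹ := by
        rw [mat_inv_mul, mul_one]
        noncomm_ring
    _ = _ := by rw [blockSign_mul_self, mul_one, mcInv]

lemma tension_frameReflection_aux (hU : IsOpen U) (hF : MSmooth U fun w => mat (F w))
    (hz : z ∈ U) (h : ℂ) :
    mdd h (mdd h (frameReflection F)) z * frameReflection F z
      + mdd h (frameReflection F) z * mdd h (frameReflection F) z =
      mat (F z) * frameTension F h z * mat (F z)⁻¹ := by
  have hQ := smooth_frameReflection hF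
  have hd := (smooth_mc hU hF h).sub (smooth_mcInv hU hF h)
  rw [← mdd_mul hU (hQ.mdd hU h) hQ hz,
    mdd_congr hU h (fun w hw => mdd_frameReflection_mul hU hF hw h) hz,
    mdd_mul hU (hF.mul hd) (smooth_mat_inv hF) hz, mdd_mul hU hF hd hz,
    mdd_sub hU (smooth_mc hU hF h) (smooth_mcInv hU hF h) hz, mdd_mat_inv hU hF hz, ← mat_mul_mc,
    frameTension]
  noncomm_ring

lemma tension_frameReflection (hU : IsOpen U) (hF : MSmooth U fun w => mat (F w))
    (hz : z ∈ U) : tension (frameReflection F) z =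
      mat (F z) * (frameTension F 1 z + frameTension F Complex.I z) * mat (F z)⁻¹ := by
  rw [tension, tension_frameReflection_aux hU hF hz, tension_frameReflection_aux hU hF hz]
  noncomm_ring

/-- The involution exchanges `mc` and `mcInv`, and the tension is antisymmetric under this exchange;
it is therefore `𝔪`-valued. -/
lemma blockSign_conj_frameTension (hU : IsOpen U) (hF : MSmooth U fun w => mat (F w))
    (hz : z ∈ U) (h : ℂ) :
    blockSign n * frameTension F h z * blockSign n = -frameTension F h z := by
  have hS : blockSign n * blockSign n = 1 := blockSign_mul_self
  have hS' (X : Matrix (Fin (n + 4)) (Fin (n + 4)) ℝ) :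
      blockSign n * (blockSign n * X) = X := by rw [← mul_assoc, hS, one_mul]
  rw [frameTension, mdd_mcInv hU hF hz, mcInv]
  simp only [mul_add, mul_sub, add_mul, sub_mul, mul_assoc, hS, hS', mul_one]
  abel

/-- Skewness with respect to the Lorentzian inner product. -/
def IsSkew (A : Matrix (Fin (n + 4)) (Fin (n + 4)) ℝ) : Prop :=
  Aᵀ = -(minkowski n * A * minkowski n)

variable {A B : Matrix (Fin (n + 4)) (Fin (n + 4)) ℝ}

lemma IsSkew.add (hA : IsSkew A) (hB : IsSkew B) : IsSkew (A + B) := by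
  rw [IsSkew, Matrix.transpose_add, hA, hB]
  noncomm_ring

lemma IsSkew.sub (hA : IsSkew A) (hB : IsSkew B) : IsSkew (A - B) := by
  rw [IsSkew, Matrix.transpose_sub, hA, hB]
  noncomm_ring

lemma IsSkew.commutator (hA : IsSkew A) (hB : IsSkew B) : IsSkew (A * B - B * A) := by
  have hJ (X : Matrix (Fin (n + 4)) (Fin (n + 4)) ℝ) :
      minkowski n * (minkowski n * X) = X := by rw [← mul_assoc, minkowski_mul_self, one_mul]
  rw [IsSkew, Matrix.transpose_sub, Matrix.transpose_mul, Matrix.transpose_mul, hA, hB]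
  simp only [neg_mul_neg, mul_assoc, mul_sub, sub_mul, hJ]
  abel

lemma IsSkew.conj (hA : IsSkew A) : IsSkew (blockSign n * A * blockSign n) := by
  have hST : (blockSign n)ᵀ = blockSign n := by rw [blockSign, Matrix.diagonal_transpose]
  have hc : blockSign n * minkowski n = minkowski n * blockSign n := by
    rw [blockSign, minkowski_eq, Matrix.diagonal_mul_diagonal, Matrix.diagonal_mul_diagonal]
    simp only [mul_comm]
  rw [IsSkew, Matrix.transpose_mul, Matrix.transpose_mul, hA, hST]
  calc blockSign n * (-(minkowski n * A * minkowski n) * blockSign n)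
      = -(blockSign n * minkowski n * A * (minkowski n * blockSign n)) := by noncomm_ring
    _ = -(minkowski n * blockSign n * A * (blockSign n * minkowski n)) := by rw [hc]
    _ = _ := by noncomm_ring

/-- This is the derivative of `Fᵀ J F = J`, with `J = minkowski n`, transported by `F⁻¹ = J Fᵀ J`.
-/
lemma isSkew_mc (hU : IsOpen U) (hF : MSmooth U fun w => mat (F w)) (hz : z ∈ U) (h : ℂ) :
    IsSkew (mc F h z) := by
  have h1 := mdd_mul hU (hF.transpose.mul (MSmooth.const (minkowski n))) hF hz h
  rw [mdd_congr hU h (B := fun _ => minkowski n) (fun w _ => mat_lorentz (F w)) hz, mdd_const,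
    mdd_mul hU hF.transpose (MSmooth.const _) hz, mdd_const, mul_zero, add_zero,
    mdd_transpose] at h1
  have hJT : (minkowski n)ᵀ = minkowski n := by rw [minkowski_eq, Matrix.diagonal_transpose]
  have hJ (X : Matrix (Fin (n + 4)) (Fin (n + 4)) ℝ) :
      minkowski n * (minkowski n * X) = X := by rw [← mul_assoc, minkowski_mul_self, one_mul]
  have h2 := eq_neg_of_add_eq_zero_left h1.symm
  rw [IsSkew, mc, mat_inv, Matrix.transpose_mul, Matrix.transpose_mul, Matrix.transpose_mul, hJT,
    Matrix.transpose_transpose]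
  simp only [mul_assoc, hJ] at h2 ⊢
  rw [← mul_assoc (minkowski n) (mat (F z)) (minkowski n), ← mul_assoc, h2]
  noncomm_ring

lemma isSkew_mdd (hU : IsOpen U) {A : ℂ → Matrix (Fin (n + 4)) (Fin (n + 4)) ℝ}
    (hA : MSmooth U A) (hs : ∀ w ∈ U, IsSkew (A w)) (hz : z ∈ U) (h : ℂ) :
    IsSkew (mdd h A z) := by
  have h1 : ∀ w ∈ U, (A w)ᵀ = (-1 : ℝ) • (minkowski n * A w * minkowski n) := fun w hw => by
    rw [hs w hw, neg_one_smul]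
  have h2 := mdd_congr hU h h1 hz
  rw [mdd_transpose, mdd_smul hU _ (((MSmooth.const _).mul hA).mul (MSmooth.const _)) hz,
    mdd_const_mul_mul_const hU hA hz, neg_one_smul] at h2
  exact h2

lemma isSkew_frameTension (hU : IsOpen U) (hF : MSmooth U fun w => mat (F w)) (hz : z ∈ U)
    (h : ℂ) : IsSkew (frameTension F h z) := by
  have h1 := isSkew_mdd hU (smooth_mc hU hF h) (fun w hw => isSkew_mc hU hF hw h) hz h
  have h2 : IsSkew (mcInv F h z) := (isSkew_mc hU hF hz h).conj
  have h3 : IsSkew (mdd h (mcInv F h) z) := by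
    rw [mdd_mcInv hU hF hz]
    exact h1.conj
  exact (h1.sub h3).add (h2.commutator (isSkew_mc hU hF hz h))

/-- A skew matrix anticommuting with the block reflection vanishes if its first four columns do. -/
lemma eq_zero_of_isSkew (hA : IsSkew A) (hS : blockSign n * A * blockSign n = -A)
    (h0 : ∀ i j, A i (lead n j) = 0) : A = 0 := by
  have hcol (i j : Fin (n + 4)) (hj : j.1 < 4) : A i j = 0 := by
    obtain ⟨j, rfl⟩ := exists_lead hj
    exact h0 i j
  ext i j
  rw [Matrix.zero_apply]
  by_cases hj : j.1 < 4
  · exact hcol i j hj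
  · by_cases hi : i.1 < 4
    -- Skewness identifies the upper right block, up to signs, with the transpose of the vanishing
    -- lower left block. The lower right block is excluded by anticommutation.
    · have := congrFun (congrFun hA j) i
      rw [Matrix.transpose_apply, Matrix.neg_apply, minkowski_eq, Matrix.mul_diagonal,
        Matrix.diagonal_mul, hcol j i hi] at this
      simpa using this
    · have := congrFun (congrFun hS i) j
      rw [blockSign_conj_apply, if_pos (by simp [SameBlock, hi, hj]), Matrix.neg_apply] at this
      linarith

end MaurerCartan

/-! ### The harmonic map equation in an adapted frame. -/

section Harmonic

variable {n : ℕ} {U : Set ℂ} {z : ℂ} {F : ℂ → SOPlus n} {y : ℂ → Euc n}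

/-- The Lorentzian inner product with a fixed vector as a linear map. -/
def minkLin (x : Fin (n + 4) → ℝ) : (Fin (n + 4) → ℝ) →ₗ[ℝ] ℝ where
  toFun := mink x
  map_add' := mink_add_right x
  map_smul' c v := mink_smul_right c x v

lemma isGaussReflection_frame (hU : IsOpen U) (hy : IsConformalImmersion U y)
    (hF : MSmooth U fun w => mat (F w))
    (hlead : ∀ w ∈ U, ∀ j, (mat (F w))ᵀ (lead n j) = gaussBasis y w j) :
    IsGaussReflection U y (frameReflection F) := by
  have hfix {w : ℂ} (hw : w ∈ U) (j : Fin 4) :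
      gaussBasis y w j ∈ LinearMap.ker (LinearMap.id - (frameReflection F w).mulVecLin) := by
    rw [LinearMap.mem_ker, LinearMap.sub_apply, LinearMap.id_apply, Matrix.mulVecLin_apply,
      sub_eq_zero, ← hlead w hw j]
    have h1 : (mat (F w))ᵀ (lead n j) = mat (F w) *ᵥ Pi.single (lead n j) 1 := by
      rw [Matrix.mulVec_single_one]
      rfl
    have h2 : blockSign n *ᵥ Pi.single (lead n j) 1 = Pi.single (lead n j) 1 := by
      ext i
      rw [blockSign, Matrix.mulVec_diagonal]
      by_cases hi : i = lead n j
      · subst hi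
        simp [lead_val]
      · simp [hi]
    rw [h1, frameReflection, Matrix.mulVec_mulVec, mul_assoc, mul_assoc, mat_inv_mul, mul_one,
      ← Matrix.mulVec_mulVec, h2]
  have hall {w : ℂ} (hw : w ∈ U) := (gaussBasis_mem hU hy hw _).mp (hfix hw)
  simp only [LinearMap.mem_ker, LinearMap.sub_apply, LinearMap.id_apply, Matrix.mulVecLin_apply,
    sub_eq_zero] at hall
  refine ⟨smooth_frameReflection hF, fun w hw => (hall hw).1.symm, fun w hw => (hall hw).2.1.symm,
    fun w hw => (hall hw).2.2.1.symm, fun w hw => (hall hw).2.2.2.symm, ?_⟩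
  intro w hw x h1 h2 h3 h4
  have hx (j : Fin 4) : mink x ((mat (F w))ᵀ (lead n j)) = 0 := by
    rw [hlead w hw]
    exact (gaussBasis_mem hU hy hw (LinearMap.ker (minkLin x))).mpr ⟨h1, h2, h3, h4⟩ j
  -- The coordinates of `x` in the frame are, up to sign, its products with the columns. If the
  -- first four vanish, `blockSign n` acts on these coordinates as `-1`.
  have hG (i : Fin (n + 4)) : (mat (F w)⁻¹ *ᵥ x) i = sgn n i * mink x ((mat (F w))ᵀ i) := by
    rw [mat_inv, ← Matrix.mulVec_mulVec, ← Matrix.mulVec_mulVec, minkowski_eq,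
      Matrix.mulVec_diagonal, mink_comm, mink_eq_dotProduct, minkowski_eq]
    rfl
  have hS : blockSign n *ᵥ (mat (F w)⁻¹ *ᵥ x) = -(mat (F w)⁻¹ *ᵥ x) := by
    ext i
    rw [blockSign, Matrix.mulVec_diagonal, Pi.neg_apply]
    by_cases hi : i.1 < 4
    · obtain ⟨j, rfl⟩ := exists_lead hi
      rw [hG, hx]
      simp
    · simp [hi]
  rw [frameReflection, ← Matrix.mulVec_mulVec, ← Matrix.mulVec_mulVec, hS, Matrix.mulVec_neg,
    Matrix.mulVec_mulVec, mat_mul_inv, Matrix.one_mulVec]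

/-- The harmonic map equation in an adapted frame. -/
lemma frameTension_eq_zero (hU : IsOpen U) (hy : IsConformalImmersion U y)
    (hF : MSmooth U fun w => mat (F w))
    (hlead : ∀ w ∈ U, ∀ j, (mat (F w))ᵀ (lead n j) = gaussBasis y w j)
    (hEL : ∀ w ∈ U, eulerLagrange y w = 0) (hz : z ∈ U) :
    frameTension F 1 z + frameTension F Complex.I z = 0 := by
  refine eq_zero_of_isSkew
    ((isSkew_frameTension hU hF hz 1).add (isSkew_frameTension hU hF hz Complex.I)) ?_ ?_
  · rw [mul_add, add_mul, blockSign_conj_frameTension hU hF hz,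
      blockSign_conj_frameTension hU hF hz, neg_add]
  · intro i j
    -- The Gauss basis gives the leading columns of `F`. Conjugated by `F`, its annihilation by the
    -- tension says that the first four columns of the frame tension vanish.
    have h1 := (isGaussReflection_frame hU hy hF hlead).tension_mulVec_gaussBasis hU hy hEL hz j
    have h2 : (mat (F z))ᵀ (lead n j) = mat (F z) *ᵥ Pi.single (lead n j) 1 := by
      rw [Matrix.mulVec_single_one]
      rfl
    rw [← hlead z hz, h2, tension_frameReflection hU hF hz, Matrix.mulVec_mulVec, mul_assoc,
      mat_inv_mul, mul_one] at h1
    have h3 := congrArg (mat (F z)⁻¹ *ᵥ ·) h1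
    simp only [Matrix.mulVec_mulVec, Matrix.mulVec_zero, ← mul_assoc, mat_inv_mul,
      one_mul] at h3
    rw [Matrix.mulVec_single_one] at h3
    exact congrFun h3 i

end Harmonic

/-! ### Flatness of the loop of connections. -/

section Loop

variable {n : ℕ} {U : Set ℂ} {z : ℂ} {F : ℂ → SOPlus n}

/-- The `𝔨`-part of the Maurer–Cartan coefficient. -/
def mcK (F : ℂ → SOPlus n) (h z : ℂ) : Matrix (Fin (n + 4)) (Fin (n + 4)) ℝ :=
  (1 / 2 : ℝ) • (mc F h z + mcInv F h z)

/-- The `𝔪`-part of the Maurer–Cartan coefficient. -/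
def mcP (F : ℂ → SOPlus n) (h z : ℂ) : Matrix (Fin (n + 4)) (Fin (n + 4)) ℝ :=
  (1 / 2 : ℝ) • (mc F h z - mcInv F h z)

/-- Complexification of a real matrix. -/
def cplx (A : Matrix (Fin (n + 4)) (Fin (n + 4)) ℝ) : Matrix (Fin (n + 4)) (Fin (n + 4)) ℂ :=
  A.map Complex.ofReal

lemma cplx_add (A B : Matrix (Fin (n + 4)) (Fin (n + 4)) ℝ) :
    cplx (A + B) = cplx A + cplx B := by
  ext i j
  simp [cplx]

lemma cplx_sub (A B : Matrix (Fin (n + 4)) (Fin (n + 4)) ℝ) :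
    cplx (A - B) = cplx A - cplx B := by
  ext i j
  simp [cplx]

lemma cplx_mul (A B : Matrix (Fin (n + 4)) (Fin (n + 4)) ℝ) :
    cplx (A * B) = cplx A * cplx B := by
  ext i j
  simp [cplx, Matrix.mul_apply]

lemma cplx_zero : cplx (0 : Matrix (Fin (n + 4)) (Fin (n + 4)) ℝ) = 0 := by
  ext i j
  simp [cplx]

lemma kPart_mc (h : ℂ) : kPart (mc F h z) = cplx (mcK F h z) := by
  ext i j
  simp only [kPart, cplx, mcK, mcInv, Matrix.of_apply, Matrix.map_apply, Matrix.smul_apply,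
    Matrix.add_apply, blockSign_conj_apply, smul_eq_mul]
  split_ifs
  · congr 1
    ring
  · simp

lemma mPart_mc (h : ℂ) : mPart (mc F h z) = cplx (mcP F h z) := by
  ext i j
  simp only [mPart, cplx, mcP, mcInv, Matrix.of_apply, Matrix.map_apply, Matrix.smul_apply,
    Matrix.sub_apply, blockSign_conj_apply, smul_eq_mul]
  split_ifs
  · simp
  · congr 1
    ring

lemma mcU_eq : mcU F z = mc F 1 z := rfl

lemma mcV_eq : mcV F z = mc F Complex.I z := rfl

/-- For `l = exp (iθ)` the two coefficients are `cos θ` and `sin θ`: the loop parameter rotates the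
pair of `𝔪`-coefficients `(mcP F 1, mcP F I)` and leaves the `𝔨`-part alone. -/
lemma loopU_eq (l : ℂ) : loopU F l z = cplx (mcK F 1 z) + ((l + l⁻¹) / 2) • cplx (mcP F 1 z)
    - (Complex.I * (l⁻¹ - l) / 2) • cplx (mcP F Complex.I z) := by
  rw [loopU, mcM', mcM'', mcU_eq, mcV_eq, kPart_mc, mPart_mc, mPart_mc]
  module

lemma loopV_eq (l : ℂ) : loopV F l z = cplx (mcK F Complex.I z)
    + (Complex.I * (l⁻¹ - l) / 2) • cplx (mcP F 1 z)
    + ((l + l⁻¹) / 2) • cplx (mcP F Complex.I z) := by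
  have hI : Complex.I * (Complex.I * l⁻¹) = -l⁻¹ := by
    rw [← mul_assoc, Complex.I_mul_I, neg_one_mul]
  have hI' : Complex.I * (Complex.I * l) = -l := by
    rw [← mul_assoc, Complex.I_mul_I, neg_one_mul]
  rw [loopV, mcM', mcM'', mcU_eq, mcV_eq, kPart_mc, mPart_mc, mPart_mc]
  have e : Complex.I • (l⁻¹ • (1 / 2 : ℂ) • (cplx (mcP F 1 z) - Complex.I • cplx (mcP F Complex.I z))
      - l • (1 / 2 : ℂ) • (cplx (mcP F 1 z) + Complex.I • cplx (mcP F Complex.I z)))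
      = (Complex.I * (l⁻¹ - l) / 2) • cplx (mcP F 1 z)
        - ((Complex.I * (Complex.I * l⁻¹) + Complex.I * (Complex.I * l)) / 2) •
          cplx (mcP F Complex.I z) := by module
  rw [e, hI, hI']
  module

lemma smooth_mcK (hU : IsOpen U) (hF : MSmooth U fun w => mat (F w)) (h : ℂ) :
    MSmooth U (mcK F h) := ((smooth_mc hU hF h).add (smooth_mcInv hU hF h)).smul _

lemma smooth_mcP (hU : IsOpen U) (hF : MSmooth U fun w => mat (F w)) (h : ℂ) :
    MSmooth U (mcP F h) := ((smooth_mc hU hF h).sub (smooth_mcInv hU hF h)).smul _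

lemma mdd_mcK (hU : IsOpen U) (hF : MSmooth U fun w => mat (F w)) (hz : z ∈ U) (h k : ℂ) :
    mdd h (mcK F k) z = (1 / 2 : ℝ) • (mdd h (mc F k) z + mdd h (mcInv F k) z) := by
  have h1 : mdd h (mcK F k) z = _ :=
    mdd_smul hU (1 / 2) ((smooth_mc hU hF k).add (smooth_mcInv hU hF k)) hz h
  rw [h1, mdd_add hU (smooth_mc hU hF k) (smooth_mcInv hU hF k) hz]

lemma mdd_mcP (hU : IsOpen U) (hF : MSmooth U fun w => mat (F w)) (hz : z ∈ U) (h k : ℂ) :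
    mdd h (mcP F k) z = (1 / 2 : ℝ) • (mdd h (mc F k) z - mdd h (mcInv F k) z) := by
  have h1 : mdd h (mcP F k) z = _ :=
    mdd_smul hU (1 / 2) ((smooth_mc hU hF k).sub (smooth_mcInv hU hF k)) hz h
  rw [h1, mdd_sub hU (smooth_mc hU hF k) (smooth_mcInv hU hF k) hz]

/-- The `𝔨`-part of the Maurer–Cartan equation. -/
lemma maurerCartan_k (hU : IsOpen U) (hF : MSmooth U fun w => mat (F w)) (hz : z ∈ U) (h k : ℂ) :
    mdd h (mcK F k) z - mdd k (mcK F h) z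
      + (mcK F h z * mcK F k z - mcK F k z * mcK F h z)
      + (mcP F h z * mcP F k z - mcP F k z * mcP F h z) = 0 := by
  have h1 := maurerCartan hU hF hz h k
  have h2 := maurerCartan_inv hU hF hz h k
  have h3 : (1 / 2 : ℝ) • (_ + _) = (0 : Matrix (Fin (n + 4)) (Fin (n + 4)) ℝ) :=
    (congrArg₂ (fun X Y => (1 / 2 : ℝ) • (X + Y)) h1 h2).trans (by simp)
  rw [mdd_mcK hU hF hz, mdd_mcK hU hF hz, ← h3]
  simp only [mcK, mcP, Matrix.smul_mul, Matrix.mul_smul, mul_add, add_mul, mul_sub, sub_mul]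
  module

/-- The `𝔪`-part of the Maurer–Cartan equation. -/
lemma maurerCartan_p (hU : IsOpen U) (hF : MSmooth U fun w => mat (F w)) (hz : z ∈ U) (h k : ℂ) :
    mdd h (mcP F k) z - mdd k (mcP F h) z
      + (mcK F h z * mcP F k z - mcP F k z * mcK F h z)
      + (mcP F h z * mcK F k z - mcK F k z * mcP F h z) = 0 := by
  have h1 := maurerCartan hU hF hz h k
  have h2 := maurerCartan_inv hU hF hz h k
  have h3 : (1 / 2 : ℝ) • (_ - _) = (0 : Matrix (Fin (n + 4)) (Fin (n + 4)) ℝ) :=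
    (congrArg₂ (fun X Y => (1 / 2 : ℝ) • (X - Y)) h1 h2).trans (by simp)
  rw [mdd_mcP hU hF hz, mdd_mcP hU hF hz, ← h3]
  simp only [mcK, mcP, Matrix.smul_mul, Matrix.mul_smul, mul_add, add_mul, mul_sub, sub_mul]
  module

/-- The left side is the covariant derivative of the `𝔪`-part, the form in which the tension occurs
in the curvature of the loop. -/
lemma frameTension_eq (hU : IsOpen U) (hF : MSmooth U fun w => mat (F w)) (hz : z ∈ U) (h : ℂ) :
    mdd h (mcP F h) z + (mcK F h z * mcP F h z - mcP F h z * mcK F h z)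
      = (1 / 2 : ℝ) • frameTension F h z := by
  rw [mdd_mcP hU hF hz, frameTension]
  simp only [mcK, mcP, Matrix.smul_mul, Matrix.mul_smul, mul_add, add_mul, mul_sub, sub_mul]
  module

lemma dd_cplx_combination (hU : IsOpen U) {A B C : ℂ → Matrix (Fin (n + 4)) (Fin (n + 4)) ℝ}
    (hA : MSmooth U A) (hB : MSmooth U B) (hC : MSmooth U C) (hz : z ∈ U) (h b c : ℂ)
    (i j : Fin (n + 4)) :
    dd h (fun w => (cplx (A w) + b • cplx (B w) + c • cplx (C w)) i j) z
      = (cplx (mdd h A z) + b • cplx (mdd h B z) + c • cplx (mdd h C z)) i j := by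
  have key {A : ℂ → Matrix (Fin (n + 4)) (Fin (n + 4)) ℝ} (hA : MSmooth U A) (b : ℂ) :
      HasFDerivAt (fun w => b * ((A w i j : ℝ) : ℂ))
        (b • Complex.ofRealCLM.comp (fderiv ℝ (fun w => A w i j) z)) z :=
    (Complex.ofRealCLM.hasFDerivAt.comp z
      (diffAt_of_smooth hU (hA i j) hz).hasFDerivAt).const_mul b
  have h1 := ((key hA 1).fun_add (key hB b)).fun_add (key hC c)
  have h2 : (fun w => (cplx (A w) + b • cplx (B w) + c • cplx (C w)) i j)
      = fun w => 1 * ((A w i j : ℝ) : ℂ) + b * ((B w i j : ℝ) : ℂ) + c * ((C w i j : ℝ) : ℂ) := by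
    funext w
    simp [cplx]
  rw [h2, dd, h1.fderiv]
  simp [cplx, mdd, dd]

/-- The loop of flat connections of a frame satisfying the harmonic map equation. -/
lemma loopIntegrable_of_frameTension (hU : IsOpen U) (hF : MSmooth U fun w => mat (F w))
    (hτ : ∀ w ∈ U, frameTension F 1 w + frameTension F Complex.I w = 0) {l : ℂ} (hl : l ≠ 0) :
    LoopIntegrable U F l := by
  intro z hz i j
  have hk := congrArg cplx (maurerCartan_k hU hF hz 1 Complex.I)
  have hp := congrArg cplx (maurerCartan_p hU hF hz 1 Complex.I)
  have ht : mdd 1 (mcP F 1) z + (mcK F 1 z * mcP F 1 z - mcP F 1 z * mcK F 1 z)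
      + (mdd Complex.I (mcP F Complex.I) z
        + (mcK F Complex.I z * mcP F Complex.I z - mcP F Complex.I z * mcK F Complex.I z)) = 0 := by
    rw [frameTension_eq hU hF hz, frameTension_eq hU hF hz, ← smul_add, hτ z hz, smul_zero]
  have ht := congrArg cplx ht
  simp only [cplx_add, cplx_sub, cplx_mul, cplx_zero] at hk hp ht
  set c : ℂ := (l + l⁻¹) / 2 with hc
  set s : ℂ := Complex.I * (l⁻¹ - l) / 2 with hs
  -- This algebraic form of `cos² + sin² = 1` holds for every nonzero `l`, on the unit circle or
  -- not.
  have hcs : c * c + s * s = 1 := by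
    have hI : Complex.I ^ 2 = -1 := Complex.I_sq
    rw [hc, hs]
    field_simp
    rw [hI]
    ring
  have hV : (fun w => loopV F l w i j) = fun w => (cplx (mcK F Complex.I w)
      + s • cplx (mcP F 1 w) + c • cplx (mcP F Complex.I w)) i j := funext fun w => by rw [loopV_eq]
  have hUU : (fun w => loopU F l w i j) = fun w => (cplx (mcK F 1 w)
      + c • cplx (mcP F 1 w) + (-s) • cplx (mcP F Complex.I w)) i j := funext fun w => by
    rw [loopU_eq, neg_smul, ← sub_eq_add_neg]
  have sK := smooth_mcK hU hF
  have sP := smooth_mcP hU hF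
  rw [hV, hUU, du_eq_dd, dv_eq_dd, dd_cplx_combination hU (sK _) (sP _) (sP _) hz,
    dd_cplx_combination hU (sK _) (sP _) (sP _) hz, loopU_eq, loopV_eq, ← hc, ← hs,
    ← Matrix.sub_apply, ← Matrix.add_apply]
  have hmat : cplx (mdd 1 (mcK F Complex.I) z) + s • cplx (mdd 1 (mcP F 1) z)
        + c • cplx (mdd 1 (mcP F Complex.I) z)
      - (cplx (mdd Complex.I (mcK F 1) z) + c • cplx (mdd Complex.I (mcP F 1) z)
        + (-s) • cplx (mdd Complex.I (mcP F Complex.I) z))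
      + ((cplx (mcK F 1 z) + c • cplx (mcP F 1 z) - s • cplx (mcP F Complex.I z))
          * (cplx (mcK F Complex.I z) + s • cplx (mcP F 1 z) + c • cplx (mcP F Complex.I z))
        - (cplx (mcK F Complex.I z) + s • cplx (mcP F 1 z) + c • cplx (mcP F Complex.I z))
          * (cplx (mcK F 1 z) + c • cplx (mcP F 1 z) - s • cplx (mcP F Complex.I z))) = 0 := by
    simp only [mul_add, add_mul, mul_sub, sub_mul, Matrix.smul_mul, Matrix.mul_smul]
    -- The `𝔨`-component of the curvature is the `𝔨`-part of the Maurer–Cartan equation, with the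
    -- bracket of the `𝔪`-parts multiplied by `c² + s² = 1`. The `𝔪`-component is `s` times the
    -- tension plus `c` times the `𝔪`-part of the Maurer–Cartan equation.
    linear_combination (norm := module) hk + s • ht + c • hp
      + hcs • (cplx (mcP F 1 z) * cplx (mcP F Complex.I z)
        - cplx (mcP F Complex.I z) * cplx (mcP F 1 z))
  rw [hmat, Matrix.zero_apply]

end Loop

/-! ### Harmonicity of the Gauss map and the equivalence of periods. -/

section Main

variable {n : ℕ} {Ω : Set ℂ} {y : ℂ → Euc n} {f : ℂ → Gr n}

lemma IsConformalImmersion.mono {U : Set ℂ} (hy : IsConformalImmersion Ω y) (hU : U ⊆ Ω) :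
    IsConformalImmersion U y :=
  ⟨hy.smooth.mono hU, fun z hz => hy.mem_sphere z (hU hz), fun z hz => hy.norm_eq z (hU hz),
    fun z hz => hy.orthogonal z (hU hz), fun z hz => hy.immersed z (hU hz)⟩

/-- The conformal Gauss map of a Willmore immersion is harmonic. -/
theorem isHarmonicMap_of_isWillmore (hΩ : IsOpen Ω) (hy : IsConformalImmersion Ω y)
    (hW : IsWillmore Ω y) (hf : IsConformalGaussMap Ω y f) : IsHarmonicMap Ω f := by
  intro z₀ hz₀
  obtain ⟨U, F, hU, hzU, hUΩ, hfr, hlead⟩ := exists_adapted_frame hΩ hy hf hz₀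
  refine ⟨U, F, hU, hzU, hUΩ, hfr, fun l hl => ?_⟩
  have hl0 : l ≠ 0 := fun h => by simp [h] at hl
  exact loopIntegrable_of_frameTension hU hfr.smooth (fun w hw =>
    frameTension_eq_zero hU (hy.mono hUΩ) hfr.smooth hlead
      (fun w hw => eulerLagrange_eq_zero hΩ hy hW (hUΩ hw)) hw) hl0

end Main

end TEWillmore

end

theorem mainTheorem10 (n : ℕ) (a b : EReal) (hab : a < b)
    (y : ℂ → TEWillmore.Euc n)
    (hy : TEWillmore.IsTEWillmoreSurface (TEWillmore.strip a b) y)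
    (f : ℂ → TEWillmore.Gr n)
    (hf : TEWillmore.IsConformalGaussMap (TEWillmore.strip a b) y f)
    (hfull : TEWillmore.IsFull (TEWillmore.strip a b) f)
    (ω : ℝ) :
    TEWillmore.IsTEWillmoreCylinder (TEWillmore.strip a b) y ω ↔
      TEWillmore.IsTEHarmonicCylinder (TEWillmore.strip a b) f ω := by
  have hΩ := TEWillmore.isOpen_strip a b
  have htr : ∀ (t : ℝ), ∀ z ∈ TEWillmore.strip a b, z + (t : ℂ) ∈ TEWillmore.strip a b :=
    fun t z hz => TEWillmore.add_real_mem_strip hz t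
  obtain ⟨R, hR, hyR⟩ := hy.equivariant
  have hfR : ∀ z ∈ TEWillmore.strip a b, ∀ t : ℝ, f (z + (t : ℂ)) = R t • f z := fun z hz t =>
    TEWillmore.gaussMap_equivariant hΩ hy.conformal hf (htr t) (fun w hw => hyR w hw t) hz
  constructor
  · intro h
    refine ⟨TEWillmore.isHarmonicMap_of_isWillmore hΩ hy.conformal hy.willmore hf, ⟨R, hR, hfR⟩,
      h.period_ne, fun z hz => ?_⟩
    -- Periodicity of `y` says that translation by `ω` is realised by the identity of the group.
    have h1 := TEWillmore.gaussMap_equivariant hΩ hy.conformal hf (htr ω) (g := 1)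
      (fun w hw => by rw [h.periodic w hw, TEWillmore.sphereAct_one]) hz
    rw [h1, one_smul]
  · intro h
    refine ⟨hy, h.period_ne, fun z hz => ?_⟩
    -- `R` is the group moving `y`, which by naturality also moves `f`. Periodicity of `f` makes `R
    -- ω` fix every `f w`, and fullness applies.
    have hmem : R ω ∈ (Subgroup.center (TEWillmore.SOPlus n) : Set (TEWillmore.SOPlus n)) := by
      rw [← hfull]
      intro w hw
      rw [← hfR w hw, h.periodic w hw]
    rw [hyR z hz, TEWillmore.eq_one_of_mem_center hmem, TEWillmore.sphereAct_one]
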